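/- **Setting.** Let $d,K,N\ge 1$. A labelled embedding $(z,y)\in\mathbb R^d\times\{\text{live},\text{spoof}\}$ has the law $D$: with probability $p_0\in(0,1)$ it is live and $z\sim\mathcal N(0,\sigma_0^2 I_d)$; with probability $1-p_0$ it is spoof and $z\sim\sum_{k=1}^K\pi_k\,\mathcal N(\mu_k,\sigma_{\mathrm{eff}}^2 I_d)$, where $\pi_k\ge 0$, $\sum_k\pi_k=1$, $\sigma_0>0$, $\sigma_{\mathrm{eff}}^2=\sigma_0^2+\varepsilon$, $\varepsilon>0$. Let $S=((z_i,y_i))_{i\le N}$ be i.i.d. from $D$, and put $\tilde y_i=-1$ for live, $\tilde y_i=+1$ for spoof. A hypothesis $h$ is a parameter with a score $f_h(z)$; it predicts spoof iff $f_h(z)>0$; $\mathcal R(h)$ is its misclassification probability under $D$ and $\hat{\mathcal R}(h)$ its fraction of errors on $S$. The likelihood is logistic, with negative logarithm $\sum_i\ln(1+e^{-\tilde y_i f_h(z_i)})$. * *Symmetric (linear) IRM:* $h=\beta\in\mathbb R^d$, $f_\beta(z)=\beta^\top z$, prior $\Pi_{\mathrm{sym}}=\mathcal N(0,\sigma_\beta^2I_d)$,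 $\sigma_\beta>0$. * *AsyIRM (radial):* $h=R\in\mathbb R$, $f_R(z)=\|z\|_2^q-R$ with $q\in\{1,2\}$ ($R$ is the radius or the squared radius), prior $\Pi_{\mathrm{asym}}=\mathcal N(\mu_R,\sigma_R^2)$, $\sigma_R>0$. In both cases $\mathcal P$ denotes either the Bayes posterior (proportional to likelihood times prior) or its Laplace approximation $\mathcal N(h_{\mathrm{MAP}},H^{-1})$, where $h_{\mathrm{MAP}}$ minimizes the negative log-posterior and $H=\sum_i c_iz_iz_i^\top+\sigma_\beta^{-2}I_d$, respectively $H=\sum_ic_i+\sigma_R^{-2}$, with $c_i=\sigma(a_i)(1-\sigma(a_i))$, $a_i=\tilde y_if_{h_{\mathrm{MAP}}}(z_i)$, $\sigma(t)=1/(1+e^{-t})$; the claims hold for each of the two choices. **Theorem.** 1. *(Symmetric IRM.)* For all $p_0,\sigma_0,\varepsilon,\sigma_\beta$ and $M>0$ there is a constant $C$ such that for all $d,K,N\ge1$, all weights $\pi_k$, all means with $\|\mu_k\|\le M\sqrt d$, and all $\delta\in(0,1)$, each of the following holds with probability at least $1-\delta$ over $S$: (a) $\mathrm{KL}(\mathcal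 P_{\mathrm{sym}}\|\Pi_{\mathrm{sym}})\le C\,(d+K)\ln(2N/\delta)$; (b) $\mathrm{KL}(\mathcal P_{\mathrm{sym}}\|\Pi_{\mathrm{sym}})<\infty$ and $\mathbb E_{h\sim\mathcal P_{\mathrm{sym}}}\mathcal R(h)\le\mathbb E_{h\sim\mathcal P_{\mathrm{sym}}}\hat{\mathcal R}(h)+\sqrt{\frac{\mathrm{KL}(\mathcal P_{\mathrm{sym}}\|\Pi_{\mathrm{sym}})+\ln(2\sqrt N/\delta)}{2N}}$; (c) $\mathcal R(h)\le\hat{\mathcal R}(h)+\sqrt{\frac{C(d+K)\ln(2N/\delta)}{N}}=\hat{\mathcal R}(h)+\tilde O\big(\sqrt{(d+K)/N}\big)$, both in expectation over $h\sim\mathcal P_{\mathrm{sym}}$ and, with $\mathcal P_{\mathrm{sym}}$-probability at least $1-\delta$, for the drawn $h$ itself. 2. *(AsyIRM.)* For every $\sigma_R>0$ there is a constant $C$, depending on nothing else, in particular not on $d$ or $K$, such that for all $d,K,N\ge1$, all $p_0,\sigma_0,\varepsilon,\pi_k,\mu_k,\mu_R$ as in the setting, both $q$, and all $\delta\in(0,1)$: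 for every sample $S$, (a) $\mathrm{KL}(\mathcal P_{\mathrm{asym}}\|\Pi_{\mathrm{asym}})\le C\big(\ln(2N)+(R_{\mathrm{MAP}}-\mu_R)^2\big)$, and each of the following holds with probability at least $1-\delta$ over $S$: (b) the inequality of 1(b) for $\mathcal P_{\mathrm{asym}},\Pi_{\mathrm{asym}}$; (c) $\mathcal R(h)\le\hat{\mathcal R}(h)+\sqrt{\frac{C\ln(2N/\delta)}{N}}=\hat{\mathcal R}(h)+\tilde O\big(\sqrt{1/N}\big)$, both in expectation over $h\sim\mathcal P_{\mathrm{asym}}$ and, with $\mathcal P_{\mathrm{asym}}$-probability at least $1-\delta$, for the drawn $h$ itself. 3. *(Strictly better scaling.)* For all $C,C',\eta>0$ there is $n_0$ such that $\sqrt{C'\ln(2N/\delta)/N}<\eta\sqrt{C(d+K)\ln(2N/\delta)/N}$ whenever $d+K\ge n_0$, $N\ge1$, $\delta\in(0,1)$. -/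

import Mathlib

open MeasureTheory ProbabilityTheory InformationTheory Filter
open scoped ENNReal RealInnerProductSpace

noncomputable section

namespace AsyIRM

/-- The embedding space `ℝ^d` with its Euclidean norm. -/
abbrev Feature (d : ℕ) : Type := EuclideanSpace ℝ (Fin d)

/-- A labelled embedding `(z, y)`; the label `false` is "live", `true` is "spoof". -/
abbrev Example (d : ℕ) : Type := Feature d × Bool

/-- The signed label: `-1` for live and `+1` for spoof. -/
def signedLabel (y : Bool) : ℝ := if y then 1 else -1

/-! ### The data distribution -/

/-- The isotropic Gaussian `N(m, v I_d)`. -/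
def isoGaussian {d : ℕ} (m : Feature d) (v : ℝ) : Measure (Feature d) :=
  multivariateGaussian m (v • (1 : Matrix (Fin d) (Fin d) ℝ))

/-- The asymmetric live/spoof distribution of a labelled embedding: with probability `p₀` the
example is live and `z ∼ N(0, σ₀² I)`; with probability `1 - p₀` it is spoof and `z` is drawn from
the Gaussian mixture `∑ₖ wₖ N(μₖ, σ_eff² I)`, where `σ_eff² = σ₀² + ε`. -/
def dataLaw {d K : ℕ} (p₀ σ₀ ε : ℝ) (w : Fin K → ℝ) (μ : Fin K → Feature d) :
    Measure (Example d) :=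
  ENNReal.ofReal p₀ • (isoGaussian (0 : Feature d) (σ₀ ^ 2)).prod (Measure.dirac false) +
    ENNReal.ofReal (1 - p₀) •
      (∑ k, ENNReal.ofReal (w k) • isoGaussian (μ k) (σ₀ ^ 2 + ε)).prod (Measure.dirac true)

/-- The law of `N` i.i.d. training examples. -/
def sampleLaw {d : ℕ} (D : Measure (Example d)) (N : ℕ) : Measure (Fin N → Example d) :=
  Measure.pi fun _ => D

/-! ### Classifiers given by a score, and their risks

A hypothesis is a parameter `θ : Θ`; `f θ z` is the score (spoof logit) of the embedding `z`. -/

/-- The hyperplane score `βᵀ z`. -/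
def linearScore {d : ℕ} (β : Feature d) (z : Feature d) : ℝ := ⟪β, z⟫

/-- The radial score `‖z‖ ^ q - R`.  For `q = 1` the parameter `R` is the decision radius itself,
for `q = 2` it is the squared radius. -/
def radialScore {d : ℕ} (q : ℕ) (R : ℝ) (z : Feature d) : ℝ := ‖z‖ ^ q - R

/-- The examples that `θ` misclassifies; `θ` predicts "spoof" exactly when the score is positive. -/
def errorSet {d : ℕ} {Θ : Type} (f : Θ → Feature d → ℝ) (θ : Θ) : Set (Example d) :=
  {x | ¬ (x.2 = true ↔ 0 < f θ x.1)}

/-- The true risk: the probability of misclassification. -/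
def risk {d : ℕ} {Θ : Type} (D : Measure (Example d)) (f : Θ → Feature d → ℝ) (θ : Θ) : ℝ :=
  D.real (errorSet f θ)

/-- The empirical risk: the fraction of misclassified training examples. -/
def empRisk {d N : ℕ} {Θ : Type} (S : Fin N → Example d) (f : Θ → Feature d → ℝ) (θ : Θ) : ℝ :=
  (1 / (N : ℝ)) * ∑ i, (errorSet f θ).indicator (fun _ => (1 : ℝ)) (S i)

/-! ### Logistic likelihood, maximum a posteriori estimates and posteriors -/

/-- The negative log-likelihood `∑ᵢ ln (1 + exp (-yᵢ f θ zᵢ))` with signed labels `yᵢ`. -/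
def logisticNLL {d N : ℕ} {Θ : Type} (f : Θ → Feature d → ℝ) (S : Fin N → Example d) (θ : Θ) : ℝ :=
  ∑ i, Real.log (1 + Real.exp (-(signedLabel (S i).2 * f θ (S i).1)))

/-- The curvature `c = σ(a) (1 - σ(a))` of the logistic loss at `a = y f θ z`. -/
def logisticCurv {d : ℕ} {Θ : Type} (f : Θ → Feature d → ℝ) (θ : Θ) (x : Example d) : ℝ :=
  Real.sigmoid (signedLabel x.2 * f θ x.1) * (1 - Real.sigmoid (signedLabel x.2 * f θ x.1))

/-- The exact Bayes posterior: proportional to likelihood times prior. -/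
def bayesPosterior {d N : ℕ} {Θ : Type} [MeasurableSpace Θ] (prior : Measure Θ)
    (f : Θ → Feature d → ℝ) (S : Fin N → Example d) : Measure Θ :=
  prior.tilted fun θ => -logisticNLL f S θ

/-- A global minimizer of `L` (if there is one). -/
def minimizer {Θ : Type} [Nonempty Θ] (L : Θ → ℝ) : Θ :=
  Classical.epsilon fun θ => ∀ θ', L θ ≤ L θ'

/-- The Gaussian prior `N(0, σβ² I_d)` on hyperplanes. -/
def symPrior (d : ℕ) (σβ : ℝ) : Measure (Feature d) := isoGaussian 0 (σβ ^ 2)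

/-- The negative log-posterior of `β`, up to an additive constant. -/
def symObjective {d N : ℕ} (σβ : ℝ) (S : Fin N → Example d) (β : Feature d) : ℝ :=
  logisticNLL linearScore S β + ‖β‖ ^ 2 / (2 * σβ ^ 2)

/-- The MAP estimate `β_MAP`. -/
def symMAP {d N : ℕ} (σβ : ℝ) (S : Fin N → Example d) : Feature d :=
  minimizer (symObjective σβ S)

/-- The Hessian `∑ᵢ cᵢ zᵢ zᵢᵀ + σβ⁻² I` of the negative log-posterior at `β_MAP`. -/
def symHessian {d N : ℕ} (σβ : ℝ) (S : Fin N → Example d) : Matrix (Fin d) (Fin d) ℝ :=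
  (∑ i, logisticCurv linearScore (symMAP σβ S) (S i) •
      Matrix.vecMulVec (fun j => (S i).1 j) (fun j => (S i).1 j)) +
    (1 / σβ ^ 2) • (1 : Matrix (Fin d) (Fin d) ℝ)

/-- The Laplace approximation `N(β_MAP, H⁻¹)` of the posterior. -/
def symLaplace {d N : ℕ} (σβ : ℝ) (S : Fin N → Example d) : Measure (Feature d) :=
  multivariateGaussian (symMAP σβ S) (symHessian σβ S)⁻¹

/-- The Gaussian prior `N(μR, σR²)` on the radial parameter. -/
def asymPrior (μR σR : ℝ) : Measure ℝ := gaussianReal μR (σR ^ 2).toNNReal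

/-- The negative log-posterior of the radial parameter, up to an additive constant. -/
def asymObjective {d N : ℕ} (q : ℕ) (μR σR : ℝ) (S : Fin N → Example d) (R : ℝ) : ℝ :=
  logisticNLL (radialScore q) S R + (R - μR) ^ 2 / (2 * σR ^ 2)

/-- The MAP estimate `R_MAP`. -/
def asymMAP {d N : ℕ} (q : ℕ) (μR σR : ℝ) (S : Fin N → Example d) : ℝ :=
  minimizer (asymObjective q μR σR S)

/-- The second derivative `∑ᵢ cᵢ + σR⁻²` of the negative log-posterior at `R_MAP`. -/
def asymHessian {d N : ℕ} (q : ℕ) (μR σR : ℝ) (S : Fin N → Example d) : ℝ :=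
  (∑ i, logisticCurv (radialScore q) (asymMAP q μR σR S) (S i)) + 1 / σR ^ 2

/-- The Laplace approximation `N(R_MAP, H⁻¹)` of the posterior. -/
def asymLaplace {d N : ℕ} (q : ℕ) (μR σR : ℝ) (S : Fin N → Example d) : Measure ℝ :=
  gaussianReal (asymMAP q μR σR S) (asymHessian q μR σR S)⁻¹.toNNReal

/-! ### Events of the training sample -/

/-- The PAC-Bayes inequality for the posterior `post` and the prior `prior`: the KL divergence is
finite and the expected true risk of a hypothesis drawn from the posterior is at most its expected
empirical risk plus `√((KL(post ‖ prior) + ln(2√N/δ)) / (2N))`. -/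
def PACBayesBound {d N : ℕ} {Θ : Type} [MeasurableSpace Θ] (D : Measure (Example d))
    (S : Fin N → Example d) (f : Θ → Feature d → ℝ) (post prior : Measure Θ) (δ : ℝ) : Prop :=
  klDiv post prior ≠ ⊤ ∧
    ∫ θ, risk D f θ ∂post ≤ ∫ θ, empRisk S f θ ∂post +
      Real.sqrt (((klDiv post prior).toReal + Real.log (2 * Real.sqrt N / δ)) / (2 * N))

/-- True risk at most empirical risk plus `rate`, for a hypothesis drawn from the posterior: on
average over the draw, and also for the single drawn hypothesis with probability `≥ 1 - δ`. -/
def RiskBound {d N : ℕ} {Θ : Type} [MeasurableSpace Θ] (D : Measure (Example d))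
    (S : Fin N → Example d) (f : Θ → Feature d → ℝ) (post : Measure Θ) (δ rate : ℝ) : Prop :=
  ∫ θ, risk D f θ ∂post ≤ ∫ θ, empRisk S f θ ∂post + rate ∧
    post {θ | ¬ risk D f θ ≤ empRisk S f θ + rate} ≤ ENNReal.ofReal δ

/-- The event `A` has probability at least `1 - δ`: its complement has (outer) measure `≤ δ`. -/
def HighProb {Ω : Type} [MeasurableSpace Ω] (P : Measure Ω) (δ : ℝ) (A : Ω → Prop) : Prop :=
  P {S | ¬ A S} ≤ ENNReal.ofReal δ

/-- `√(C (d + K) ln(2N/δ) / N)`, an explicit form of `Õ(√((d+K)/N))`. -/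
def symRate (C : ℝ) (d K N : ℕ) (δ : ℝ) : ℝ :=
  Real.sqrt (C * ((d : ℝ) + K) * Real.log (2 * N / δ) / N)

/-- `√(C ln(2N/δ) / N)`, an explicit form of `Õ(√(1/N))`. -/
def asymRate (C : ℝ) (N : ℕ) (δ : ℝ) : ℝ :=
  Real.sqrt (C * Real.log (2 * N / δ) / N)

/-! ### The MAP estimates exist -/

theorem logisticNLL_nonneg {d N : ℕ} {Θ : Type} (f : Θ → Feature d → ℝ) (S : Fin N → Example d)
    (θ : Θ) : 0 ≤ logisticNLL f S θ := by
  refine Finset.sum_nonneg fun i _ => Real.log_nonneg ?_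
  have := Real.exp_pos (-(signedLabel (S i).2 * f θ (S i).1))
  linarith

theorem symMAP_le {d N : ℕ} {σβ : ℝ} (hσ : 0 < σβ) (S : Fin N → Example d) (β : Feature d) :
    symObjective σβ S (symMAP σβ S) ≤ symObjective σβ S β := by
  refine Classical.epsilon_spec (p := fun θ => ∀ θ', symObjective σβ S θ ≤ symObjective σβ S θ')
    ?_ β
  refine Continuous.exists_forall_le ?_ ?_
  · unfold symObjective logisticNLL linearScore
    refine Continuous.add (continuous_finsetSum _ fun i _ => Continuous.log (by fun_prop)
      fun x => ?_) (by fun_prop)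
    have := Real.exp_pos (-(signedLabel (S i).2 * ⟪x, (S i).1⟫))
    positivity
  · refine tendsto_atTop_mono (f := fun β : Feature d => ‖β‖ ^ 2 / (2 * σβ ^ 2))
      (fun β => by have := logisticNLL_nonneg linearScore S β; unfold symObjective; linarith) ?_
    exact ((tendsto_pow_atTop two_ne_zero).comp (tendsto_norm_cocompact_atTop)).atTop_div_const
      (by positivity)

theorem asymMAP_le {d N : ℕ} (q : ℕ) (μR : ℝ) {σR : ℝ} (hσ : 0 < σR) (S : Fin N → Example d)
    (R : ℝ) : asymObjective q μR σR S (asymMAP q μR σR S) ≤ asymObjective q μR σR S R := by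
  refine Classical.epsilon_spec
    (p := fun θ => ∀ θ', asymObjective q μR σR S θ ≤ asymObjective q μR σR S θ') ?_ R
  refine Continuous.exists_forall_le ?_ ?_
  · unfold asymObjective logisticNLL radialScore
    refine Continuous.add (continuous_finsetSum _ fun i _ => Continuous.log (by fun_prop)
      fun x => ?_) (by fun_prop)
    have := Real.exp_pos (-(signedLabel (S i).2 * (‖(S i).1‖ ^ q - x)))
    positivity
  · refine tendsto_atTop_mono (f := fun R : ℝ => ‖R - μR‖ ^ 2 / (2 * σR ^ 2))
      (fun R => by
        have := logisticNLL_nonneg (radialScore q) S R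
        simp only [asymObjective, Real.norm_eq_abs, sq_abs]; linarith) ?_
    refine ((tendsto_pow_atTop two_ne_zero).comp
      (tendsto_norm_cocompact_atTop.comp ?_)).atTop_div_const (by positivity)
    exact (Homeomorph.subRight μR).isClosedEmbedding.tendsto_cocompact

end AsyIRM

end

open AsyIRM

/-! The proof has four ingredients: an exponential moment, an estimate for tilted Gaussians, a bound
on the linear MAP estimate, and uniform convergence for radii.

Exponential moment. For a fixed event of probability p with empirical frequency p̂ in N draws, E
exp(2N(p − p̂)²) ≤ 2√N for every N ≥ 1 (`lintegral_pi_exp_empFreq_le`). Pinsker's inequality absorbs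
the exponential into the maximal likelihood of the observed bit string, which exceeds its
Krichevsky–Trofimov probability by a factor of at most 2√N, and those probabilities sum to one.
Since the prior does not depend on the sample, Tonelli and Markov bound the prior mean of exp(2N
gap²), where gap is true minus empirical risk, and the Donsker–Varadhan inequality turns this into
the PAC-Bayes bound for any posterior of finite divergence.

Tilted Gaussians. The Bayes posterior and its Laplace approximation both have a density proportional
to exp(−G(x − m) − ‖x − m‖²/(2σ²)) with m the MAP estimate and 0 ≤ G(u) ≤ (1/8) ∑ ⟨bᵢ, u⟩², where
G(u) ≤ G(√2 u). For the Bayes posterior this is convexity of the logistic loss together with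
Hoeffding's lemma. `IsConvexTilt.tiltEstimate` derives from this alone the divergence bound
`tiltBound`, of order ‖m − μ‖²/σ² + n + n ln(1 + σ² ∑ ‖bᵢ‖²/n) in dimension n, and a change of
measure from prior to posterior for exponential moments. The latter gives the risk bound for a
single drawn hypothesis.

Linear MAP estimate. With high probability ‖m‖² = O(d ln(2N/δ)) (`exists_symMAP_bound`). For small
N, comparison with β = 0 suffices. For large N, a union bound over a grid shows that in every
direction a fixed fraction of the live points, whose law is centred at 0, lies well on the wrong
side, so a long m would cost more loss than β = 0. The number of mixture components plays no role: K
enters only through d ≤ d + K.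

Radii. The divergence of the radial posterior contains (m − μ)², which no constant controls, so its
risk bound does not go through the divergence. The errors of a radial rule are the union of one
member from each of two monotone families of sets, and for such families the deviation is uniformly
O(√(ln(2N/δ)/N)) by bracketing (`highProb_forall_radial_risk_le`). This covers all radii at once,
whatever the posterior. The comparison of rates is then arithmetic. -/

namespace AsyIRM

/-! ### Scalar inequalities -/

/-- Hoeffding's lemma for a Bernoulli variable. -/
theorem bernoulli_mgf_le {p : ℝ} (h0 : 0 ≤ p) (h1 : p ≤ 1) (y : ℝ) :
    1 - p + p * Real.exp y ≤ Real.exp (p * y + y ^ 2 / 8) := by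
  let μ : Measure ℝ := ENNReal.ofReal p • Measure.dirac 1 + ENNReal.ofReal (1 - p) • Measure.dirac 0
  have hμ : IsProbabilityMeasure μ := ⟨by
    simp only [μ, Measure.add_apply, Measure.smul_apply, measure_univ, smul_eq_mul, mul_one]
    rw [← ENNReal.ofReal_add h0 (by linarith)]; simp⟩
  have hint : ∀ g : ℝ → ℝ, ∫ x, g x ∂μ = p * g 1 + (1 - p) * g 0 := fun g => by
    rw [integral_add_measure, integral_smul_measure, integral_smul_measure]
    · simp [ENNReal.toReal_ofReal, h0, h1]
    · exact (integrable_dirac (by simp)).smul_measure (by simp)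
    · exact (integrable_dirac (by simp)).smul_measure (by simp)
  have h := (hasSubgaussianMGF_of_mem_Icc (μ := μ) (X := id) (a := 0) (b := 1) aemeasurable_id
    (by
      simp only [μ]
      rw [ae_add_measure_iff]
      constructor
      · refine Measure.ae_smul_measure ?_ _
        rw [ae_dirac_iff (measurableSet_Icc.preimage measurable_id)]; simp
      · refine Measure.ae_smul_measure ?_ _
        rw [ae_dirac_iff (measurableSet_Icc.preimage measurable_id)]; simp)).mgf_le y
  rw [mgf, hint, hint] at h
  simp only [id, mul_one, mul_zero, add_zero, zero_sub, sub_zero, nnnorm_one] at h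
  -- The sub-Gaussian bound is for the centred variable; multiplying by exp(py) removes the
  -- centring.
  have h2 := mul_le_mul_of_nonneg_right h (Real.exp_pos (p * y)).le
  rw [add_mul, mul_assoc, mul_assoc, ← Real.exp_add, ← Real.exp_add, ← Real.exp_add] at h2
  have e1 : y * (1 - p) + p * y = y := by ring
  have e2 : y * -p + p * y = 0 := by ring
  rw [e1, e2, Real.exp_zero] at h2
  refine le_trans (le_of_eq (by ring)) (h2.trans (le_of_eq ?_))
  congr 1
  push_cast
  ring

/-- Convexity of the exponential for a Bernoulli variable. -/
theorem exp_mul_le_bernoulli_mgf {p : ℝ} (h0 : 0 ≤ p) (h1 : p ≤ 1) (y : ℝ) :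
    Real.exp (p * y) ≤ 1 - p + p * Real.exp y := by
  have := convexOn_exp.2 (Set.mem_univ y) (Set.mem_univ 0) h0 (sub_nonneg.2 h1) (by ring)
  simp only [smul_eq_mul, mul_zero, add_zero, Real.exp_zero, mul_one] at this
  linarith

/-- This is x ≤ exp(x − 1) at x = Np/k, raised to the power k. When applied to p with a and to 1 − p
with b, where a + b = N, the two exponential factors cancel, so the likelihood is maximized without
calculus. -/
theorem pow_le_div_pow_mul_exp {p : ℝ} (hp : 0 ≤ p) (k N : ℕ) (hN : 0 < N) :
    p ^ k ≤ ((k : ℝ) / N) ^ k * Real.exp (N * p - k) := by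
  rcases Nat.eq_zero_or_pos k with rfl | hk
  · simpa using mul_nonneg (Nat.cast_nonneg N) hp
  have hk' : (0 : ℝ) < k := by exact_mod_cast hk
  have hN' : (0 : ℝ) < N := by exact_mod_cast hN
  have h : p ≤ (k : ℝ) / N * Real.exp (N * p / k - 1) := by
    have := Real.add_one_le_exp (N * p / k - 1)
    calc p = (k : ℝ) / N * (N * p / k - 1 + 1) := by field_simp; ring
      _ ≤ _ := by gcongr
  calc p ^ k ≤ ((k : ℝ) / N * Real.exp (N * p / k - 1)) ^ k := pow_le_pow_left₀ hp h k
    _ = _ := by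
      rw [mul_pow, ← Real.exp_nat_mul]
      congr 2
      field_simp

/-- The likelihood of a Bernoulli string is at most the maximal likelihood. -/
theorem bernoulli_likelihood_le_max {p : ℝ} (h0 : 0 ≤ p) (h1 : p ≤ 1) (a b : ℕ) (hN : 0 < a + b) :
    p ^ a * (1 - p) ^ b ≤ ((a : ℝ) / (a + b : ℕ)) ^ a * ((b : ℝ) / (a + b : ℕ)) ^ b := by
  have ha := pow_le_div_pow_mul_exp h0 a (a + b) hN
  have hb := pow_le_div_pow_mul_exp (sub_nonneg.2 h1) b (a + b) hN
  calc p ^ a * (1 - p) ^ b ≤ _ :=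
        mul_le_mul ha hb (pow_nonneg (sub_nonneg.2 h1) _) (le_trans (pow_nonneg h0 _) ha)
    _ = ((a : ℝ) / (a + b : ℕ)) ^ a * ((b : ℝ) / (a + b : ℕ)) ^ b *
        (Real.exp ((a + b : ℕ) * p - a) * Real.exp ((a + b : ℕ) * (1 - p) - b)) := by ring
    _ = _ := by
      rw [← Real.exp_add]
      have : ((a + b : ℕ) : ℝ) * p - a + ((a + b : ℕ) * (1 - p) - b) = 0 := by push_cast; ring
      rw [this]; simp

/-- Pinsker's inequality for Bernoulli strings, in exponential form. -/
theorem bernoulli_likelihood_mul_exp_le {p : ℝ} (h0 : 0 ≤ p) (h1 : p ≤ 1) (a b : ℕ)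
    (hN : 0 < a + b) :
    p ^ a * (1 - p) ^ b * Real.exp (2 * (a + b : ℕ) * (p - a / (a + b : ℕ)) ^ 2) ≤
      ((a : ℝ) / (a + b : ℕ)) ^ a * ((b : ℝ) / (a + b : ℕ)) ^ b := by
  have hN' : (0 : ℝ) < (a + b : ℕ) := by exact_mod_cast hN
  set x : ℝ := (a : ℝ) / (a + b : ℕ) with hx
  have hxa : (a + b : ℕ) * x = a := by rw [hx]; field_simp
  -- Comparing with the tilted parameter p eˡ/z leaves the exponent N(l(x − p) − l²/8); this l
  -- maximizes it, with value 2N(x − p)².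
  set l : ℝ := 4 * (x - p) with hl
  set z : ℝ := 1 - p + p * Real.exp l with hz
  have hzpos : 0 < z := lt_of_lt_of_le (Real.exp_pos _) (exp_mul_le_bernoulli_mgf h0 h1 l)
  have hpe : 0 ≤ p * Real.exp l := mul_nonneg h0 (Real.exp_pos _).le
  have hq0 : 0 ≤ p * Real.exp l / z := div_nonneg hpe hzpos.le
  have hq1 : p * Real.exp l / z ≤ 1 := (div_le_one hzpos).2 (by rw [hz]; linarith)
  have h := bernoulli_likelihood_le_max hq0 hq1 a b hN
  refine le_trans ?_ h
  have e1 : 1 - p * Real.exp l / z = (1 - p) / z := by field_simp; rw [hz]; ring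
  rw [e1, div_pow, div_pow, mul_pow, div_mul_div_comm, ← pow_add, le_div_iff₀ (by positivity)]
  have hzN : z ^ (a + b) ≤ Real.exp ((a + b : ℕ) * (p * l + l ^ 2 / 8)) := by
    rw [Real.exp_nat_mul]
    exact pow_le_pow_left₀ hzpos.le (bernoulli_mgf_le h0 h1 l) _
  have hpp : 0 ≤ p ^ a * (1 - p) ^ b := mul_nonneg (pow_nonneg h0 _) (pow_nonneg (sub_nonneg.2 h1) _)
  calc p ^ a * (1 - p) ^ b * Real.exp (2 * (a + b : ℕ) * (p - x) ^ 2) * z ^ (a + b)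
      ≤ p ^ a * (1 - p) ^ b * Real.exp (2 * (a + b : ℕ) * (p - x) ^ 2) *
        Real.exp ((a + b : ℕ) * (p * l + l ^ 2 / 8)) := by gcongr
    _ = p ^ a * (1 - p) ^ b * Real.exp (a * l) := by
      rw [mul_assoc, ← Real.exp_add]
      congr 2
      rw [← hxa, hl]; ring
    _ = _ := by rw [Real.exp_nat_mul]; ring

/-! ### The Krichevsky–Trofimov distribution -/

/-- The Krichevsky–Trofimov probability of a binary string with `a` ones and `b` zeros. -/
noncomputable def ktProb (a b : ℕ) : ℝ :=
  (∏ i ∈ Finset.range a, ((i : ℝ) + 1 / 2)) * (∏ i ∈ Finset.range b, ((i : ℝ) + 1 / 2)) /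
    ((a + b).factorial : ℝ)

theorem ktProb_pos (a b : ℕ) : 0 < ktProb a b := by
  unfold ktProb
  have : ∀ a : ℕ, 0 < ∏ i ∈ Finset.range a, ((i : ℝ) + 1 / 2) :=
    fun a => Finset.prod_pos fun i _ => by positivity
  have h1 := this a
  have h2 := this b
  positivity

theorem ktProb_comm (a b : ℕ) : ktProb a b = ktProb b a := by
  unfold ktProb; rw [mul_comm, add_comm]

theorem ktProb_succ_left (a b : ℕ) :
    ktProb (a + 1) b = ktProb a b * (a + 1 / 2) / (a + b + 1) := by
  unfold ktProb
  rw [Finset.prod_range_succ, show a + 1 + b = a + b + 1 by ring, Nat.factorial_succ]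
  have : ((a + b).factorial : ℝ) ≠ 0 := by exact_mod_cast (Nat.factorial_pos _).ne'
  generalize ∏ i ∈ Finset.range a, ((i : ℝ) + 1 / 2) = x
  generalize ∏ i ∈ Finset.range b, ((i : ℝ) + 1 / 2) = y
  push_cast
  field_simp

/-- The predictive probabilities (a + 1/2)/(a + b + 1) and (b + 1/2)/(a + b + 1) of the next symbol
add up to one, so the probabilities of strings of different lengths are consistent. -/
theorem ktProb_split (a b : ℕ) : ktProb (a + 1) b + ktProb a (b + 1) = ktProb a b := by
  rw [ktProb_comm a (b + 1), ktProb_succ_left, ktProb_succ_left, ktProb_comm b a]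
  have : (a : ℝ) + b + 1 ≠ 0 := by positivity
  rw [show (b : ℝ) + a + 1 = a + b + 1 by ring]
  field_simp
  ring

/-- Equivalent to (1 + 1/N)^(N + 1/2) ≥ e, which follows from ln(1 + x) ≥ 2x/(x + 2). The half in
the exponent is what produces the growth √N. -/
theorem exp_one_mul_sqrt_mul_pow_le (N : ℕ) (hN : 0 < N) :
    Real.exp 1 * (Real.sqrt N * (N : ℝ) ^ N) ≤ Real.sqrt (N + 1 : ℕ) * ((N + 1 : ℕ) : ℝ) ^ N := by
  have hN' : (0 : ℝ) < N := by exact_mod_cast hN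
  have h1 := Real.le_log_one_add_of_nonneg (x := 1 / (N : ℝ)) (by positivity)
  have h2 : (1 : ℝ) ≤ (N + 1 / 2) * Real.log (1 + 1 / N) := by
    have : (1 : ℝ) = (N + 1 / 2) * (2 * (1 / (N : ℝ)) / (1 / N + 2)) := by field_simp; ring
    calc (1 : ℝ) = _ := this
      _ ≤ _ := by gcongr
  have e : (1 : ℝ) + 1 / N = (N + 1) / N := by field_simp
  rw [e, Real.log_div (by positivity) (by positivity)] at h2
  rw [← Real.log_le_log_iff (by positivity) (by positivity),
    Real.log_mul (by positivity) (by positivity), Real.log_mul (by positivity) (by positivity),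
    Real.log_mul (by positivity) (by positivity), Real.log_exp, Real.log_sqrt (by positivity),
    Real.log_sqrt (by positivity), Real.log_pow, Real.log_pow]
  push_cast
  linarith

/-- The two sides agree at 0, and their difference has derivative y/(2 + y) − ln((1 + y)/(1 + y/2)),
which is nonnegative by ln t ≤ t − 1. -/
theorem add_one_mul_log_add_one_le {y : ℝ} (hy : 0 ≤ y) :
    (1 + y) * Real.log (1 + y) ≤ y + y * Real.log ((2 + y) / 2) := by
  let f : ℝ → ℝ := fun y => y + y * Real.log ((2 + y) / 2) - (1 + y) * Real.log (1 + y)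
  have hd : ∀ x ∈ Set.Ioi (0 : ℝ), HasDerivAt f
      (x / (2 + x) + Real.log ((2 + x) / 2) - Real.log (1 + x)) x := by
    intro x hx
    have hx0 : (0 : ℝ) < x := hx
    have h1 : HasDerivAt (fun y : ℝ => Real.log ((2 + y) / 2)) (1 / 2 / ((2 + x) / 2)) x :=
      (((hasDerivAt_id x).const_add 2).div_const 2).log (by simp; positivity)
    have h2 : HasDerivAt (fun y : ℝ => Real.log (1 + y)) (1 / (1 + x)) x :=
      ((hasDerivAt_id x).const_add 1).log (by simp; positivity)
    refine HasDerivAt.congr_deriv (((hasDerivAt_id x).add ((hasDerivAt_id x).mul h1)).sub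
      (((hasDerivAt_id x).const_add 1).mul h2)) ?_
    have : 1 + x ≠ 0 := by positivity
    simp only [id_eq]
    field_simp
    ring
  have hmono : MonotoneOn f (Set.Ici 0) := by
    refine monotoneOn_of_deriv_nonneg (convex_Ici 0) ?_ ?_ ?_
    · refine ContinuousOn.sub (ContinuousOn.add continuousOn_id (continuousOn_id.mul
        (ContinuousOn.log (by fun_prop) ?_))) (ContinuousOn.mul (by fun_prop)
        (ContinuousOn.log (by fun_prop) ?_))
      all_goals intro x hx; have : (0 : ℝ) ≤ x := hx; positivity
    · rw [interior_Ici]; exact fun x hx => (hd x hx).differentiableAt.differentiableWithinAt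
    · rw [interior_Ici]
      intro x hx
      rw [(hd x hx).deriv]
      have hx0 : (0 : ℝ) < x := hx
      have h := Real.log_le_sub_one_of_pos (x := (1 + x) / ((2 + x) / 2)) (by positivity)
      rw [Real.log_div (by positivity) (by positivity)] at h
      have : (1 + x) / ((2 + x) / 2) - 1 = x / (2 + x) := by field_simp; ring
      linarith
  have := hmono (Set.mem_Ici.2 le_rfl) hy hy
  simp only [f, add_zero, Real.log_one, mul_zero, zero_mul, sub_zero] at this
  linarith

/-- The factor a + 1/2 is exactly the one that `ktProb` gains when a one is appended, and the factor
e is paid for by `exp_one_mul_sqrt_mul_pow_le`; hence the comparison with the maximal likelihood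
passes from a to a + 1. -/
theorem succ_pow_succ_le (a : ℕ) :
    ((a + 1 : ℕ) : ℝ) ^ (a + 1) ≤ Real.exp 1 * ((a + 1 / 2) * (a : ℝ) ^ a) := by
  rcases Nat.eq_zero_or_pos a with rfl | ha
  · have := Real.add_one_le_exp 1
    norm_num at this ⊢
    linarith
  have ha' : (0 : ℝ) < a := by exact_mod_cast ha
  have h := add_one_mul_log_add_one_le (y := 1 / (a : ℝ)) (by positivity)
  have e1 : (1 : ℝ) + 1 / a = (a + 1) / a := by field_simp
  have e2 : (2 + 1 / (a : ℝ)) / 2 = (a + 1 / 2) / a := by field_simp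
  rw [e1, e2, Real.log_div (by positivity) (by positivity),
    Real.log_div (by positivity) (by positivity)] at h
  have h' := mul_le_mul_of_nonneg_left h ha'.le
  have e3 : (a : ℝ) * ((a + 1) / a * (Real.log (a + 1) - Real.log a)) =
    (a + 1) * (Real.log (a + 1) - Real.log a) := by field_simp
  have e4 : (a : ℝ) * (1 / a + 1 / a * (Real.log (a + 1 / 2) - Real.log a)) =
    1 + (Real.log (a + 1 / 2) - Real.log a) := by field_simp
  rw [e3, e4] at h'
  rw [← Real.log_le_log_iff (by positivity) (by positivity),
    Real.log_mul (by positivity) (by positivity), Real.log_mul (by positivity) (by positivity),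
    Real.log_exp, Real.log_pow, Real.log_pow]
  push_cast
  linarith

theorem self_pow_mul_self_pow_le_succ {a b : ℕ} (hN : 0 < a + b)
    (h : (a : ℝ) ^ a * (b : ℝ) ^ b ≤
      2 * (Real.sqrt (a + b : ℕ) * ((a + b : ℕ) : ℝ) ^ (a + b)) * ktProb a b) :
    ((a + 1 : ℕ) : ℝ) ^ (a + 1) * (b : ℝ) ^ b ≤
      2 * (Real.sqrt (a + 1 + b : ℕ) * ((a + 1 + b : ℕ) : ℝ) ^ (a + 1 + b)) * ktProb (a + 1) b := by
  have h1 := succ_pow_succ_le a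
  have h2 := exp_one_mul_sqrt_mul_pow_le (a + b) hN
  have hk := ktProb_pos a b
  calc ((a + 1 : ℕ) : ℝ) ^ (a + 1) * (b : ℝ) ^ b
      ≤ Real.exp 1 * ((a + 1 / 2) * (a : ℝ) ^ a) * (b : ℝ) ^ b := by gcongr
    _ = Real.exp 1 * (a + 1 / 2) * ((a : ℝ) ^ a * (b : ℝ) ^ b) := by ring
    _ ≤ Real.exp 1 * (a + 1 / 2) *
        (2 * (Real.sqrt (a + b : ℕ) * ((a + b : ℕ) : ℝ) ^ (a + b)) * ktProb a b) := by gcongr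
    _ = 2 * (a + 1 / 2) * ktProb a b *
        (Real.exp 1 * (Real.sqrt (a + b : ℕ) * ((a + b : ℕ) : ℝ) ^ (a + b))) := by ring
    _ ≤ 2 * (a + 1 / 2) * ktProb a b *
        (Real.sqrt (a + b + 1 : ℕ) * ((a + b + 1 : ℕ) : ℝ) ^ (a + b)) := by gcongr
    _ = _ := by
      rw [ktProb_succ_left, show a + 1 + b = a + b + 1 by ring, pow_succ]
      have : (a : ℝ) + b + 1 ≠ 0 := by positivity
      push_cast
      field_simp

theorem self_pow_mul_self_pow_le (a b : ℕ) (hN : 0 < a + b) :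
    (a : ℝ) ^ a * (b : ℝ) ^ b ≤
      2 * (Real.sqrt (a + b : ℕ) * ((a + b : ℕ) : ℝ) ^ (a + b)) * ktProb a b := by
  have h0 : ∀ a : ℕ, ((a + 1 : ℕ) : ℝ) ^ (a + 1) * ((0 : ℕ) : ℝ) ^ 0 ≤
      2 * (Real.sqrt (a + 1 + 0 : ℕ) * ((a + 1 + 0 : ℕ) : ℝ) ^ (a + 1 + 0)) *
        ktProb (a + 1) 0 := by
    intro a
    induction a with
    -- A string of length one gives equality, so the constant 2 is forced here.
    | zero => norm_num [ktProb]
    | succ a ih => exact self_pow_mul_self_pow_le_succ (by omega) ih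
  cases b with
  | zero =>
    obtain ⟨a, rfl⟩ : ∃ c, a = c + 1 := ⟨a - 1, by omega⟩
    exact h0 a
  | succ b =>
    clear hN
    induction a with
    | zero =>
      have := h0 b
      rw [ktProb_comm, zero_add, mul_comm]
      simpa using this
    | succ a ih => exact self_pow_mul_self_pow_le_succ (by omega) ih

/-- The maximal likelihood exceeds the Krichevsky–Trofimov probability by at most `2 √N`. -/
theorem max_likelihood_le_ktProb (a b : ℕ) (hN : 0 < a + b) :
    ((a : ℝ) / (a + b : ℕ)) ^ a * ((b : ℝ) / (a + b : ℕ)) ^ b ≤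
      2 * Real.sqrt (a + b : ℕ) * ktProb a b := by
  have hN' : (0 : ℝ) < (a + b : ℕ) := by exact_mod_cast hN
  rw [div_pow, div_pow, div_mul_div_comm, ← pow_add, div_le_iff₀ (by positivity)]
  refine (self_pow_mul_self_pow_le a b hN).trans (le_of_eq (by ring))

/-- The prefix counts a, b are kept general so that induction can peel off the first bit by
`ktProb_split`. For a = b = 0 the sum is 1. -/
theorem sum_bool_strings_ktProb (N a b : ℕ) :
    ∑ s : Fin N → Bool, ktProb (a + ∑ i, (s i).toNat) (b + ∑ i, (1 - (s i).toNat)) =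
      ktProb a b := by
  induction N generalizing a b with
  | zero => simp
  | succ N ih =>
    rw [← (Fin.consEquiv fun _ : Fin (N + 1) => Bool).sum_comp, Fintype.sum_prod_type,
      Fintype.sum_bool]
    simp only [Fin.consEquiv_apply, Fin.sum_univ_succ, Fin.cons_zero, Fin.cons_succ,
      Bool.toNat_true, Bool.toNat_false, tsub_self, tsub_zero, zero_add]
    have e1 := ih (a + 1) b
    have e2 := ih a (b + 1)
    simp only [add_assoc] at e1 e2
    rw [e1, e2, ktProb_split]

/-! ### Exponential moments of the deviation of an empirical frequency -/

/-- The fraction of the sample lying in `A`. -/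
noncomputable def empFreq {X : Type*} {N : ℕ} (A : Set X) (S : Fin N → X) : ℝ :=
  (1 / (N : ℝ)) * ∑ i, A.indicator (fun _ => (1 : ℝ)) (S i)

theorem empFreq_nonneg {X : Type*} {N : ℕ} (A : Set X) (S : Fin N → X) : 0 ≤ empFreq A S :=
  mul_nonneg (by positivity) (Finset.sum_nonneg fun _ _ => Set.indicator_nonneg (by simp) _)

theorem empFreq_le_one {X : Type*} {N : ℕ} (A : Set X) (S : Fin N → X) : empFreq A S ≤ 1 := by
  unfold empFreq
  have h : ∑ i, A.indicator (fun _ => (1 : ℝ)) (S i) ≤ ∑ _i : Fin N, (1 : ℝ) :=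
    Finset.sum_le_sum fun i _ => Set.indicator_le_self' (by simp) _
  simp only [Finset.sum_const, Finset.card_univ, Fintype.card_fin, nsmul_eq_mul, mul_one] at h
  rcases Nat.eq_zero_or_pos N with rfl | hN
  · simp
  have hN' : (0 : ℝ) < N := by exact_mod_cast hN
  rw [one_div, inv_mul_le_iff₀ hN']
  simpa using h

theorem empFreq_mono {X : Type*} {N : ℕ} {A B : Set X} (h : A ⊆ B) (S : Fin N → X) :
    empFreq A S ≤ empFreq B S := by
  unfold empFreq
  gcongr with i

theorem empFreq_union {X : Type*} {N : ℕ} {A B : Set X} (h : Disjoint A B) (S : Fin N → X) :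
    empFreq (A ∪ B) S = empFreq A S + empFreq B S := by
  unfold empFreq
  rw [← mul_add, ← Finset.sum_add_distrib]
  simp [Set.indicator_union_of_disjoint h]

/-- Only the bit string recording membership in A matters, so the integral is a finite sum. In each
term `bernoulli_likelihood_mul_exp_le` and `max_likelihood_le_ktProb` replace likelihood times
exponential by 2√N times a Krichevsky–Trofimov probability. -/
theorem lintegral_pi_exp_empFreq_le {X : Type*} [MeasurableSpace X] (D : Measure X)
    [IsProbabilityMeasure D] {A : Set X} (hA : MeasurableSet A) {N : ℕ} (hN : 0 < N) :
    ∫⁻ S : Fin N → X, ENNReal.ofReal (Real.exp (2 * N * (D.real A - empFreq A S) ^ 2))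
      ∂(Measure.pi fun _ => D) ≤ ENNReal.ofReal (2 * Real.sqrt N) := by
  classical
  let c : X → Bool := fun x => decide (x ∈ A)
  have hc : Measurable c := measurable_to_bool (by simpa [c, Set.preimage] using hA)
  let g : (Fin N → Bool) → ℝ≥0∞ := fun s => ENNReal.ofReal
    (Real.exp (2 * N * (D.real A - (1 / (N : ℝ)) * ∑ i, ((s i).toNat : ℝ)) ^ 2))
  have hg : ∀ S : Fin N → X, ENNReal.ofReal (Real.exp (2 * N * (D.real A - empFreq A S) ^ 2)) =
      g (fun i => c (S i)) := by
    intro S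
    have : ∀ i, A.indicator (fun _ => (1 : ℝ)) (S i) = ((c (S i)).toNat : ℝ) := fun i => by
      by_cases h : S i ∈ A <;> simp [h, c]
    simp only [g, empFreq, this]
  simp_rw [hg]
  have hprob : IsProbabilityMeasure (D.map c) := Measure.isProbabilityMeasure_map hc.aemeasurable
  rw [← lintegral_map (f := g) (g := fun S : Fin N → X => fun i => c (S i))
    (measurable_of_finite g) (measurable_pi_lambda _ fun i => hc.comp (measurable_pi_apply i)),
    Measure.pi_map_pi (μ := fun _ : Fin N => D) (f := fun _ => c) (fun _ => hc.aemeasurable),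
    lintegral_fintype]
  set p := D.real A with hp
  have hp0 : 0 ≤ p := measureReal_nonneg
  have hp1 : p ≤ 1 := measureReal_le_one
  have htrue : D.map c {true} = ENNReal.ofReal p := by
    rw [Measure.map_apply hc (measurableSet_singleton _), hp, ofReal_measureReal]
    congr 1; ext x; simp [c]
  have hfalse : D.map c {false} = ENNReal.ofReal (1 - p) := by
    rw [Measure.map_apply hc (measurableSet_singleton _), hp, ← probReal_compl_eq_one_sub hA,
      ofReal_measureReal]
    congr 1; ext x; simp [c]
  have hsing : ∀ s : Fin N → Bool, (Measure.pi fun _ : Fin N => D.map c) {s} =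
      ENNReal.ofReal (p ^ (∑ i, (s i).toNat) * (1 - p) ^ (∑ i, (1 - (s i).toNat))) := by
    intro s
    rw [Measure.pi_singleton, ← Finset.prod_pow_eq_pow_sum, ← Finset.prod_pow_eq_pow_sum,
      ← Finset.prod_mul_distrib, ENNReal.ofReal_prod_of_nonneg]
    · refine Finset.prod_congr rfl fun i _ => ?_
      cases s i <;> simp [htrue, hfalse]
    · intro i _
      exact mul_nonneg (pow_nonneg hp0 _) (pow_nonneg (sub_nonneg.2 hp1) _)
  have hcount : ∀ s : Fin N → Bool, (∑ i, (s i).toNat) + ∑ i, (1 - (s i).toNat) = N := by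
    intro s
    rw [← Finset.sum_add_distrib]
    have : ∀ i, (s i).toNat + (1 - (s i).toNat) = 1 := fun i => by cases s i <;> simp
    simp [this]
  calc ∑ s, g s * (Measure.pi fun _ : Fin N => D.map c) {s}
      ≤ ∑ s : Fin N → Bool, ENNReal.ofReal (2 * Real.sqrt N *
          ktProb (∑ i, (s i).toNat) (∑ i, (1 - (s i).toNat))) := by
        refine Finset.sum_le_sum fun s _ => ?_
        rw [hsing, ← ENNReal.ofReal_mul (Real.exp_pos _).le]
        refine ENNReal.ofReal_le_ofReal ?_
        have h1 := bernoulli_likelihood_mul_exp_le hp0 hp1 (∑ i, (s i).toNat)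
          (∑ i, (1 - (s i).toNat)) (by rw [hcount]; exact hN)
        have h2 := max_likelihood_le_ktProb (∑ i, (s i).toNat)
          (∑ i, (1 - (s i).toNat)) (by rw [hcount]; exact hN)
        rw [hcount] at h1 h2
        refine le_trans (le_of_eq ?_) (h1.trans h2)
        rw [mul_comm]
        congr 4
        push_cast
        ring
    _ = ENNReal.ofReal (2 * Real.sqrt N) := by
        rw [← ENNReal.ofReal_sum_of_nonneg, ← Finset.mul_sum]
        · have := sum_bool_strings_ktProb N 0 0
          simp only [zero_add] at this
          rw [this]
          simp [ktProb]
        · exact fun s _ => mul_nonneg (by positivity) (ktProb_pos _ _).le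

theorem measurable_empFreq {X : Type*} [MeasurableSpace X] {A : Set X} (hA : MeasurableSet A)
    (N : ℕ) : Measurable (empFreq A : (Fin N → X) → ℝ) :=
  (Finset.measurable_sum _ fun i _ =>
    (measurable_const.indicator hA).comp (measurable_pi_apply i)).const_mul _

/-- A Hoeffding type tail bound for the empirical frequency of a fixed event. -/
theorem measure_empFreq_deviation_le {X : Type*} [MeasurableSpace X] (D : Measure X)
    [IsProbabilityMeasure D] {A : Set X} (hA : MeasurableSet A) {N : ℕ} (hN : 0 < N) {t : ℝ}
    (ht : 0 ≤ t) :
    (Measure.pi fun _ : Fin N => D) {S | empFreq A S + t < D.real A} ≤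
      ENNReal.ofReal (2 * Real.sqrt N * Real.exp (-(2 * N * t ^ 2))) := by
  have h := lintegral_pi_exp_empFreq_le D hA hN
  have hm := mul_meas_ge_le_lintegral₀ (μ := Measure.pi fun _ : Fin N => D)
    (f := fun S => ENNReal.ofReal (Real.exp (2 * N * (D.real A - empFreq A S) ^ 2)))
    (by
      have := measurable_empFreq hA N
      exact Measurable.aemeasurable (by fun_prop)) (ENNReal.ofReal (Real.exp (2 * N * t ^ 2)))
  have hsub : {S : Fin N → X | empFreq A S + t < D.real A} ⊆
      {S | ENNReal.ofReal (Real.exp (2 * N * t ^ 2)) ≤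
        ENNReal.ofReal (Real.exp (2 * N * (D.real A - empFreq A S) ^ 2))} := by
    intro S hS
    have hS' : empFreq A S + t < D.real A := hS
    refine ENNReal.ofReal_le_ofReal (Real.exp_le_exp.2 ?_)
    have : t ^ 2 ≤ (D.real A - empFreq A S) ^ 2 := pow_le_pow_left₀ ht (by linarith) 2
    gcongr
  have h2 := (mul_le_mul_right (measure_mono hsub) _).trans (hm.trans h)
  rw [Real.exp_neg, ← div_eq_mul_inv, ENNReal.ofReal_div_of_pos (Real.exp_pos _),
    ENNReal.le_div_iff_mul_le (by simp [Real.exp_pos]) (by simp), mul_comm]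
  exact h2

/-! ### The PAC-Bayes bound -/

theorem empRisk_eq_empFreq {d N : ℕ} {Θ : Type} (S : Fin N → Example d) (f : Θ → Feature d → ℝ)
    (θ : Θ) : empRisk S f θ = empFreq (errorSet f θ) S := rfl

theorem measurableSet_errorSet_prod {d : ℕ} {Θ : Type} [MeasurableSpace Θ]
    {f : Θ → Feature d → ℝ} (hf : Measurable (Function.uncurry f)) :
    MeasurableSet {p : Θ × Example d | p.2 ∈ errorSet f p.1} := by
  have h1 : MeasurableSet {p : Θ × Example d | p.2.2 = true} :=
    (measurable_snd.comp measurable_snd) (measurableSet_singleton true)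
  have h2 : MeasurableSet {p : Θ × Example d | 0 < f p.1 p.2.1} := by
    refine measurableSet_lt measurable_const ?_
    exact hf.comp (measurable_fst.prodMk (measurable_fst.comp measurable_snd))
  exact (h1.iff h2).compl

theorem measurableSet_errorSet {d : ℕ} {Θ : Type} [MeasurableSpace Θ]
    {f : Θ → Feature d → ℝ} (hf : Measurable (Function.uncurry f)) (θ : Θ) :
    MeasurableSet (errorSet f θ) :=
  measurable_prodMk_left (measurableSet_errorSet_prod hf)

theorem measurable_risk {d : ℕ} {Θ : Type} [MeasurableSpace Θ] (D : Measure (Example d))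
    [IsProbabilityMeasure D] {f : Θ → Feature d → ℝ} (hf : Measurable (Function.uncurry f)) :
    Measurable (risk D f) :=
  (measurable_measure_prodMk_left (measurableSet_errorSet_prod hf)).ennreal_toReal

theorem measurable_empRisk_prod {d N : ℕ} {Θ : Type} [MeasurableSpace Θ]
    {f : Θ → Feature d → ℝ} (hf : Measurable (Function.uncurry f)) :
    Measurable fun p : (Fin N → Example d) × Θ => empRisk p.1 f p.2 := by
  refine (Finset.measurable_sum _ fun i _ => ?_).const_mul _
  have h : Measurable ({p : Θ × Example d | p.2 ∈ errorSet f p.1}.indicator fun _ => (1 : ℝ)) :=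
    measurable_const.indicator (measurableSet_errorSet_prod hf)
  exact h.comp (measurable_snd.prodMk ((measurable_pi_apply i).comp measurable_fst))

theorem measurable_empRisk {d N : ℕ} {Θ : Type} [MeasurableSpace Θ] (S : Fin N → Example d)
    {f : Θ → Feature d → ℝ} (hf : Measurable (Function.uncurry f)) : Measurable (empRisk S f) :=
  (measurable_empRisk_prod hf).comp measurable_prodMk_left

/-- The exponential moment of the squared generalization gap under the prior. -/
noncomputable def gapMoment {d N : ℕ} {Θ : Type} [MeasurableSpace Θ] (D : Measure (Example d))
    (f : Θ → Feature d → ℝ) (prior : Measure Θ) (S : Fin N → Example d) : ℝ≥0∞ :=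
  ∫⁻ θ, ENNReal.ofReal (Real.exp (2 * N * (risk D f θ - empRisk S f θ) ^ 2)) ∂prior

/-- The prior is fixed before the sample, so Tonelli allows integration over the sample first, where
the moment bound holds for each θ separately; Markov's inequality does the rest. -/
theorem measure_gapMoment_ge_le {d N : ℕ} {Θ : Type} [MeasurableSpace Θ] (D : Measure (Example d))
    [IsProbabilityMeasure D] {f : Θ → Feature d → ℝ} (hf : Measurable (Function.uncurry f))
    (prior : Measure Θ) [IsProbabilityMeasure prior] (hN : 0 < N) {δ : ℝ} (hδ : 0 < δ) :
    sampleLaw D N {S | ENNReal.ofReal (2 * Real.sqrt N / δ) ≤ gapMoment D f prior S} ≤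
      ENNReal.ofReal δ := by
  have hN' : (0 : ℝ) < N := by exact_mod_cast hN
  have : IsProbabilityMeasure (sampleLaw D N) := by unfold sampleLaw; infer_instance
  have hjoint : Measurable fun p : (Fin N → Example d) × Θ =>
      ENNReal.ofReal (Real.exp (2 * N * (risk D f p.2 - empRisk p.1 f p.2) ^ 2)) := by
    have h1 := measurable_empRisk_prod (N := N) hf
    have h2 : Measurable fun p : (Fin N → Example d) × Θ => risk D f p.2 :=
      (measurable_risk D hf).comp measurable_snd
    exact ((((h2.sub h1).pow_const 2).const_mul _).exp).ennreal_ofReal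
  have hint : ∫⁻ S, gapMoment D f prior S ∂(sampleLaw D N) ≤ ENNReal.ofReal (2 * Real.sqrt N) := by
    unfold gapMoment
    rw [lintegral_lintegral_swap hjoint.aemeasurable]
    calc _ ≤ ∫⁻ _θ, ENNReal.ofReal (2 * Real.sqrt N) ∂prior :=
          lintegral_mono fun θ => lintegral_pi_exp_empFreq_le D (measurableSet_errorSet hf θ) hN
      _ = _ := by simp
  have hm := mul_meas_ge_le_lintegral₀ (μ := sampleLaw D N) (f := gapMoment D f prior)
    hjoint.lintegral_prod_right'.aemeasurable (ENNReal.ofReal (2 * Real.sqrt N / δ))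
  have h2 := hm.trans hint
  have e : ENNReal.ofReal (2 * Real.sqrt N) =
      ENNReal.ofReal (2 * Real.sqrt N / δ) * ENNReal.ofReal δ := by
    rw [← ENNReal.ofReal_mul (by positivity)]; congr 1; field_simp
  rw [e] at h2
  have hpos : 0 < 2 * Real.sqrt N / δ := by positivity
  exact (ENNReal.mul_le_mul_iff_right (by simpa using hpos) (by simp)).1 h2

/-- The variational inequality of Donsker and Varadhan for a bounded function. -/
theorem integral_le_toReal_klDiv_add_log {Θ : Type*} [MeasurableSpace Θ] {post prior : Measure Θ}
    [IsProbabilityMeasure post] [IsProbabilityMeasure prior] (h : klDiv post prior ≠ ⊤)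
    {φ : Θ → ℝ} (hφ : Measurable φ) {M : ℝ} (hM : ∀ θ, |φ θ| ≤ M) :
    ∫ θ, φ θ ∂post ≤ (klDiv post prior).toReal + Real.log (∫ θ, Real.exp (φ θ) ∂prior) := by
  obtain ⟨hac, hint⟩ := klDiv_ne_top_iff.1 h
  have hφi : Integrable φ post := Integrable.of_bound hφ.aestronglyMeasurable M
    (ae_of_all _ fun θ => by simpa using hM θ)
  have hei : Integrable (fun θ => Real.exp (φ θ)) prior :=
    Integrable.of_bound hφ.exp.aestronglyMeasurable (Real.exp M)
      (ae_of_all _ fun θ => by simpa using (le_abs_self _).trans (hM θ))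
  have hprob := isProbabilityMeasure_tilted hei
  have h1 := integral_llr_tilted_right hac hφi hei hint
  -- Gibbs' inequality: the divergence of `post` from the prior tilted by φ is nonnegative, and `h1`
  -- expands it into the claimed terms.
  have h2 := integral_llr_add_sub_measure_univ_nonneg (hac.trans (absolutelyContinuous_tilted hei))
    (integrable_llr_tilted_right hac hφi hint hei)
  have h3 := toReal_klDiv_of_measure_eq hac (by simp)
  simp only [probReal_univ, add_sub_cancel_right] at h2
  linarith

theorem abs_risk_sub_empRisk_le_one {d N : ℕ} {Θ : Type} (D : Measure (Example d))
    [IsProbabilityMeasure D] (f : Θ → Feature d → ℝ) (S : Fin N → Example d) (θ : Θ) :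
    |risk D f θ - empRisk S f θ| ≤ 1 := by
  have h1 : 0 ≤ risk D f θ := measureReal_nonneg
  have h2 : risk D f θ ≤ 1 := measureReal_le_one
  have h3 : 0 ≤ empRisk S f θ := empFreq_nonneg _ _
  have h4 : empRisk S f θ ≤ 1 := empFreq_le_one _ _
  rw [abs_le]; constructor <;> linarith

theorem integrable_risk {d : ℕ} {Θ : Type} [MeasurableSpace Θ] (D : Measure (Example d))
    [IsProbabilityMeasure D] {f : Θ → Feature d → ℝ} (hf : Measurable (Function.uncurry f))
    (post : Measure Θ) [IsFiniteMeasure post] : Integrable (risk D f) post :=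
  Integrable.of_bound (measurable_risk D hf).aestronglyMeasurable 1 (ae_of_all _ fun θ => by
    rw [risk, Real.norm_of_nonneg measureReal_nonneg]; exact measureReal_le_one)

theorem integrable_empRisk {d N : ℕ} {Θ : Type} [MeasurableSpace Θ] (S : Fin N → Example d)
    {f : Θ → Feature d → ℝ} (hf : Measurable (Function.uncurry f))
    (post : Measure Θ) [IsFiniteMeasure post] : Integrable (empRisk S f) post :=
  Integrable.of_bound (measurable_empRisk S hf).aestronglyMeasurable 1 (ae_of_all _ fun θ => by
    rw [empRisk_eq_empFreq, Real.norm_of_nonneg (empFreq_nonneg _ _)]; exact empFreq_le_one _ _)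

/-- A bound on the mean squared gap bounds the mean gap. -/
theorem integral_risk_le_of_sq {d N : ℕ} {Θ : Type} [MeasurableSpace Θ] (D : Measure (Example d))
    [IsProbabilityMeasure D] {f : Θ → Feature d → ℝ} (hf : Measurable (Function.uncurry f))
    (S : Fin N → Example d) (post : Measure Θ) [IsProbabilityMeasure post] {r : ℝ} (hr : 0 < r)
    (h : ∫ θ, (risk D f θ - empRisk S f θ) ^ 2 ∂post ≤ r ^ 2) :
    ∫ θ, risk D f θ ∂post ≤ ∫ θ, empRisk S f θ ∂post + r := by
  have h1 := integrable_risk D hf post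
  have h2 := integrable_empRisk S hf post
  have hsq : Integrable (fun θ => (risk D f θ - empRisk S f θ) ^ 2) post :=
    Integrable.of_bound (((measurable_risk D hf).sub
      (measurable_empRisk S hf)).pow_const 2).aestronglyMeasurable 1 (ae_of_all _ fun θ => by
        rw [Real.norm_of_nonneg (sq_nonneg _), sq_le_one_iff_abs_le_one]
        exact abs_risk_sub_empRisk_le_one D f S θ)
  -- The pointwise bound g ≤ g²/(2r) + r/2, an equality at g = r, takes the place of Jensen's
  -- inequality.
  have h3 : ∫ θ, (risk D f θ - empRisk S f θ) ∂post ≤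
      ∫ θ, ((risk D f θ - empRisk S f θ) ^ 2 / (2 * r) + r / 2) ∂post := by
    refine integral_mono (h1.sub h2) ((hsq.div_const _).add (integrable_const _)) fun θ => ?_
    have := sq_nonneg (risk D f θ - empRisk S f θ - r)
    have e : (risk D f θ - empRisk S f θ) ^ 2 / (2 * r) + r / 2 - (risk D f θ - empRisk S f θ) =
      (risk D f θ - empRisk S f θ - r) ^ 2 / (2 * r) := by field_simp; ring
    have : 0 ≤ (risk D f θ - empRisk S f θ - r) ^ 2 / (2 * r) := by positivity
    simp only
    linarith
  rw [integral_sub h1 h2, integral_add (hsq.div_const _) (integrable_const _), integral_div,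
    integral_const, probReal_univ, one_smul] at h3
  have h4 : (∫ θ, (risk D f θ - empRisk S f θ) ^ 2 ∂post) / (2 * r) ≤ r / 2 := by
    rw [div_le_iff₀ (by positivity)]; nlinarith
  linarith

/-- The deterministic half of PAC-Bayes: Donsker–Varadhan with φ = 2N gap². The event involves only
the prior, so the posterior may depend on the sample in any way. -/
theorem pacBayesBound_of_gapMoment_lt {d N : ℕ} {Θ : Type} [MeasurableSpace Θ]
    (D : Measure (Example d)) [IsProbabilityMeasure D] {f : Θ → Feature d → ℝ}
    (hf : Measurable (Function.uncurry f)) {post prior : Measure Θ}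
    [IsProbabilityMeasure post] [IsProbabilityMeasure prior] (hN : 0 < N) {δ : ℝ} (hδ : 0 < δ)
    (hδ1 : δ < 1) (hkl : klDiv post prior ≠ ⊤) (S : Fin N → Example d)
    (h : gapMoment D f prior S < ENNReal.ofReal (2 * Real.sqrt N / δ)) :
    PACBayesBound D S f post prior δ := by
  have hN' : (1 : ℝ) ≤ N := by exact_mod_cast hN
  have hsN : 1 ≤ Real.sqrt N := Real.one_le_sqrt.2 hN'
  refine ⟨hkl, ?_⟩
  have hφm : Measurable fun θ => 2 * N * (risk D f θ - empRisk S f θ) ^ 2 :=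
    (((measurable_risk D hf).sub (measurable_empRisk S hf)).pow_const 2).const_mul _
  have hφb : ∀ θ, |2 * N * (risk D f θ - empRisk S f θ) ^ 2| ≤ 2 * (N : ℝ) := fun θ => by
    rw [abs_of_nonneg (by positivity)]
    have := (sq_le_one_iff_abs_le_one _).2 (abs_risk_sub_empRisk_le_one D f S θ)
    nlinarith
  have hdv := integral_le_toReal_klDiv_add_log hkl hφm hφb
  have hexp : ∫ θ, Real.exp (2 * N * (risk D f θ - empRisk S f θ) ^ 2) ∂prior ≤
      2 * Real.sqrt N / δ := by
    rw [integral_eq_lintegral_of_nonneg_ae (ae_of_all _ fun θ => (Real.exp_pos _).le)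
      hφm.exp.aestronglyMeasurable]
    exact ENNReal.toReal_le_of_le_ofReal (by positivity) h.le
  have hei : Integrable (fun θ => Real.exp (2 * N * (risk D f θ - empRisk S f θ) ^ 2)) prior :=
    Integrable.of_bound hφm.exp.aestronglyMeasurable (Real.exp (2 * N))
      (ae_of_all _ fun θ => by simpa using (le_abs_self _).trans (hφb θ))
  have hlog := Real.log_le_log (integral_exp_pos hei) hexp
  have hlogpos : 0 < Real.log (2 * Real.sqrt N / δ) := by
    refine Real.log_pos ?_
    rw [lt_div_iff₀ hδ]; nlinarith
  have hkl0 : 0 ≤ (klDiv post prior).toReal := ENNReal.toReal_nonneg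
  refine integral_risk_le_of_sq D hf S post (Real.sqrt_pos.2 (by positivity)) ?_
  rw [Real.sq_sqrt (by positivity), le_div_iff₀ (by positivity)]
  rw [integral_const_mul] at hdv
  linarith

/-! ### Log-concave tilts of isotropic Gaussian measures -/

theorem lintegral_of_density {V : Type*} [NormedAddCommGroup V] [MeasurableSpace V] [BorelSpace V]
    [SecondCountableTopology V] {ν prior : Measure V} [ν.IsAddRightInvariant] {μ : V} {σ : ℝ} {c : ℝ≥0∞}
    (hc : prior = c • ν.withDensity fun x =>
      ENNReal.ofReal (Real.exp (-(‖x - μ‖ ^ 2 / (2 * σ ^ 2)))))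
    {g : V → ℝ≥0∞} (hg : Measurable g) :
    ∫⁻ x, g x ∂prior =
      c * ∫⁻ u, ENNReal.ofReal (Real.exp (-(‖u‖ ^ 2 / (2 * σ ^ 2)))) * g (u + μ) ∂ν := by
  rw [hc, lintegral_smul_measure, lintegral_withDensity_eq_lintegral_mul _ (by fun_prop) hg,
    smul_eq_mul, ← lintegral_add_right_eq_self _ μ]
  simp

section Tilt

variable {V : Type*} [NormedAddCommGroup V] [InnerProductSpace ℝ V] [FiniteDimensional ℝ V]
  [MeasurableSpace V] [BorelSpace V]

/-- `prior` is the isotropic Gaussian measure with mean `μ` and variance `σ²`, described by its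
density with respect to the Haar measure `ν`. -/
structure IsIsotropicGaussian (ν prior : Measure V) (μ : V) (σ : ℝ) : Prop where
  prob : IsProbabilityMeasure prior
  density : ∃ c : ℝ≥0∞, c ≠ 0 ∧ c ≠ ⊤ ∧
    prior = c • ν.withDensity fun x => ENNReal.ofReal (Real.exp (-(‖x - μ‖ ^ 2 / (2 * σ ^ 2))))
  integrable_sq : ∀ b : V, Integrable (fun x => ⟪b, x - μ⟫ ^ 2) prior
  integral_sq : ∀ b : V, ∫ x, ⟪b, x - μ⟫ ^ 2 ∂prior = σ ^ 2 * ‖b‖ ^ 2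

/-- `post` is obtained from the Gaussian `prior` by an exponential tilt such that the density of
`post` is proportional to `exp (-(G (x - m) + ‖x - m‖² / (2σ²)))`, where the nonnegative `G` grows
along rays and is at most the quadratic form `(1/8) ∑ᵢ ⟪bᵢ, ·⟫²`. -/
def IsConvexTilt {N : ℕ} (prior post : Measure V) (μ m : V) (σ : ℝ) (b : Fin N → V) : Prop :=
  ∃ (G : V → ℝ) (w₀ : ℝ), Measurable G ∧ (∀ u, 0 ≤ G u) ∧ (∀ u, G u ≤ G (Real.sqrt 2 • u)) ∧
    (∀ u, G u ≤ 1 / 8 * ∑ i, ⟪b i, u⟫ ^ 2) ∧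
    post = prior.tilted fun x => -(w₀ + G (x - m) - ⟪x - m, m - μ⟫ / σ ^ 2)

/-- An upper bound for the divergence of a convex tilt from the prior. -/
noncomputable def tiltBound {N : ℕ} (μ m : V) (σ : ℝ) (b : Fin N → V) : ℝ :=
  3 / 2 * ‖m - μ‖ ^ 2 / σ ^ 2 + Module.finrank ℝ V +
    Module.finrank ℝ V / 2 * Real.log (1 + σ ^ 2 * (∑ i, ‖b i‖ ^ 2) / (4 * Module.finrank ℝ V))

theorem lintegral_eq_smul_scale (ν : Measure V) [ν.IsAddHaarMeasure] {t : ℝ} (ht : 0 < t)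
    {g : V → ℝ≥0∞} (hg : Measurable g) :
    ∫⁻ u, g u ∂ν = ENNReal.ofReal (t ^ Module.finrank ℝ V) * ∫⁻ u, g (t • u) ∂ν := by
  have h := Measure.map_addHaar_smul ν ht.ne'
  have h2 : ∫⁻ u, g (t • u) ∂ν = ∫⁻ u, g u ∂(ν.map (t • ·)) :=
    (lintegral_map hg (measurable_const_smul t)).symm
  rw [h2, h, lintegral_smul_measure, smul_eq_mul, ← mul_assoc, ← ENNReal.ofReal_mul (by positivity),
    abs_of_pos (by positivity), mul_inv_cancel₀ (by positivity)]
  simp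

variable {ν prior post : Measure V} [ν.IsAddHaarMeasure] {μ m : V} {σ : ℝ}

/-- Integrals of the Gaussian prior against the tilt, recentred at `m`. -/
theorem lintegral_exp_tilt {c : ℝ≥0∞} (hσ : 0 < σ)
    (hc : prior = c • ν.withDensity fun x =>
      ENNReal.ofReal (Real.exp (-(‖x - μ‖ ^ 2 / (2 * σ ^ 2)))))
    {G : V → ℝ} (hG : Measurable G) (w₀ : ℝ) {h : V → ℝ≥0∞} (hh : Measurable h) :
    ∫⁻ x, ENNReal.ofReal (Real.exp (-(w₀ + G (x - m) - ⟪x - m, m - μ⟫ / σ ^ 2))) * h (x - m)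
      ∂prior =
    ENNReal.ofReal (Real.exp (-(w₀ + ‖m - μ‖ ^ 2 / (2 * σ ^ 2)))) *
      (c * ∫⁻ u, ENNReal.ofReal (Real.exp (-(G u + ‖u‖ ^ 2 / (2 * σ ^ 2)))) * h u ∂ν) := by
  rw [lintegral_of_density hc (by fun_prop), mul_left_comm]
  congr 1
  rw [← lintegral_add_right_eq_self _ (m - μ), ← lintegral_const_mul _ (by fun_prop)]
  refine lintegral_congr fun u => ?_
  have e : u + (m - μ) + μ - m = u := by abel
  rw [e, ← mul_assoc, ← mul_assoc, ← ENNReal.ofReal_mul (Real.exp_pos _).le,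
    ← ENNReal.ofReal_mul (Real.exp_pos _).le, ← Real.exp_add, ← Real.exp_add]
  congr 3
  -- Completing the square: the cross term of ‖u + (m − μ)‖² cancels the linear part of the tilt.
  rw [norm_add_sq_real]
  field_simp
  ring

theorem density_normalization (hprob : IsProbabilityMeasure prior) {c : ℝ≥0∞}
    (hc : prior = c • ν.withDensity fun x =>
      ENNReal.ofReal (Real.exp (-(‖x - μ‖ ^ 2 / (2 * σ ^ 2))))) :
    c * ∫⁻ u, ENNReal.ofReal (Real.exp (-(‖u‖ ^ 2 / (2 * σ ^ 2)))) ∂ν = 1 := by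
  have := lintegral_of_density (ν := ν) hc (g := fun _ => 1) measurable_const
  simpa using this.symm

theorem integrable_exp_tilt (hσ : 0 < σ) (hprob : IsProbabilityMeasure prior) {c : ℝ≥0∞}
    (hc : prior = c • ν.withDensity fun x =>
      ENNReal.ofReal (Real.exp (-(‖x - μ‖ ^ 2 / (2 * σ ^ 2)))))
    {G : V → ℝ} (hG : Measurable G) (hG0 : ∀ u, 0 ≤ G u) (w₀ : ℝ) :
    Integrable (fun x => Real.exp (-(w₀ + G (x - m) - ⟪x - m, m - μ⟫ / σ ^ 2))) prior := by
  refine (lintegral_ofReal_ne_top_iff_integrable (by fun_prop)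
    (ae_of_all _ fun x => (Real.exp_pos _).le)).1 ?_
  have h := lintegral_exp_tilt (m := m) hσ hc hG w₀ (h := fun _ => 1) measurable_const
  simp only [mul_one] at h
  rw [h]
  refine ENNReal.mul_ne_top ENNReal.ofReal_ne_top (ne_top_of_le_ne_top ENNReal.one_ne_top ?_)
  refine le_of_le_of_eq ?_ (density_normalization hprob hc)
  gcongr with u
  linarith [hG0 u]

/-- Lower bound for the normalizing constant: shrink by the factor `t` and use Jensen's
inequality. -/
theorem le_lintegral_tilt {N : ℕ} {b : Fin N → V} (hσ : 0 < σ)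
    (hprior : IsIsotropicGaussian ν prior μ σ) {c : ℝ≥0∞}
    (hc : prior = c • ν.withDensity fun x =>
      ENNReal.ofReal (Real.exp (-(‖x - μ‖ ^ 2 / (2 * σ ^ 2)))))
    {G : V → ℝ} (hG : Measurable G) (hGb : ∀ u, G u ≤ 1 / 8 * ∑ i, ⟪b i, u⟫ ^ 2) {t : ℝ}
    (ht : 0 < t) (ht1 : t ≤ 1) :
    ENNReal.ofReal (t ^ Module.finrank ℝ V *
        Real.exp (-(t ^ 2 * σ ^ 2 * (∑ i, ‖b i‖ ^ 2) / 8))) ≤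
      c * ∫⁻ u, ENNReal.ofReal (Real.exp (-(G u + ‖u‖ ^ 2 / (2 * σ ^ 2)))) ∂ν := by
  have hprob := hprior.prob
  rw [lintegral_eq_smul_scale ν ht (by fun_prop), ENNReal.ofReal_mul (by positivity),
    mul_left_comm]
  gcongr
  set X : V → ℝ := fun x => -(t ^ 2 / 8 * ∑ i, ⟪b i, x - μ⟫ ^ 2) with hX
  have hXm : Measurable X := by
    simp only [hX]
    fun_prop
  have hsum : Integrable (fun x => ∑ i, ⟪b i, x - μ⟫ ^ 2) prior :=
    integrable_finsetSum _ fun i _ => hprior.integrable_sq (b i)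
  have hXi : Integrable X prior := (hsum.const_mul _).neg
  have hXint : ∫ x, X x ∂prior = -(t ^ 2 * σ ^ 2 * (∑ i, ‖b i‖ ^ 2) / 8) := by
    simp only [hX]
    rw [integral_neg, integral_const_mul, integral_finsetSum _ fun i _ => hprior.integrable_sq (b i)]
    simp_rw [hprior.integral_sq]
    rw [← Finset.mul_sum]
    ring
  have hXle : ∀ x, X x ≤ 0 := fun x => by
    simp only [hX]
    have : 0 ≤ ∑ i, ⟪b i, x - μ⟫ ^ 2 := Finset.sum_nonneg fun i _ => sq_nonneg _
    have : 0 ≤ t ^ 2 / 8 * ∑ i, ⟪b i, x - μ⟫ ^ 2 := by positivity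
    linarith
  have hei : Integrable (fun x => Real.exp (X x)) prior :=
    Integrable.of_bound hXm.exp.aestronglyMeasurable 1
      (ae_of_all _ fun x => by simpa using hXle x)
  have hjensen : Real.exp (∫ x, X x ∂prior) ≤ ∫ x, Real.exp (X x) ∂prior :=
    convexOn_exp.map_integral_le Real.continuous_exp.continuousOn isClosed_univ
      (ae_of_all _ fun _ => Set.mem_univ _) hXi hei
  rw [← hXint]
  refine (ENNReal.ofReal_le_ofReal hjensen).trans ?_
  rw [ofReal_integral_eq_lintegral_ofReal hei (ae_of_all _ fun x => (Real.exp_pos _).le),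
    lintegral_of_density (ν := ν) hc (by fun_prop)]
  gcongr with u
  rw [← ENNReal.ofReal_mul (Real.exp_pos _).le, ← Real.exp_add]
  refine ENNReal.ofReal_le_ofReal (Real.exp_le_exp.2 ?_)
  simp only [hX, add_sub_cancel_right]
  have h1 := hGb (t • u)
  -- Shrinking only decreases the quadratic term, so the Gaussian weight of the prior can be put
  -- back and the remaining factor averaged under the prior.
  have h2 : ‖t • u‖ ^ 2 ≤ ‖u‖ ^ 2 := by
    rw [norm_smul, Real.norm_of_nonneg ht.le]
    have : t * ‖u‖ ≤ ‖u‖ := mul_le_of_le_one_left (norm_nonneg _) ht1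
    gcongr
  have h3 : ‖t • u‖ ^ 2 / (2 * σ ^ 2) ≤ ‖u‖ ^ 2 / (2 * σ ^ 2) := by gcongr
  have h4 : 1 / 8 * ∑ i, ⟪b i, t • u⟫ ^ 2 = t ^ 2 / 8 * ∑ i, ⟪b i, u⟫ ^ 2 := by
    simp_rw [real_inner_smul_right, mul_pow]
    rw [← Finset.mul_sum]; ring
  linarith

/-- The optimal choice of the shrinkage factor. -/
theorem exists_shrinkage (n : ℕ) (hn : 0 < n) {A : ℝ} (hA : 0 ≤ A) :
    ∃ t : ℝ, 0 < t ∧ t ≤ 1 ∧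
      Real.exp (-((n : ℝ) / 2 + n / 2 * Real.log (1 + A / (4 * n)))) ≤
        t ^ n * Real.exp (-(t ^ 2 * A / 8)) := by
  have hn' : (0 : ℝ) < n := by exact_mod_cast hn
  have hA' : 0 ≤ A / (4 * n) := by positivity
  set s := 1 + A / (4 * n) with hs
  have hs1 : 1 ≤ s := by linarith
  -- For A > 0 the exact maximizer of n ln t − t²A/8 is t² = 4n/A; the choice t² = 1/(1 + A/(4n))
  -- behaves alike for large A and never exceeds 1.
  refine ⟨(Real.sqrt s)⁻¹, by positivity, inv_le_one_of_one_le₀ (Real.one_le_sqrt.2 hs1), ?_⟩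
  have e : ((Real.sqrt s)⁻¹) ^ n = Real.exp (-(n / 2 * Real.log s)) := by
    rw [← Real.exp_log (show 0 < (Real.sqrt s)⁻¹ by positivity), ← Real.exp_nat_mul, Real.log_inv,
      Real.log_sqrt (by positivity)]
    congr 1; ring
  rw [e, ← Real.exp_add, Real.exp_le_exp, inv_pow, Real.sq_sqrt (by positivity)]
  have : s⁻¹ * A / 8 ≤ n / 2 := by
    have hA4 : A = 4 * n * (s - 1) := by rw [hs]; field_simp; ring
    have : s⁻¹ * A ≤ 4 * n := by
      rw [inv_mul_le_iff₀ (by positivity), hA4]; nlinarith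
    linarith
  linarith

/-- Properties of a convex tilt of the isotropic Gaussian prior that are used for the bounds. -/
structure TiltEstimate (prior post : Measure V) (κ : ℝ) : Prop where
  prob : IsProbabilityMeasure post
  klDiv_le : klDiv post prior ≤ ENNReal.ofReal κ
  lintegral_exp_le : ∀ φ : V → ℝ, Measurable φ →
    ∫⁻ x, ENNReal.ofReal (Real.exp (φ x / 2)) ∂post ≤
      ENNReal.ofReal (Real.exp κ) * (1 + ∫⁻ x, ENNReal.ofReal (Real.exp (φ x)) ∂prior)

/-- Let Z be the normalizing constant of the tilt. Since G ≥ 0, the log-density ratio −W − ln Z is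
at most c₁ + ‖x − m‖²/(4σ²), by the shrinkage bound for Z and Young's inequality for the linear
term. The posterior has E exp(‖x − m‖²/(4σ²)) ≤ 2^(n/2), because dilating by √2 doubles the Gaussian
exponent, which offsets the added square, and does not decrease G. Both conclusions follow from
these two facts. -/
theorem IsConvexTilt.tiltEstimate {N : ℕ} {b : Fin N → V} (hn : 0 < Module.finrank ℝ V)
    (hσ : 0 < σ) (hprior : IsIsotropicGaussian ν prior μ σ)
    (h : IsConvexTilt prior post μ m σ b) : TiltEstimate prior post (tiltBound μ m σ b) := by
  obtain ⟨G, w₀, hG, hG0, hGs, hGb, hpost⟩ := h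
  obtain ⟨c, hc0, hctop, hc⟩ := hprior.density
  have hprob := hprior.prob
  set n := Module.finrank ℝ V with hn_def
  set B := ∑ i, ‖b i‖ ^ 2 with hB
  have hB0 : 0 ≤ B := Finset.sum_nonneg fun i _ => sq_nonneg _
  set W : V → ℝ := fun x => w₀ + G (x - m) - ⟪x - m, m - μ⟫ / σ ^ 2 with hW
  have hWm : Measurable W := by simp only [hW]; fun_prop
  set F := w₀ + ‖m - μ‖ ^ 2 / (2 * σ ^ 2) with hF
  set J : (V → ℝ≥0∞) → ℝ≥0∞ := fun h =>
    c * ∫⁻ u, ENNReal.ofReal (Real.exp (-(G u + ‖u‖ ^ 2 / (2 * σ ^ 2)))) * h u ∂ν with hJ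
  have hJint : ∀ h : V → ℝ≥0∞, Measurable h →
      ∫⁻ x, ENNReal.ofReal (Real.exp (-W x)) * h (x - m) ∂prior =
        ENNReal.ofReal (Real.exp (-F)) * J h := fun h hh => lintegral_exp_tilt hσ hc hG w₀ hh
  set κ₀ : ℝ := (n : ℝ) / 2 + n / 2 * Real.log (1 + σ ^ 2 * B / (4 * n)) with hκ₀
  have hJ1ge : ENNReal.ofReal (Real.exp (-κ₀)) ≤ J (fun _ => 1) := by
    obtain ⟨t, ht, ht1, hle⟩ := exists_shrinkage n hn (A := σ ^ 2 * B) (by positivity)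
    refine (ENNReal.ofReal_le_ofReal hle).trans ?_
    have := le_lintegral_tilt hσ hprior hc hG hGb ht ht1
    simp only [hJ, mul_one]
    rwa [mul_assoc (t ^ 2)] at this
  have hZE : ∫⁻ x, ENNReal.ofReal (Real.exp (-W x)) ∂prior =
      ENNReal.ofReal (Real.exp (-F)) * J (fun _ => 1) := by
    rw [← hJint _ measurable_const]; simp
  have hexpi : Integrable (fun x => Real.exp (-W x)) prior :=
    integrable_exp_tilt hσ hprob hc hG hG0 w₀
  set Z := ∫ x, Real.exp (-W x) ∂prior with hZ
  have hZpos : 0 < Z := integral_exp_pos hexpi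
  have hofZ : ENNReal.ofReal Z = ENNReal.ofReal (Real.exp (-F)) * J (fun _ => 1) := by
    rw [← hZE, hZ, ofReal_integral_eq_lintegral_ofReal hexpi
      (ae_of_all _ fun x => (Real.exp_pos _).le)]
  have hlogZ : -F - κ₀ ≤ Real.log Z := by
    rw [Real.le_log_iff_exp_le hZpos, ← ENNReal.ofReal_le_ofReal_iff hZpos.le, hofZ,
      sub_eq_add_neg, Real.exp_add, ENNReal.ofReal_mul (Real.exp_pos _).le]
    gcongr
  have hpostprob : IsProbabilityMeasure post := by
    rw [hpost]; exact isProbabilityMeasure_tilted hexpi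
  have hsqm : Measurable fun x : V => Real.exp (‖x - m‖ ^ 2 / (4 * σ ^ 2)) := by fun_prop
  -- exponential square moment of the posterior
  have hmom : ∫⁻ x, ENNReal.ofReal (Real.exp (‖x - m‖ ^ 2 / (4 * σ ^ 2))) ∂post ≤
      ENNReal.ofReal (Real.sqrt 2 ^ n) := by
    rw [hpost, lintegral_tilted]
    have e : ∀ x, ENNReal.ofReal (Real.exp (-W x) / Z) *
        ENNReal.ofReal (Real.exp (‖x - m‖ ^ 2 / (4 * σ ^ 2))) =
        (ENNReal.ofReal Z)⁻¹ * (ENNReal.ofReal (Real.exp (-W x)) *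
          ENNReal.ofReal (Real.exp (‖x - m‖ ^ 2 / (4 * σ ^ 2)))) := fun x => by
      rw [ENNReal.ofReal_div_of_pos hZpos, ENNReal.div_eq_inv_mul, mul_assoc]
    change ∫⁻ x, ENNReal.ofReal (Real.exp (-W x) / Z) *
        ENNReal.ofReal (Real.exp (‖x - m‖ ^ 2 / (4 * σ ^ 2))) ∂prior ≤ _
    simp_rw [e]
    rw [lintegral_const_mul _ (by fun_prop),
      hJint (fun u => ENNReal.ofReal (Real.exp (‖u‖ ^ 2 / (4 * σ ^ 2)))) (by fun_prop),
      ENNReal.inv_mul_le_iff (by simpa using hZpos) ENNReal.ofReal_ne_top, hofZ, mul_assoc]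
    gcongr
    simp only [hJ, mul_one]
    rw [lintegral_eq_smul_scale ν (Real.sqrt_pos.2 (zero_lt_two' ℝ)) (by fun_prop), ← hn_def,
      mul_comm (c * _), mul_left_comm]
    gcongr with u
    rw [← ENNReal.ofReal_mul (Real.exp_pos _).le, ← Real.exp_add]
    refine ENNReal.ofReal_le_ofReal (Real.exp_le_exp.2 ?_)
    rw [norm_smul, mul_pow, Real.norm_of_nonneg (Real.sqrt_nonneg 2), Real.sq_sqrt zero_le_two]
    have h1 := hGs u
    have h2 : 2 * ‖u‖ ^ 2 / (2 * σ ^ 2) = 2 * (‖u‖ ^ 2 / (2 * σ ^ 2)) := by ring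
    have h3 : 2 * ‖u‖ ^ 2 / (4 * σ ^ 2) = ‖u‖ ^ 2 / (2 * σ ^ 2) := by field_simp; ring
    linarith
  have hmomi : Integrable (fun x => Real.exp (‖x - m‖ ^ 2 / (4 * σ ^ 2))) post :=
    (lintegral_ofReal_ne_top_iff_integrable hsqm.aestronglyMeasurable
      (ae_of_all _ fun x => (Real.exp_pos _).le)).1
        (ne_top_of_le_ne_top ENNReal.ofReal_ne_top hmom)
  have hmomr : ∫ x, Real.exp (‖x - m‖ ^ 2 / (4 * σ ^ 2)) ∂post ≤ Real.sqrt 2 ^ n := by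
    rw [integral_eq_lintegral_of_nonneg_ae (ae_of_all _ fun x => (Real.exp_pos _).le)
      hsqm.aestronglyMeasurable]
    exact ENNReal.toReal_le_of_le_ofReal (by positivity) hmom
  -- the log-likelihood ratio
  set c₁ := 3 / 2 * ‖m - μ‖ ^ 2 / σ ^ 2 + κ₀ with hc₁
  have hκ₀0 : 0 ≤ κ₀ := by
    have : 0 ≤ Real.log (1 + σ ^ 2 * B / (4 * n)) := Real.log_nonneg (by
      have : 0 ≤ σ ^ 2 * B / (4 * n) := by positivity
      linarith)
    positivity
  have hc₁0 : 0 ≤ c₁ := by positivity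
  have hyoung : ∀ x : V, |⟪x - m, m - μ⟫ / σ ^ 2| ≤
      ‖x - m‖ ^ 2 / (4 * σ ^ 2) + ‖m - μ‖ ^ 2 / σ ^ 2 := fun x => by
    rw [abs_div, abs_of_pos (by positivity : (0 : ℝ) < σ ^ 2)]
    have h1 := abs_real_inner_le_norm (x - m) (m - μ)
    have h2 : ‖x - m‖ * ‖m - μ‖ ≤ ‖x - m‖ ^ 2 / 4 + ‖m - μ‖ ^ 2 := by
      nlinarith [sq_nonneg (‖x - m‖ / 2 - ‖m - μ‖)]
    calc _ ≤ (‖x - m‖ ^ 2 / 4 + ‖m - μ‖ ^ 2) / σ ^ 2 := by gcongr; linarith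
      _ = _ := by field_simp
  have hlle : ∀ x, -W x - Real.log Z ≤ c₁ + ‖x - m‖ ^ 2 / (4 * σ ^ 2) := fun x => by
    have h1 := (le_abs_self _).trans (hyoung x)
    have h2 := hG0 (x - m)
    have h3 : 3 / 2 * ‖m - μ‖ ^ 2 / σ ^ 2 =
      ‖m - μ‖ ^ 2 / σ ^ 2 + ‖m - μ‖ ^ 2 / (2 * σ ^ 2) := by field_simp; ring
    simp only [hW, hc₁, h3]
    simp only [hF] at hlogZ
    linarith
  have hac : post ≪ prior := by rw [hpost]; exact tilted_absolutelyContinuous _ _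
  have hllr : llr post prior =ᵐ[post] fun x => -W x - Real.log Z := by
    refine hac.ae_le ?_
    rw [hpost]
    exact log_rnDeriv_tilted_left_self hexpi
  have hsqi : Integrable (fun x => ‖x - m‖ ^ 2 / (4 * σ ^ 2)) post := by
    refine hmomi.mono' (by fun_prop) (ae_of_all _ fun x => ?_)
    rw [Real.norm_of_nonneg (by positivity)]
    linarith [Real.add_one_le_exp (‖x - m‖ ^ 2 / (4 * σ ^ 2))]
  have hlint : Integrable (fun x => -W x - Real.log Z) post := by
    refine (Integrable.mono' (g := fun x => (|w₀| + ‖m - μ‖ ^ 2 / σ ^ 2 + |Real.log Z|) +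
      (1 + B / 2 * σ ^ 2) * (‖x - m‖ ^ 2 / (4 * σ ^ 2))) ?_ ?_ (ae_of_all _ fun x => ?_))
    · exact (integrable_const _).add (hsqi.const_mul _)
    · exact (hWm.neg.sub_const _).aestronglyMeasurable
    · have h1 := hyoung x
      have h2 : G (x - m) ≤ B / 8 * ‖x - m‖ ^ 2 := by
        refine (hGb _).trans ?_
        have : ∑ i, ⟪b i, x - m⟫ ^ 2 ≤ ∑ i, ‖b i‖ ^ 2 * ‖x - m‖ ^ 2 :=
          Finset.sum_le_sum fun i _ => by
            rw [← mul_pow, ← sq_abs]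
            exact pow_le_pow_left₀ (abs_nonneg _) (abs_real_inner_le_norm _ _) 2
        rw [← Finset.sum_mul] at this
        linarith
      have h3 : B / 2 * σ ^ 2 * (‖x - m‖ ^ 2 / (4 * σ ^ 2)) = B / 8 * ‖x - m‖ ^ 2 := by
        field_simp; ring
      have h4 := hG0 (x - m)
      rw [Real.norm_eq_abs, abs_le]
      rw [abs_le] at h1
      have h5 := abs_le.1 (le_refl |w₀|)
      have h6 := abs_le.1 (le_refl |Real.log Z|)
      have h7 : 0 ≤ B / 8 * ‖x - m‖ ^ 2 := by positivity
      simp only [hW, add_mul, h3, one_mul]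
      constructor <;> linarith [h1.1, h1.2, h5.1, h5.2, h6.1, h6.2]
  have hsqle : ∫ x, ‖x - m‖ ^ 2 / (4 * σ ^ 2) ∂post ≤ (n : ℝ) / 2 := by
    -- Taking expectations in s ≤ a − 1 + exp(s − a), with exp(a) the bound on the exponential
    -- moment, gives E s ≤ a ≤ n/2.
    set a : ℝ := (n : ℝ) / 2 * Real.log 2 with ha
    have hea : Real.sqrt 2 ^ n = Real.exp a := by
      rw [← Real.exp_log (show 0 < Real.sqrt 2 by positivity), ← Real.exp_nat_mul,
        Real.log_sqrt (by positivity)]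
      congr 1; rw [ha]; ring
    have h1 : ∫ x, ‖x - m‖ ^ 2 / (4 * σ ^ 2) ∂post ≤
        ∫ x, (a - 1 + Real.exp (-a) * Real.exp (‖x - m‖ ^ 2 / (4 * σ ^ 2))) ∂post := by
      refine integral_mono hsqi ((integrable_const _).add (hmomi.const_mul _)) fun x => ?_
      simp only
      rw [← Real.exp_add]
      linarith [Real.add_one_le_exp (-a + ‖x - m‖ ^ 2 / (4 * σ ^ 2))]
    rw [integral_add (integrable_const _) (hmomi.const_mul _), integral_const_mul, integral_const,
      probReal_univ, one_smul] at h1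
    have h2 : Real.exp (-a) * ∫ x, Real.exp (‖x - m‖ ^ 2 / (4 * σ ^ 2)) ∂post ≤ 1 := by
      calc _ ≤ Real.exp (-a) * Real.exp a := by rw [← hea]; gcongr
        _ = 1 := by rw [← Real.exp_add]; simp
    have h3 : a ≤ (n : ℝ) / 2 := by
      rw [ha]
      have := Real.log_two_lt_d9
      exact mul_le_of_le_one_right (by positivity) (by linarith)
    linarith
  have hbound : tiltBound μ m σ b = c₁ + (n : ℝ) / 2 := by
    simp only [tiltBound, hc₁, hκ₀, ← hn_def, ← hB]; ring
  rw [hbound]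
  refine ⟨hpostprob, ?_, fun φ hφ => ?_⟩
  · rw [klDiv_of_ac_of_integrable hac (hlint.congr hllr.symm)]
    refine ENNReal.ofReal_le_ofReal ?_
    rw [integral_congr_ae hllr, probReal_univ, probReal_univ]
    have : ∫ x, (-W x - Real.log Z) ∂post ≤ ∫ x, (c₁ + ‖x - m‖ ^ 2 / (4 * σ ^ 2)) ∂post :=
      integral_mono hlint ((integrable_const _).add hsqi) hlle
    rw [integral_add (integrable_const _) hsqi, integral_const, probReal_univ, one_smul] at this
    linarith
  · have hpt : ∀ x, ENNReal.ofReal (Real.exp (-W x) / Z) * ENNReal.ofReal (Real.exp (φ x / 2)) ≤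
        ENNReal.ofReal (Real.exp (c₁ / 2)) * (ENNReal.ofReal (Real.exp (φ x)) +
          ENNReal.ofReal (Real.exp (-W x) / Z) *
            ENNReal.ofReal (Real.exp (‖x - m‖ ^ 2 / (4 * σ ^ 2)))) := fun x => by
      have e1 : Real.exp (-W x) / Z = Real.exp (-W x - Real.log Z) := by
        rw [Real.exp_sub, Real.exp_log hZpos]
      rw [e1, ← ENNReal.ofReal_mul (Real.exp_pos _).le, ← ENNReal.ofReal_mul (Real.exp_pos _).le,
        ← ENNReal.ofReal_add (Real.exp_pos _).le (by positivity),
        ← ENNReal.ofReal_mul (Real.exp_pos _).le]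
      refine ENNReal.ofReal_le_ofReal ?_
      rw [← Real.exp_add, ← Real.exp_add, mul_add, ← Real.exp_add, ← Real.exp_add]
      have hl := hlle x
      set l := -W x - Real.log Z
      set s := ‖x - m‖ ^ 2 / (4 * σ ^ 2)
      -- Here exp(l) is the density. Either l − c₁/2 ≤ φ/2 and the prior term dominates, or φ/2 ≤ l
      -- − c₁/2 ≤ c₁/2 + s and the exponential square moment does.
      rcases le_total (l + φ x / 2) (c₁ / 2 + φ x) with h | h
      · have := Real.exp_le_exp.2 h
        linarith [Real.exp_pos (c₁ / 2 + (l + s))]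
      · have : l + φ x / 2 ≤ c₁ / 2 + (l + s) := by linarith
        have := Real.exp_le_exp.2 this
        linarith [Real.exp_pos (c₁ / 2 + φ x)]
    have hmom' : ∫⁻ x, ENNReal.ofReal (Real.exp (-W x) / Z) *
        ENNReal.ofReal (Real.exp (‖x - m‖ ^ 2 / (4 * σ ^ 2))) ∂prior ≤
        ENNReal.ofReal (Real.sqrt 2 ^ n) := by
      rwa [hpost, lintegral_tilted] at hmom
    rw [hpost, lintegral_tilted]
    refine (lintegral_mono hpt).trans ?_
    rw [lintegral_const_mul _ (by fun_prop), lintegral_add_left (by fun_prop)]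
    have hs2 : Real.sqrt 2 ^ n ≤ Real.exp ((n : ℝ) / 2) := by
      have : Real.sqrt 2 ≤ Real.exp (1 / 2) := by
        rw [Real.sqrt_le_left (Real.exp_pos _).le, ← Real.exp_nat_mul]
        have := Real.add_one_le_exp (1 : ℝ)
        norm_num at this ⊢
        linarith
      calc _ ≤ Real.exp (1 / 2) ^ n := pow_le_pow_left₀ (Real.sqrt_nonneg _) this n
        _ = _ := by rw [← Real.exp_nat_mul]; congr 1; ring
    rw [add_comm (1 : ℝ≥0∞), mul_add, mul_add]
    refine add_le_add ?_ ?_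
    · gcongr
      have : (0 : ℝ) ≤ n / 2 := by positivity
      linarith
    · refine (mul_le_mul_right (hmom'.trans (ENNReal.ofReal_le_ofReal hs2)) _).trans ?_
      rw [mul_one, ← ENNReal.ofReal_mul (Real.exp_pos _).le, ← Real.exp_add]
      refine ENNReal.ofReal_le_ofReal (Real.exp_le_exp.2 ?_)
      linarith

end Tilt

/-! ### The logistic loss -/

/-- The derivative of the logistic loss `x ↦ ln (1 + exp (-x))`, up to sign. -/
noncomputable def logisticSlope (x : ℝ) : ℝ := Real.exp (-x) / (1 + Real.exp (-x))

theorem logisticSlope_nonneg (x : ℝ) : 0 ≤ logisticSlope x := by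
  unfold logisticSlope; positivity

theorem logisticSlope_le_one (x : ℝ) : logisticSlope x ≤ 1 := by
  unfold logisticSlope
  rw [div_le_one (by positivity)]; linarith

/-- The increment of the logistic loss is the log moment generating function of a Bernoulli variable
at −y. Convexity of exp then gives the tangent line as a lower bound, and Hoeffding's lemma the
quadratic upper bound with constant 1/8. -/
theorem log_one_add_exp_neg_add (x y : ℝ) :
    Real.log (1 + Real.exp (-(x + y))) = Real.log (1 + Real.exp (-x)) +
      Real.log (1 - logisticSlope x + logisticSlope x * Real.exp (-y)) := by
  have h : 0 < 1 + Real.exp (-x) := by positivity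
  have e : 1 - logisticSlope x + logisticSlope x * Real.exp (-y) =
      (1 + Real.exp (-(x + y))) / (1 + Real.exp (-x)) := by
    unfold logisticSlope
    rw [neg_add, Real.exp_add]
    field_simp
    ring
  rw [e, Real.log_div (by positivity) (by positivity)]
  ring

theorem logistic_tangent_le (x y : ℝ) :
    Real.log (1 + Real.exp (-x)) - logisticSlope x * y ≤ Real.log (1 + Real.exp (-(x + y))) := by
  rw [log_one_add_exp_neg_add]
  have h := exp_mul_le_bernoulli_mgf (logisticSlope_nonneg x) (logisticSlope_le_one x) (-y)
  have := (Real.le_log_iff_exp_le (lt_of_lt_of_le (Real.exp_pos _) h)).2 h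
  linarith

theorem logistic_le_tangent_add_sq (x y : ℝ) :
    Real.log (1 + Real.exp (-(x + y))) ≤
      Real.log (1 + Real.exp (-x)) - logisticSlope x * y + y ^ 2 / 8 := by
  rw [log_one_add_exp_neg_add]
  have h0 := exp_mul_le_bernoulli_mgf (logisticSlope_nonneg x) (logisticSlope_le_one x) (-y)
  have h := bernoulli_mgf_le (logisticSlope_nonneg x) (logisticSlope_le_one x) (-y)
  have := (Real.log_le_iff_le_exp (lt_of_lt_of_le (Real.exp_pos _) h0)).2 h
  rw [neg_sq] at this
  linarith

/-! ### Posteriors as convex tilts -/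

section Posterior

variable {V : Type*} [NormedAddCommGroup V] [InnerProductSpace ℝ V] [FiniteDimensional ℝ V]
  [MeasurableSpace V] [BorelSpace V]

/-- The Bayes posterior of a logistic likelihood with affine scores is a convex tilt of the prior
around the MAP estimate. -/
theorem isConvexTilt_of_logistic {N : ℕ} (prior : Measure V) {μ m : V} {σ : ℝ} (hσ : 0 < σ)
    (a : Fin N → ℝ) (b : Fin N → V)
    (hm : ∀ x, ∑ i, Real.log (1 + Real.exp (-(a i + ⟪b i, m⟫))) + ‖m - μ‖ ^ 2 / (2 * σ ^ 2) ≤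
      ∑ i, Real.log (1 + Real.exp (-(a i + ⟪b i, x⟫))) + ‖x - μ‖ ^ 2 / (2 * σ ^ 2)) :
    IsConvexTilt prior
      (prior.tilted fun x => -∑ i, Real.log (1 + Real.exp (-(a i + ⟪b i, x⟫)))) μ m σ b := by
  set W : V → ℝ := fun x => ∑ i, Real.log (1 + Real.exp (-(a i + ⟪b i, x⟫))) with hW
  set D : V → V → ℝ := fun x u => ∑ i, logisticSlope (a i + ⟪b i, x⟫) * ⟪b i, u⟫ with hD
  have hlow : ∀ x u, W x - D x u ≤ W (x + u) := fun x u => by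
    simp only [hW, hD]
    rw [← Finset.sum_sub_distrib]
    refine Finset.sum_le_sum fun i _ => ?_
    have := logistic_tangent_le (a i + ⟪b i, x⟫) ⟪b i, u⟫
    rwa [add_assoc, ← inner_add_right] at this
  have hup : ∀ x u, W (x + u) ≤ W x - D x u + 1 / 8 * ∑ i, ⟪b i, u⟫ ^ 2 := fun x u => by
    simp only [hW, hD]
    rw [← Finset.sum_sub_distrib, Finset.mul_sum, ← Finset.sum_add_distrib]
    refine Finset.sum_le_sum fun i _ => ?_
    have := logistic_le_tangent_add_sq (a i + ⟪b i, x⟫) ⟪b i, u⟫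
    rw [add_assoc, ← inner_add_right] at this
    linarith
  have hDsmul : ∀ x u (t : ℝ), D x (t • u) = t * D x u := fun x u t => by
    simp only [hD, real_inner_smul_right, Finset.mul_sum]
    exact Finset.sum_congr rfl fun i _ => by ring
  -- The excess of the objective over its minimum, with the quadratic term ‖u‖²/(2σ²) removed.
  set G : V → ℝ := fun u => W (m + u) - W m + ⟪u, m - μ⟫ / σ ^ 2 with hG
  have hmin : ∀ u, 0 ≤ G u + ‖u‖ ^ 2 / (2 * σ ^ 2) := fun u => by
    have h := hm (m + u)
    have e : ‖m + u - μ‖ ^ 2 = ‖m - μ‖ ^ 2 + 2 * ⟪u, m - μ⟫ + ‖u‖ ^ 2 := by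
      rw [show m + u - μ = (m - μ) + u by abel, norm_add_sq_real, real_inner_comm]
    rw [e, add_div, add_div] at h
    have e2 : 2 * ⟪u, m - μ⟫ / (2 * σ ^ 2) = ⟪u, m - μ⟫ / σ ^ 2 := by field_simp
    simp only [hG, hW]
    rw [e2] at h
    linarith
  -- The directional derivative of the objective at m. Its vanishing is proved from minimality and
  -- the quadratic upper bound, with no differentiation.
  set L : V → ℝ := fun u => ⟪u, m - μ⟫ / σ ^ 2 - D m u with hL
  have hLsmul : ∀ u (t : ℝ), L (t • u) = t * L u := fun u t => by
    simp only [hL, hDsmul, real_inner_smul_left]; ring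
  have hL0 : ∀ u, 0 ≤ L u := fun u => by
    by_contra! hneg
    set R := 1 / 8 * ∑ i, ⟪b i, u⟫ ^ 2 + ‖u‖ ^ 2 / (2 * σ ^ 2) with hR
    have hR0 : 0 ≤ R := by
      have : 0 ≤ ∑ i, ⟪b i, u⟫ ^ 2 := Finset.sum_nonneg fun i _ => sq_nonneg _
      positivity
    -- With this step L + tR = L/(R + 1) < 0, so moving by tu would lower the objective below its
    -- minimum.
    set t := -L u / (R + 1) with ht
    have htpos : 0 < t := div_pos (by linarith) (by linarith)
    have h1 := hmin (t • u)
    have h2 := hup m (t • u)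
    have h3 : 1 / 8 * ∑ i, ⟪b i, t • u⟫ ^ 2 = t ^ 2 * (1 / 8 * ∑ i, ⟪b i, u⟫ ^ 2) := by
      simp_rw [real_inner_smul_right, mul_pow]
      rw [← Finset.mul_sum]; ring
    have h4 : ‖t • u‖ ^ 2 / (2 * σ ^ 2) = t ^ 2 * (‖u‖ ^ 2 / (2 * σ ^ 2)) := by
      rw [norm_smul, mul_pow, Real.norm_eq_abs, sq_abs]; ring
    have h5 := hLsmul u t
    simp only [hG] at h1
    simp only [hL] at h5
    have h6 : 0 ≤ t * (L u + t * R) := by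
      have e : t * (L u + t * R) = t * L u + t ^ 2 * (1 / 8 * ∑ i, ⟪b i, u⟫ ^ 2) +
        t ^ 2 * (‖u‖ ^ 2 / (2 * σ ^ 2)) := by rw [hR]; ring
      rw [e, ← h3, ← h4]
      simp only [hL]
      linarith
    have h7 : 0 ≤ L u + t * R := nonneg_of_mul_nonneg_right h6 htpos
    have h8 : t * (R + 1) = -L u := by rw [ht]; field_simp
    nlinarith
  have hLz : ∀ u, L u = 0 := fun u => by
    have h1 := hL0 u
    have h2 := hL0 ((-1 : ℝ) • u)
    rw [hLsmul] at h2
    linarith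
  have hG0 : ∀ u, 0 ≤ G u := fun u => by
    have h1 := hlow m u
    have h2 := hLz u
    simp only [hL] at h2
    simp only [hG]
    linarith
  refine ⟨G, W m, ?_, hG0, fun u => ?_, fun u => ?_, ?_⟩
  · have hWm : Measurable W := by
      simp only [hW]
      fun_prop
    simp only [hG]
    exact ((hWm.comp (measurable_const_add m)).sub_const _).add (by fun_prop)
  -- Tangents at m + u: looking back to m and using G ≥ 0, the slope of G in direction u is
  -- nonnegative; looking ahead to m + √2 u, G has not decreased.
  · have h1 := hlow (m + u) ((-1 : ℝ) • u)
    have h2 := hlow (m + u) ((Real.sqrt 2 - 1) • u)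
    rw [hDsmul] at h1 h2
    rw [show m + u + (-1 : ℝ) • u = m by simp] at h1
    rw [show m + u + (Real.sqrt 2 - 1) • u = m + Real.sqrt 2 • u by module] at h2
    have h3 := hG0 u
    have h4 : 0 ≤ Real.sqrt 2 - 1 := sub_nonneg.2 (Real.one_le_sqrt.2 one_le_two)
    simp only [hG, real_inner_smul_left] at h3 ⊢
    have h5 : 0 ≤ (Real.sqrt 2 - 1) * (⟪u, m - μ⟫ / σ ^ 2 - D (m + u) u) :=
      mul_nonneg h4 (by linarith)
    have h6 : Real.sqrt 2 * ⟪u, m - μ⟫ / σ ^ 2 = Real.sqrt 2 * (⟪u, m - μ⟫ / σ ^ 2) := by ring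
    rw [h6]
    nlinarith
  · have h1 := hup m u
    have h2 := hLz u
    simp only [hL] at h2
    simp only [hG]
    linarith
  · congr 1
    funext x
    simp only [hG, add_sub_cancel]
    ring

variable {ν prior post : Measure V} [ν.IsAddHaarMeasure] {μ m : V} {σ : ℝ}

/-- A Gaussian measure whose precision is that of the prior plus `∑ᵢ cᵢ bᵢ bᵢᵀ`, `0 ≤ cᵢ ≤ 1/4`, is
a convex tilt of the prior. -/
theorem isConvexTilt_of_density {N : ℕ} (hσ : 0 < σ) (hprior : IsIsotropicGaussian ν prior μ σ)
    [IsProbabilityMeasure post] {b : Fin N → V} {c : Fin N → ℝ} (hc0 : ∀ i, 0 ≤ c i)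
    (hc1 : ∀ i, c i ≤ 1 / 4) {k : ℝ≥0∞} (hk0 : k ≠ 0) (hk : k ≠ ⊤)
    (hpost : post = k • ν.withDensity fun x => ENNReal.ofReal (Real.exp
      (-(1 / 2 * ∑ i, c i * ⟪b i, x - m⟫ ^ 2 + ‖x - m‖ ^ 2 / (2 * σ ^ 2))))) :
    IsConvexTilt prior post μ m σ b := by
  set G : V → ℝ := fun u => 1 / 2 * ∑ i, c i * ⟪b i, u⟫ ^ 2 with hG
  have hGm : Measurable G := by simp only [hG]; fun_prop
  have hG0 : ∀ u, 0 ≤ G u := fun u =>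
    mul_nonneg (by norm_num) (Finset.sum_nonneg fun i _ => mul_nonneg (hc0 i) (sq_nonneg _))
  have hprob := hprior.prob
  refine ⟨G, 0, hGm, hG0, fun u => ?_, fun u => ?_, ?_⟩
  · have : G (Real.sqrt 2 • u) = 2 * G u := by
      simp only [hG, real_inner_smul_right, mul_pow, Real.sq_sqrt zero_le_two, Finset.mul_sum]
      exact Finset.sum_congr rfl fun i _ => by ring
    linarith [hG0 u]
  · simp only [hG, Finset.mul_sum]
    refine Finset.sum_le_sum fun i _ => ?_
    nlinarith [hc1 i, sq_nonneg ⟪b i, u⟫]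
  obtain ⟨c', -, -, hc'⟩ := hprior.density
  have hint := integrable_exp_tilt (m := m) hσ hprob hc' hGm hG0 0
  have hpt := isProbabilityMeasure_tilted hint
  set W : V → ℝ := fun x => 0 + G (x - m) - ⟪x - m, m - μ⟫ / σ ^ 2 with hW
  set Z := ∫ x, Real.exp (-W x) ∂prior with hZ
  have hZpos : 0 < Z := integral_exp_pos hint
  set e := ENNReal.ofReal (Real.exp (-(0 + ‖m - μ‖ ^ 2 / (2 * σ ^ 2)))) with he
  -- The two measures have proportional densities; as both are probability measures, the factor is 1
  -- and the normalizing constants need not be computed.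
  have key : prior.tilted (fun x => -W x) = ((ENNReal.ofReal Z)⁻¹ * e * c' * k⁻¹) • post := by
    ext s hs
    have h1 := lintegral_exp_tilt (m := m) hσ hc' hGm 0
      (h := fun u => s.indicator (fun _ => 1) (u + m))
      ((measurable_const.indicator hs).comp (measurable_add_const m))
    simp only [sub_add_cancel] at h1
    have h2 : post s = k * ∫⁻ u, ENNReal.ofReal (Real.exp (-(G u + ‖u‖ ^ 2 / (2 * σ ^ 2)))) *
        s.indicator (fun _ => 1) (u + m) ∂ν := by
      rw [← lintegral_indicator_one hs, hpost, lintegral_smul_measure,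
        lintegral_withDensity_eq_lintegral_mul _ (by fun_prop) (measurable_one.indicator hs),
        smul_eq_mul, ← lintegral_add_right_eq_self _ m]
      simp only [Pi.mul_apply, add_sub_cancel_right]
      rfl
    rw [Measure.smul_apply, smul_eq_mul, h2, ← lintegral_indicator_one hs, lintegral_tilted]
    have h3 : ∀ x, ENNReal.ofReal (Real.exp (-W x) / Z) * s.indicator 1 x =
        (ENNReal.ofReal Z)⁻¹ * (ENNReal.ofReal (Real.exp (-W x)) *
          s.indicator (fun _ => 1) x) := fun x => by
      rw [ENNReal.ofReal_div_of_pos hZpos, ENNReal.div_eq_inv_mul, mul_assoc]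
      rfl
    change ∫⁻ x, ENNReal.ofReal (Real.exp (-W x) / Z) * s.indicator 1 x ∂prior = _
    simp_rw [h3]
    rw [lintegral_const_mul' _ _ (by simpa using hZpos), h1]
    set I := ∫⁻ u, ENNReal.ofReal (Real.exp (-(G u + ‖u‖ ^ 2 / (2 * σ ^ 2)))) *
        s.indicator (fun _ => 1) (u + m) ∂ν
    calc (ENNReal.ofReal Z)⁻¹ * (e * (c' * I)) = (ENNReal.ofReal Z)⁻¹ * e * c' * 1 * I := by ring
      _ = _ := by rw [← ENNReal.inv_mul_cancel hk0 hk]; ring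
  have hone : (ENNReal.ofReal Z)⁻¹ * e * c' * k⁻¹ = 1 := by
    have h := congrArg (fun ρ : Measure V => ρ Set.univ) key
    simpa using h.symm
  rw [hone, one_smul] at key
  exact key.symm

end Posterior

/-! ### Densities of Gaussian measures -/

/-- The normalized weight exp(−‖x‖²/2) has the Gaussian characteristic function by the Fourier
integral, and characteristic functions determine finite measures. The normalizing constant is left
implicit, since only its being nonzero and finite is used. -/
theorem stdGaussian_density (d : ℕ) : ∃ c : ℝ≥0∞, c ≠ 0 ∧ c ≠ ⊤ ∧
    stdGaussian (Feature d) =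
      c • volume.withDensity fun x => ENNReal.ofReal (Real.exp (-(‖x‖ ^ 2 / 2))) := by
  have hb : 0 < (1 / 2 : ℂ).re := by norm_num
  have hI : ∀ t : Feature d, ∫ x : Feature d, (Real.exp (-(‖x‖ ^ 2 / 2)) : ℂ) *
      Complex.exp (⟪x, t⟫ * Complex.I) =
      (∫ x : Feature d, (Real.exp (-(‖x‖ ^ 2 / 2)) : ℂ)) * Complex.exp (-‖t‖ ^ 2 / 2) := by
    intro t
    have h1 := GaussianFourier.integral_cexp_neg_mul_sq_norm_add (V := Feature d) hb Complex.I t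
    have h0 := GaussianFourier.integral_cexp_neg_mul_sq_norm (V := Feature d) hb
    have e1 : ∀ x : Feature d, (Real.exp (-(‖x‖ ^ 2 / 2)) : ℂ) *
        Complex.exp (⟪x, t⟫ * Complex.I) =
        Complex.exp (-(1 / 2) * ‖x‖ ^ 2 + Complex.I * ⟪t, x⟫) := fun x => by
      rw [Complex.ofReal_exp, ← Complex.exp_add, real_inner_comm]
      congr 1; push_cast; ring
    have e0 : ∀ x : Feature d, (Real.exp (-(‖x‖ ^ 2 / 2)) : ℂ) =
        Complex.exp (-(1 / 2) * ‖x‖ ^ 2) := fun x => by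
      rw [Complex.ofReal_exp]
      congr 1; push_cast; ring
    simp_rw [e1, e0]
    rw [h1, h0, Complex.I_sq]
    congr 2; ring
  have hint : Integrable fun x : Feature d => Real.exp (-(‖x‖ ^ 2 / 2)) := by
    have h := (GaussianFourier.integrable_cexp_neg_mul_sq_norm_add hb 0 (0 : Feature d)).norm
    refine h.congr (ae_of_all _ fun x => ?_)
    simp only [Complex.norm_exp]
    congr 1
    simp [← Complex.ofReal_pow]
    ring
  set Z := ∫ x : Feature d, Real.exp (-(‖x‖ ^ 2 / 2)) with hZ
  have hZpos : 0 < Z := integral_exp_pos hint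
  refine ⟨ENNReal.ofReal Z⁻¹, by simpa using hZpos, ENNReal.ofReal_ne_top, ?_⟩
  have hfin : IsFiniteMeasure (volume.withDensity fun x : Feature d =>
      ENNReal.ofReal (Real.exp (-(‖x‖ ^ 2 / 2)))) :=
    isFiniteMeasure_withDensity_ofReal hint.2
  have hfin2 : IsFiniteMeasure (ENNReal.ofReal Z⁻¹ • volume.withDensity fun x : Feature d =>
      ENNReal.ofReal (Real.exp (-(‖x‖ ^ 2 / 2)))) := 
    Measure.smul_finite _ ENNReal.ofReal_ne_top
  refine Measure.ext_of_charFun (funext fun t => ?_)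
  rw [charFun_stdGaussian, charFun_apply, integral_smul_measure,
    integral_withDensity_eq_integral_toReal_smul (by fun_prop) (by simp)]
  have e : ∀ x : Feature d, (ENNReal.ofReal (Real.exp (-(‖x‖ ^ 2 / 2)))).toReal •
      Complex.exp (⟪x, t⟫ * Complex.I) =
      (Real.exp (-(‖x‖ ^ 2 / 2)) : ℂ) * Complex.exp (⟪x, t⟫ * Complex.I) := fun x => by
    rw [ENNReal.toReal_ofReal (Real.exp_pos _).le, Complex.real_smul]
  simp_rw [e]
  rw [hI, integral_complex_ofReal, ← hZ, ENNReal.toReal_ofReal (by positivity), Complex.real_smul,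
    ← mul_assoc, ← Complex.ofReal_mul, inv_mul_cancel₀ hZpos.ne']
  simp

open scoped MatrixOrder in
/-- The density of a Gaussian measure with invertible covariance, in terms of the precision
matrix. -/
theorem multivariateGaussian_inv_density {d : ℕ} (m : Feature d) {H : Matrix (Fin d) (Fin d) ℝ}
    (hH : H.PosDef) : ∃ c : ℝ≥0∞, c ≠ 0 ∧ c ≠ ⊤ ∧
    multivariateGaussian m H⁻¹ = c • volume.withDensity fun x => ENNReal.ofReal
      (Real.exp (-(1 / 2 * ⟪x - m, Matrix.toEuclideanCLM (𝕜 := ℝ) H (x - m)⟫))) := by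
  obtain ⟨c, hc0, hc, hstd⟩ := stdGaussian_density d
  set A := CFC.sqrt H⁻¹ with hA
  set T := Matrix.toEuclideanCLM (𝕜 := ℝ) A with hT
  have hHu : IsUnit H.det := isUnit_iff_ne_zero.2 hH.det_pos.ne'
  have hAA : A * A = H⁻¹ := CFC.sqrt_mul_sqrt_self _ hH.inv.posSemidef.nonneg
  have hdetA : A.det ≠ 0 := fun h0 => by
    have h1 := congrArg Matrix.det hAA
    rw [Matrix.det_mul, h0, zero_mul] at h1
    exact hH.inv.det_pos.ne h1
  -- The square root A of the covariance pulls the precision form back to ‖x‖², so the density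
  -- follows from that of the standard Gaussian by a linear change of variables.
  have hAHA : A * H * A = 1 := by
    have h1 : A * (A * H) = 1 := by rw [← mul_assoc, hAA, Matrix.nonsing_inv_mul _ hHu]
    exact mul_eq_one_comm.1 h1
  have hTsa : IsSelfAdjoint T := by
    rw [hT]; exact (CFC.sqrt_nonneg H⁻¹).isSelfAdjoint.map _
  have hquad : ∀ x, ⟪T x, Matrix.toEuclideanCLM (𝕜 := ℝ) H (T x)⟫ = ‖x‖ ^ 2 := fun x => by
    have h1 := ContinuousLinearMap.adjoint_inner_right T x
      (Matrix.toEuclideanCLM (𝕜 := ℝ) H (T x))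
    rw [hTsa.adjoint_eq] at h1
    have h2 : T (Matrix.toEuclideanCLM (𝕜 := ℝ) H (T x)) =
        Matrix.toEuclideanCLM (𝕜 := ℝ) (A * H * A) x := by
      rw [map_mul, map_mul]; rfl
    rw [← h1, h2, hAHA, map_one, one_apply_eq_self, real_inner_self_eq_norm_sq]
  have hdetT : LinearMap.det (T : Feature d →ₗ[ℝ] Feature d) ≠ 0 := by
    rw [hT, Matrix.coe_toEuclideanCLM_eq_toEuclideanLin, Matrix.toEuclideanLin_eq_toLin_orthonormal,
      LinearMap.det_toLin]
    exact hdetA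
  refine ⟨c * ENNReal.ofReal |(LinearMap.det (T : Feature d →ₗ[ℝ] Feature d))⁻¹|,
    mul_ne_zero hc0 (by simpa using hdetT), ENNReal.mul_ne_top hc ENNReal.ofReal_ne_top, ?_⟩
  ext s hs
  have hmeas : Measurable fun x => m + T x := by fun_prop
  rw [multivariateGaussian, Measure.map_apply hmeas hs, ← lintegral_indicator_one (hmeas hs), hstd,
    lintegral_smul_measure, lintegral_withDensity_eq_lintegral_mul _ (by fun_prop)
      (measurable_one.indicator (hmeas hs)), Measure.smul_apply, withDensity_apply _ hs,
    ← lintegral_indicator hs]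
  set k : Feature d → ℝ≥0∞ := fun y => s.indicator (fun x => ENNReal.ofReal
      (Real.exp (-(1 / 2 * ⟪x - m, Matrix.toEuclideanCLM (𝕜 := ℝ) H (x - m)⟫)))) (y + m) with hk
  have hshift : ∫⁻ x, s.indicator (fun x => ENNReal.ofReal (Real.exp
      (-(1 / 2 * ⟪x - m, Matrix.toEuclideanCLM (𝕜 := ℝ) H (x - m)⟫)))) x = ∫⁻ x, k x :=
    (lintegral_add_right_eq_self _ m).symm
  have hkm : Measurable k := by
    refine Measurable.comp (Measurable.indicator ?_ hs) (measurable_add_const m)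
    fun_prop
  have hmap := lintegral_map (μ := volume) hkm T.measurable
  have hmap2 := Measure.map_linearMap_addHaar_eq_smul_addHaar (volume : Measure (Feature d)) hdetT
  rw [ContinuousLinearMap.coe_coe] at hmap2
  rw [hmap2, lintegral_smul_measure, smul_eq_mul] at hmap
  rw [smul_eq_mul, smul_eq_mul, mul_assoc, hshift, hmap]
  congr 1
  refine lintegral_congr fun x => ?_
  simp only [hk, Pi.mul_apply]
  by_cases hx : m + T x ∈ s
  · rw [Set.indicator_of_mem (show x ∈ (fun x => m + T x) ⁻¹' s from hx),
      Set.indicator_of_mem (show T x + m ∈ s by rwa [add_comm]), add_sub_cancel_right, hquad]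
    simp only [Pi.one_apply, mul_one]
    congr 3; ring
  · rw [Set.indicator_of_notMem (show x ∉ (fun x => m + T x) ⁻¹' s from hx),
      Set.indicator_of_notMem (show T x + m ∉ s by rwa [add_comm]), mul_zero]

theorem posDef_smul_one {d : ℕ} {v : ℝ} (hv : 0 < v) :
    (v • (1 : Matrix (Fin d) (Fin d) ℝ)).PosDef :=
  Matrix.PosDef.one.smul hv

theorem smul_one_inv {d : ℕ} {v : ℝ} (hv : 0 < v) :
    (v • (1 : Matrix (Fin d) (Fin d) ℝ)) = (v⁻¹ • (1 : Matrix (Fin d) (Fin d) ℝ))⁻¹ := by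
  refine (Matrix.inv_eq_left_inv ?_).symm
  rw [smul_mul_smul_comm, mul_one, mul_inv_cancel₀ hv.ne', one_smul]

instance isGaussian_isoGaussian {d : ℕ} (m : Feature d) (v : ℝ) : IsGaussian (isoGaussian m v) := by
  unfold isoGaussian; infer_instance

theorem integrable_inner_sub_sq {d : ℕ} (m : Feature d) (v : ℝ) (b : Feature d) :
    Integrable (fun x => ⟪b, x - m⟫ ^ 2) (isoGaussian m v) := by
  have h : MemLp (fun x : Feature d => x - m) 2 (isoGaussian m v) :=
    IsGaussian.memLp_two_id.sub (memLp_const m)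
  exact (h.const_inner b).integrable_sq

theorem integral_inner_sub_sq {d : ℕ} (m : Feature d) {v : ℝ} (hv : 0 < v) (b : Feature d) :
    ∫ x, ⟪b, x - m⟫ ^ 2 ∂(isoGaussian m v) = v * ‖b‖ ^ 2 := by
  have h1 := covarianceBilin_multivariateGaussian (μ := m) (posDef_smul_one (d := d) hv).posSemidef
    b b
  rw [covarianceBilin_apply IsGaussian.memLp_two_id, integral_id_multivariateGaussian'] at h1
  have h2 := Matrix.inner_toEuclideanCLM (v • (1 : Matrix (Fin d) (Fin d) ℝ)) b b
  rw [← h2, map_smul, map_one] at h1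
  simp only [smul_apply, one_apply_eq_self, real_inner_smul_right,
    real_inner_self_eq_norm_sq] at h1
  rw [← h1]
  unfold isoGaussian
  simp_rw [sq]

theorem isIsotropicGaussian_symPrior (d : ℕ) {σβ : ℝ} (hσ : 0 < σβ) :
    IsIsotropicGaussian volume (symPrior d σβ) 0 σβ where
  prob := by unfold symPrior; infer_instance
  density := by
    have hv : 0 < σβ ^ 2 := by positivity
    obtain ⟨c, h0, h1, h⟩ := multivariateGaussian_inv_density (0 : Feature d)
      (posDef_smul_one (d := d) (inv_pos.2 hv))
    refine ⟨c, h0, h1, ?_⟩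
    rw [symPrior, isoGaussian, smul_one_inv hv, h]
    congr 2
    funext x
    rw [map_smul, map_one]
    simp only [smul_apply, one_apply_eq_self,
      real_inner_smul_right, real_inner_self_eq_norm_sq]
    congr 3
    field_simp
  integrable_sq b := integrable_inner_sub_sq 0 _ b
  integral_sq b := integral_inner_sub_sq 0 (by positivity) b

theorem gaussianReal_density (m : ℝ) {v : NNReal} (hv : v ≠ 0) : ∃ c : ℝ≥0∞, c ≠ 0 ∧ c ≠ ⊤ ∧
    gaussianReal m v = c • volume.withDensity fun x =>
      ENNReal.ofReal (Real.exp (-((x - m) ^ 2 / (2 * v)))) := by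
  have hv' : (0 : ℝ) < v := by exact_mod_cast pos_iff_ne_zero.2 hv
  refine ⟨ENNReal.ofReal (Real.sqrt (2 * Real.pi * v))⁻¹, ?_, ENNReal.ofReal_ne_top, ?_⟩
  · have : 0 < (Real.sqrt (2 * Real.pi * v))⁻¹ := by positivity
    exact (ENNReal.ofReal_pos.2 this).ne'
  · rw [gaussianReal_of_var_ne_zero _ hv, ← withDensity_smul _ (by fun_prop)]
    congr 1
    funext x
    rw [gaussianPDF, gaussianPDFReal, ENNReal.ofReal_mul (by positivity), neg_div]
    rfl

theorem isIsotropicGaussian_asymPrior (μR : ℝ) {σR : ℝ} (hσ : 0 < σR) :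
    IsIsotropicGaussian volume (asymPrior μR σR) μR σR where
  prob := by unfold asymPrior; infer_instance
  density := by
    have hv : (σR ^ 2).toNNReal ≠ 0 := by simpa using hσ.ne'
    obtain ⟨c, h0, h1, h⟩ := gaussianReal_density μR hv
    refine ⟨c, h0, h1, ?_⟩
    rw [asymPrior, h]
    congr 2
    funext x
    rw [Real.coe_toNNReal _ (by positivity), Real.norm_eq_abs, sq_abs]
  integrable_sq b := by
    have h : MemLp (fun x : ℝ => x - μR) 2 (asymPrior μR σR) := by
      unfold asymPrior
      exact IsGaussian.memLp_two_id.sub (memLp_const _)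
    exact (h.const_inner b).integrable_sq
  integral_sq b := by
    have h := variance_id_gaussianReal (μ := μR) (v := (σR ^ 2).toNNReal)
    rw [variance_eq_integral aemeasurable_id] at h
    simp only [id, integral_id_gaussianReal] at h
    rw [Real.coe_toNNReal _ (by positivity)] at h
    have e : ∀ x : ℝ, ⟪b, x - μR⟫ ^ 2 = b ^ 2 * (x - μR) ^ 2 := fun x => by
      simp only [RCLike.inner_apply, conj_trivial]; ring
    simp_rw [e]
    rw [integral_const_mul, asymPrior, h, Real.norm_eq_abs, sq_abs, mul_comm]

/-! ### Tilt estimates for the four posteriors -/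

theorem signedLabel_sq (y : Bool) : signedLabel y ^ 2 = 1 := by
  cases y <;> simp [signedLabel]

theorem logisticCurv_nonneg {d : ℕ} {Θ : Type} (f : Θ → Feature d → ℝ) (θ : Θ) (x : Example d) :
    0 ≤ logisticCurv f θ x :=
  mul_nonneg (Real.sigmoid_nonneg _) (sub_nonneg.2 (Real.sigmoid_le_one _))

theorem logisticCurv_le {d : ℕ} {Θ : Type} (f : Θ → Feature d → ℝ) (θ : Θ) (x : Example d) :
    logisticCurv f θ x ≤ 1 / 4 := by
  unfold logisticCurv
  nlinarith [sq_nonneg (Real.sigmoid (signedLabel x.2 * f θ x.1) - 1 / 2)]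

/-- The signed embeddings, the gradients of the margins in the linear model. -/
noncomputable def signedFeature {d N : ℕ} (S : Fin N → Example d) (i : Fin N) : Feature d :=
  signedLabel (S i).2 • (S i).1

theorem isConvexTilt_symBayes {d N : ℕ} {σβ : ℝ} (hσ : 0 < σβ) (S : Fin N → Example d) :
    IsConvexTilt (symPrior d σβ) (bayesPosterior (symPrior d σβ) linearScore S) 0 (symMAP σβ S) σβ
      (signedFeature S) := by
  have e : ∀ β : Feature d, logisticNLL linearScore S β =
      ∑ i, Real.log (1 + Real.exp (-(0 + ⟪signedFeature S i, β⟫))) := fun β => by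
    unfold logisticNLL linearScore signedFeature
    refine Finset.sum_congr rfl fun i _ => ?_
    rw [real_inner_smul_left, real_inner_comm, zero_add]
  have h := isConvexTilt_of_logistic (symPrior d σβ) (μ := 0) (m := symMAP σβ S) hσ (fun _ => 0)
    (signedFeature S) (fun x => by
      have := symMAP_le hσ S x
      simp only [symObjective, e] at this
      simpa using this)
  unfold bayesPosterior
  simp_rw [e]
  exact h

theorem inner_symHessian {d N : ℕ} (σβ : ℝ) (S : Fin N → Example d) (u : Feature d) :
    ⟪u, Matrix.toEuclideanCLM (𝕜 := ℝ) (symHessian σβ S) u⟫ =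
      ∑ i, logisticCurv linearScore (symMAP σβ S) (S i) * ⟪signedFeature S i, u⟫ ^ 2 +
        ‖u‖ ^ 2 / σβ ^ 2 := by
  unfold symHessian
  rw [map_add, map_sum, map_smul, map_one]
  simp only [map_smul, add_apply, sum_apply,
    smul_apply, one_apply_eq_self, inner_add_right, inner_sum,
    real_inner_smul_right, real_inner_self_eq_norm_sq]
  congr 1
  · refine Finset.sum_congr rfl fun i _ => ?_
    congr 1
    rw [Matrix.inner_toEuclideanCLM, Matrix.vecMulVec_mulVec]
    unfold signedFeature
    rw [real_inner_smul_left, mul_pow, signedLabel_sq, one_mul,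
      EuclideanSpace.inner_eq_star_dotProduct, star_trivial, dotProduct_smul,
      dotProduct_comm (fun j => (S i).1 j), MulOpposite.smul_eq_mul_unop, MulOpposite.unop_op, sq]
  · ring

theorem posDef_symHessian {d N : ℕ} {σβ : ℝ} (hσ : 0 < σβ) (S : Fin N → Example d) :
    (symHessian σβ S).PosDef := by
  unfold symHessian
  refine Matrix.PosDef.posSemidef_add ?_ (posDef_smul_one (by positivity))
  refine Matrix.posSemidef_sum _ fun i _ => Matrix.PosSemidef.smul ?_ (logisticCurv_nonneg _ _ _)
  simpa using Matrix.posSemidef_vecMulVec_self_star (fun j => (S i).1 j)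

theorem isConvexTilt_symLaplace {d N : ℕ} {σβ : ℝ} (hσ : 0 < σβ) (S : Fin N → Example d) :
    IsConvexTilt (symPrior d σβ) (symLaplace σβ S) 0 (symMAP σβ S) σβ (signedFeature S) := by
  obtain ⟨c, h0, h1, h⟩ := multivariateGaussian_inv_density (symMAP σβ S) (posDef_symHessian hσ S)
  have : IsProbabilityMeasure (symLaplace σβ S) := by unfold symLaplace; infer_instance
  refine isConvexTilt_of_density hσ (isIsotropicGaussian_symPrior d hσ)
    (fun i => logisticCurv_nonneg linearScore (symMAP σβ S) (S i))
    (fun i => logisticCurv_le linearScore (symMAP σβ S) (S i)) h0 h1 ?_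
  rw [symLaplace, h]
  congr 2
  funext x
  rw [inner_symHessian]
  congr 3
  ring

theorem isConvexTilt_asymBayes {d N : ℕ} (q : ℕ) (μR : ℝ) {σR : ℝ} (hσ : 0 < σR)
    (S : Fin N → Example d) :
    IsConvexTilt (asymPrior μR σR) (bayesPosterior (asymPrior μR σR) (radialScore q) S) μR
      (asymMAP q μR σR S) σR (fun i => -signedLabel (S i).2) := by
  have e : ∀ R : ℝ, logisticNLL (radialScore q) S R =
      ∑ i, Real.log (1 + Real.exp (-(signedLabel (S i).2 * ‖(S i).1‖ ^ q +
        ⟪-signedLabel (S i).2, R⟫))) := fun R => by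
    unfold logisticNLL radialScore
    refine Finset.sum_congr rfl fun i _ => ?_
    simp only [RCLike.inner_apply, conj_trivial]
    congr 4; ring
  have h := isConvexTilt_of_logistic (asymPrior μR σR) (μ := μR) (m := asymMAP q μR σR S) hσ
    (fun i => signedLabel (S i).2 * ‖(S i).1‖ ^ q) (fun i => -signedLabel (S i).2) (fun x => by
      have := asymMAP_le q μR hσ S x
      simp only [asymObjective, e] at this
      simpa only [Real.norm_eq_abs, sq_abs] using this)
  unfold bayesPosterior
  simp_rw [e]
  exact h

theorem isConvexTilt_asymLaplace {d N : ℕ} (q : ℕ) (μR : ℝ) {σR : ℝ} (hσ : 0 < σR)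
    (S : Fin N → Example d) :
    IsConvexTilt (asymPrior μR σR) (asymLaplace q μR σR S) μR (asymMAP q μR σR S) σR
      (fun i => -signedLabel (S i).2) := by
  have hH : 0 < asymHessian q μR σR S := by
    have : 0 ≤ ∑ i, logisticCurv (radialScore q) (asymMAP q μR σR S) (S i) :=
      Finset.sum_nonneg fun i _ => logisticCurv_nonneg _ _ _
    unfold asymHessian
    positivity
  have hv : (asymHessian q μR σR S)⁻¹.toNNReal ≠ 0 := by
    simpa using hH
  obtain ⟨c, h0, h1, h⟩ := gaussianReal_density (asymMAP q μR σR S) hv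
  have : IsProbabilityMeasure (asymLaplace q μR σR S) := by unfold asymLaplace; infer_instance
  refine isConvexTilt_of_density hσ (isIsotropicGaussian_asymPrior μR hσ)
    (fun i => logisticCurv_nonneg (radialScore q) (asymMAP q μR σR S) (S i))
    (fun i => logisticCurv_le (radialScore q) (asymMAP q μR σR S) (S i)) h0 h1 ?_
  rw [asymLaplace, h]
  congr 2
  funext x
  rw [Real.coe_toNNReal _ (by positivity)]
  congr 3
  have e : ∀ i, ⟪-signedLabel (S i).2, x - asymMAP q μR σR S⟫ ^ 2 =
      (x - asymMAP q μR σR S) ^ 2 := fun i => by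
    simp only [RCLike.inner_apply, conj_trivial]
    rw [mul_pow, neg_sq, signedLabel_sq, mul_one]
  simp_rw [e]
  rw [← Finset.sum_mul, Real.norm_eq_abs, sq_abs]
  unfold asymHessian
  field_simp

theorem tiltEstimate_sym {d N : ℕ} (hd : 1 ≤ d) {σβ : ℝ} (hσ : 0 < σβ)
    {post : (Fin N → Example d) → Measure (Feature d)}
    (hpost : post ∈ ({bayesPosterior (symPrior d σβ) linearScore, symLaplace σβ} :
      Set ((Fin N → Example d) → Measure (Feature d)))) (S : Fin N → Example d) :
    TiltEstimate (symPrior d σβ) (post S)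
      (tiltBound 0 (symMAP σβ S) σβ (signedFeature S)) := by
  have hn : 0 < Module.finrank ℝ (Feature d) := by rw [finrank_euclideanSpace_fin]; exact hd
  rcases hpost with rfl | rfl
  · exact (isConvexTilt_symBayes hσ S).tiltEstimate hn hσ (isIsotropicGaussian_symPrior d hσ)
  · exact (isConvexTilt_symLaplace hσ S).tiltEstimate hn hσ (isIsotropicGaussian_symPrior d hσ)

theorem tiltEstimate_asym {d N : ℕ} (q : ℕ) (μR : ℝ) {σR : ℝ} (hσ : 0 < σR)
    {post : (Fin N → Example d) → Measure ℝ}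
    (hpost : post ∈ ({bayesPosterior (asymPrior μR σR) (radialScore q), asymLaplace q μR σR} :
      Set ((Fin N → Example d) → Measure ℝ))) (S : Fin N → Example d) :
    TiltEstimate (asymPrior μR σR) (post S)
      (tiltBound μR (asymMAP q μR σR S) σR fun i => -signedLabel (S i).2) := by
  have hn : 0 < Module.finrank ℝ ℝ := by simp
  rcases hpost with rfl | rfl
  · exact (isConvexTilt_asymBayes q μR hσ S).tiltEstimate hn hσ
      (isIsotropicGaussian_asymPrior μR hσ)
  · exact (isConvexTilt_asymLaplace q μR hσ S).tiltEstimate hn hσ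
      (isIsotropicGaussian_asymPrior μR hσ)

/-! ### The data distribution -/

theorem lintegral_dataLaw {d K : ℕ} (p₀ σ₀ ε : ℝ) (w : Fin K → ℝ) (μ : Fin K → Feature d)
    {g : Example d → ℝ≥0∞} (hg : Measurable g) :
    ∫⁻ x, g x ∂(dataLaw p₀ σ₀ ε w μ) =
      ENNReal.ofReal p₀ * ∫⁻ z, g (z, false) ∂(isoGaussian (0 : Feature d) (σ₀ ^ 2)) +
      ENNReal.ofReal (1 - p₀) *
        ∑ k, ENNReal.ofReal (w k) * ∫⁻ z, g (z, true) ∂(isoGaussian (μ k) (σ₀ ^ 2 + ε)) := by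
  have : IsFiniteMeasure (∑ k, ENNReal.ofReal (w k) • isoGaussian (μ k) (σ₀ ^ 2 + ε)) := ⟨by
    simp [Measure.finsetSum_apply]⟩
  unfold dataLaw
  rw [lintegral_add_measure, lintegral_smul_measure, lintegral_smul_measure, Measure.prod_dirac,
    Measure.prod_dirac, lintegral_map hg measurable_prodMk_right,
    lintegral_map hg measurable_prodMk_right, lintegral_finsetSum_measure]
  simp only [lintegral_smul_measure, smul_eq_mul]

theorem isProbabilityMeasure_dataLaw {d K : ℕ} {p₀ : ℝ} (σ₀ ε : ℝ) {w : Fin K → ℝ}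
    (μ : Fin K → Feature d) (hp0 : 0 < p₀) (hp1 : p₀ < 1) (hw : ∀ k, 0 ≤ w k)
    (hw1 : ∑ k, w k = 1) : IsProbabilityMeasure (dataLaw p₀ σ₀ ε w μ) := by
  constructor
  rw [← lintegral_one, lintegral_dataLaw _ _ _ _ _ measurable_const]
  simp only [lintegral_one, measure_univ, mul_one]
  rw [← ENNReal.ofReal_sum_of_nonneg fun k _ => hw k, hw1, ENNReal.ofReal_one, mul_one,
    ← ENNReal.ofReal_add hp0.le (by linarith)]
  simp

theorem lintegral_norm_sq_isoGaussian_le {d : ℕ} (m : Feature d) {v : ℝ} (hv : 0 < v) :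
    ∫⁻ x, ENNReal.ofReal (‖x‖ ^ 2) ∂(isoGaussian m v) ≤
      ENNReal.ofReal (2 * (d * v) + 2 * ‖m‖ ^ 2) := by
  have hb : ∀ x : Feature d, ‖x - m‖ ^ 2 = ∑ j, ⟪EuclideanSpace.basisFun (Fin d) ℝ j, x - m⟫ ^ 2 :=
    fun x => ((EuclideanSpace.basisFun (Fin d) ℝ).sum_sq_inner_right (x - m)).symm
  have hi : Integrable (fun x : Feature d => ‖x - m‖ ^ 2) (isoGaussian m v) := by
    simp_rw [hb]
    exact integrable_finsetSum _ fun j _ => integrable_inner_sub_sq m v _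
  have hint : ∫ x, ‖x - m‖ ^ 2 ∂(isoGaussian m v) = d * v := by
    simp_rw [hb]
    rw [integral_finsetSum _ fun j _ => integrable_inner_sub_sq m v _]
    simp_rw [integral_inner_sub_sq m hv]
    simp
  have hle : ∀ x : Feature d, ‖x‖ ^ 2 ≤ 2 * ‖x - m‖ ^ 2 + 2 * ‖m‖ ^ 2 := fun x => by
    have h1 : ‖x‖ ≤ ‖x - m‖ + ‖m‖ := by simpa using norm_add_le (x - m) m
    have h2 : ‖x‖ ^ 2 ≤ (‖x - m‖ + ‖m‖) ^ 2 := pow_le_pow_left₀ (norm_nonneg _) h1 2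
    nlinarith [sq_nonneg (‖x - m‖ - ‖m‖)]
  calc ∫⁻ x, ENNReal.ofReal (‖x‖ ^ 2) ∂(isoGaussian m v)
      ≤ ∫⁻ x, ENNReal.ofReal (2 * ‖x - m‖ ^ 2 + 2 * ‖m‖ ^ 2) ∂(isoGaussian m v) :=
        lintegral_mono fun x => ENNReal.ofReal_le_ofReal (hle x)
    _ = ENNReal.ofReal (∫ x, (2 * ‖x - m‖ ^ 2 + 2 * ‖m‖ ^ 2) ∂(isoGaussian m v)) :=
        (ofReal_integral_eq_lintegral_ofReal ((hi.const_mul 2).add (integrable_const _))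
          (ae_of_all _ fun x => by
            change 0 ≤ 2 * ‖x - m‖ ^ 2 + 2 * ‖m‖ ^ 2; positivity)).symm
    _ = _ := by
        rw [integral_add (hi.const_mul 2) (integrable_const _), integral_const_mul, hint,
          integral_const, probReal_univ, one_smul]

/-- Every component has a second moment of order d, and the weights sum to one, so K drops out. The
bound on the means enters the argument only here. -/
theorem lintegral_norm_sq_dataLaw_le {d K : ℕ} {p₀ σ₀ ε M : ℝ} {w : Fin K → ℝ}
    {μ : Fin K → Feature d} (hp0 : 0 < p₀) (hp1 : p₀ < 1) (hσ : 0 < σ₀) (hε : 0 < ε)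
    (hw : ∀ k, 0 ≤ w k) (hw1 : ∑ k, w k = 1) (hμ : ∀ k, ‖μ k‖ ≤ M * Real.sqrt d) :
    ∫⁻ x, ENNReal.ofReal (‖x.1‖ ^ 2) ∂(dataLaw p₀ σ₀ ε w μ) ≤
      ENNReal.ofReal (2 * (σ₀ ^ 2 + ε + M ^ 2) * d) := by
  have hprob := isProbabilityMeasure_dataLaw σ₀ ε μ hp0 hp1 hw hw1
  have hd : (0 : ℝ) ≤ d := Nat.cast_nonneg d
  rw [lintegral_dataLaw _ _ _ _ _ (by fun_prop)]
  have h1 := lintegral_norm_sq_isoGaussian_le (0 : Feature d) (v := σ₀ ^ 2) (by positivity)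
  have h2 : ∀ k, ∫⁻ z, ENNReal.ofReal (‖z‖ ^ 2) ∂(isoGaussian (μ k) (σ₀ ^ 2 + ε)) ≤
      ENNReal.ofReal (2 * (σ₀ ^ 2 + ε + M ^ 2) * d) := fun k => by
    refine (lintegral_norm_sq_isoGaussian_le (μ k) (by positivity)).trans
      (ENNReal.ofReal_le_ofReal ?_)
    have : ‖μ k‖ ^ 2 ≤ (M * Real.sqrt d) ^ 2 := pow_le_pow_left₀ (norm_nonneg _) (hμ k) 2
    rw [mul_pow, Real.sq_sqrt hd] at this
    nlinarith
  have h1' : ∫⁻ z, ENNReal.ofReal (‖z‖ ^ 2) ∂(isoGaussian (0 : Feature d) (σ₀ ^ 2)) ≤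
      ENNReal.ofReal (2 * (σ₀ ^ 2 + ε + M ^ 2) * d) := by
    refine h1.trans (ENNReal.ofReal_le_ofReal ?_)
    rw [norm_zero]
    nlinarith [mul_nonneg hd hε.le, mul_nonneg hd (sq_nonneg M)]
  set a := ENNReal.ofReal (2 * (σ₀ ^ 2 + ε + M ^ 2) * d)
  calc _ ≤ ENNReal.ofReal p₀ * a + ENNReal.ofReal (1 - p₀) * ∑ k, ENNReal.ofReal (w k) * a := by
        gcongr with k
        exact h2 k
    _ = a := by
        rw [← Finset.sum_mul, ← ENNReal.ofReal_sum_of_nonneg fun k _ => hw k, hw1,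
          ENNReal.ofReal_one, one_mul, ← add_mul, ← ENNReal.ofReal_add hp0.le (by linarith)]
        simp

theorem map_inner_isoGaussian {d : ℕ} {v : ℝ} (hv : 0 < v) (u : Feature d) :
    (isoGaussian (0 : Feature d) v).map (fun z => ⟪u, z⟫) =
      gaussianReal 0 (v * ‖u‖ ^ 2).toNNReal := by
  have h := IsGaussian.map_eq_gaussianReal (μ := isoGaussian (0 : Feature d) v) (innerSL ℝ u)
  have h1 : ∫ x, innerSL ℝ u x ∂(isoGaussian (0 : Feature d) v) = 0 := by
    rw [ContinuousLinearMap.integral_comp_comm _ IsGaussian.integrable_fun_id, isoGaussian,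
      integral_id_multivariateGaussian, map_zero]
  have h2 : Var[innerSL ℝ u; isoGaussian (0 : Feature d) v] = v * ‖u‖ ^ 2 := by
    rw [variance_eq_integral (by fun_prop), h1, ← integral_inner_sub_sq 0 hv u]
    simp
  rw [h1, h2] at h
  exact h

/-- The live examples with a margin larger than `τ` in direction `v`. -/
def liveMargin {d : ℕ} (τ : ℝ) (v : Feature d) : Set (Example d) :=
  {x | x.2 = false ∧ τ < ⟪v, x.1⟫}

theorem measurableSet_liveMargin {d : ℕ} (τ : ℝ) (v : Feature d) :
    MeasurableSet (liveMargin τ v) :=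
  (measurable_snd (measurableSet_singleton false)).inter
    (measurableSet_lt (f := fun _ => τ) (g := fun x : Example d => ⟪v, x.1⟫) measurable_const
      (by fun_prop))

/-- For a live point ⟨v, z⟩ is centred Gaussian with standard deviation σ₀‖v‖ ≥ σ₀/2, so it exceeds
σ₀/2 at least as often as a standard Gaussian exceeds 1. The spoof part is discarded, which makes
the bound independent of d, K and the means. -/
theorem le_dataLaw_liveMargin {d K : ℕ} {p₀ σ₀ : ℝ} (ε : ℝ) {w : Fin K → ℝ}
    (μ : Fin K → Feature d) (hp0 : 0 < p₀) (hp1 : p₀ < 1) (hσ : 0 < σ₀) (hw : ∀ k, 0 ≤ w k)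
    (hw1 : ∑ k, w k = 1) {v : Feature d} (hv : 1 / 2 ≤ ‖v‖) :
    p₀ * (gaussianReal 0 1).real (Set.Ioi 1) ≤
      (dataLaw p₀ σ₀ ε w μ).real (liveMargin (σ₀ / 2) v) := by
  have hprob := isProbabilityMeasure_dataLaw σ₀ ε μ hp0 hp1 hw hw1
  have hm := measurableSet_liveMargin (σ₀ / 2) v
  rw [measureReal_def (dataLaw p₀ σ₀ ε w μ),
    ← ENNReal.ofReal_le_iff_le_toReal (measure_ne_top _ _)]
  rw [← lintegral_indicator_one hm, lintegral_dataLaw _ _ _ _ _ (measurable_one.indicator hm)]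
  refine le_trans ?_ le_self_add
  rw [ENNReal.ofReal_mul hp0.le, ofReal_measureReal]
  gcongr
  have e : ∀ z : Feature d, (liveMargin (σ₀ / 2) v).indicator (1 : Example d → ℝ≥0∞) (z, false) =
      ((fun z => ⟪v, z⟫) ⁻¹' Set.Ioi (σ₀ / 2)).indicator 1 z := fun z => by
    by_cases h : σ₀ / 2 < ⟪v, z⟫ <;> simp [liveMargin, Set.indicator, h]
  simp_rw [e]
  have hmi : Measurable fun z : Feature d => ⟪v, z⟫ := by fun_prop
  rw [lintegral_indicator_one (hmi measurableSet_Ioi), ← Measure.map_apply hmi measurableSet_Ioi,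
    map_inner_isoGaussian (by positivity)]
  have e2 : gaussianReal 0 (σ₀ ^ 2 * ‖v‖ ^ 2).toNNReal =
      (gaussianReal 0 1).map ((σ₀ * ‖v‖) * ·) := by
    rw [gaussianReal_map_const_mul]
    congr 1
    · simp
    · ext
      rw [Real.coe_toNNReal _ (by positivity)]
      simp [mul_pow]
  rw [e2, Measure.map_apply (measurable_const_mul _) measurableSet_Ioi]
  refine measure_mono fun x hx => ?_
  have hx' : (1 : ℝ) < x := hx
  simp only [Set.mem_preimage, Set.mem_Ioi]
  have h1 : σ₀ * (1 / 2) ≤ σ₀ * ‖v‖ := by gcongr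
  have h2 : 0 < σ₀ * ‖v‖ := by linarith [mul_pos hσ (by norm_num : (0 : ℝ) < 1 / 2)]
  nlinarith

theorem gaussianReal_Ioi_pos : 0 < (gaussianReal 0 1).real (Set.Ioi 1) := by
  rw [measureReal_def]
  refine ENNReal.toReal_pos (fun h => ?_) (measure_ne_top _ _)
  have := gaussianReal_absolutelyContinuous' 0 (one_ne_zero (α := NNReal)) h
  simp at this

/-! ### A grid net of the unit ball -/

/-- Rounding each coordinate down to the grid (1/k)ℤ ∩ [−1, 1] suffices. A volumetric net would save
nothing that matters: k will be polynomial in d/δ, so the logarithm of the cardinality is still of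
order d times a logarithm. -/
theorem exists_net (d : ℕ) {k : ℕ} (hk : 0 < k) :
    ∃ T : Finset (Feature d), T.card ≤ (2 * k + 1) ^ d ∧
      ∀ u : Feature d, ‖u‖ ≤ 1 → ∃ v ∈ T, ‖u - v‖ ≤ Real.sqrt d / k := by
  classical
  have hk' : (0 : ℝ) < k := by exact_mod_cast hk
  let F : (Fin d → Fin (2 * k + 1)) → Feature d :=
    fun s => WithLp.toLp 2 fun j => ((s j : ℝ) - k) / k
  refine ⟨Finset.univ.image F, Finset.card_image_le.trans (by simp), fun u hu => ?_⟩
  have hcoord : ∀ j, |u j| ≤ 1 := fun j => (PiLp.norm_apply_le u j).trans hu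
  have hex : ∀ j, ∃ s : Fin (2 * k + 1), |u j - ((s : ℝ) - k) / k| ≤ 1 / k := fun j => by
    have h0 : 0 ≤ k * (u j + 1) := mul_nonneg hk'.le (by linarith [(abs_le.1 (hcoord j)).1])
    have h1 : k * (u j + 1) ≤ 2 * k := by nlinarith [(abs_le.1 (hcoord j)).2]
    have hle := Nat.floor_le h0
    have hlt := Nat.lt_floor_add_one (k * (u j + 1))
    have hb : ⌊k * (u j + 1)⌋₊ < 2 * k + 1 := by
      rw [Nat.floor_lt h0]; push_cast; linarith
    refine ⟨⟨⌊k * (u j + 1)⌋₊, hb⟩, ?_⟩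
    simp only
    have e : u j - ((⌊k * (u j + 1)⌋₊ : ℝ) - k) / k = (k * (u j + 1) - ⌊k * (u j + 1)⌋₊) / k := by
      field_simp; ring
    rw [e, abs_of_nonneg (div_nonneg (by linarith) hk'.le)]
    gcongr
    linarith
  choose s hs using hex
  refine ⟨F s, Finset.mem_image_of_mem _ (Finset.mem_univ _), ?_⟩
  rw [EuclideanSpace.norm_eq, Real.sqrt_le_left (by positivity), div_pow,
    Real.sq_sqrt (Nat.cast_nonneg d)]
  calc ∑ j, ‖(u - F s) j‖ ^ 2 ≤ ∑ _j : Fin d, (1 / (k : ℝ)) ^ 2 :=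
        Finset.sum_le_sum fun j _ => by
          have := hs j
          simp only [PiLp.sub_apply, F, Real.norm_eq_abs]
          gcongr
    _ = d / k ^ 2 := by simp [div_eq_mul_inv]

/-! ### The size of the MAP estimate -/

/-- Comparison with β = 0, where the loss is N ln 2 and the penalty vanishes. -/
theorem symMAP_norm_sq_le {d N : ℕ} {σβ : ℝ} (hσ : 0 < σβ) (S : Fin N → Example d) :
    ‖symMAP σβ S‖ ^ 2 ≤ 2 * σβ ^ 2 * (N * Real.log 2) := by
  have h := symMAP_le hσ S 0
  have h0 := logisticNLL_nonneg linearScore S (symMAP σβ S)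
  have h1 : logisticNLL linearScore S (0 : Feature d) = N * Real.log 2 := by
    simp [logisticNLL, linearScore]
    norm_num
  simp only [symObjective, h1, norm_zero] at h
  have h2 : ‖symMAP σβ S‖ ^ 2 / (2 * σβ ^ 2) ≤ N * Real.log 2 := by
    have : (0 : ℝ) ^ 2 / (2 * σβ ^ 2) = 0 := by simp
    linarith
  rw [div_le_iff₀ (by positivity)] at h2
  linarith

/-- If every direction has a positive fraction of live examples with large margin, the MAP estimate
is bounded. -/
theorem symMAP_norm_le_of_margin {d N : ℕ} (hN : 0 < N) {σβ : ℝ} (hσ : 0 < σβ)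
    (S : Fin N → Example d) {τ p ρ R : ℝ} (hτ : 0 < τ) (hp : 0 < p) (hρ : 0 ≤ ρ) (hR : 0 ≤ R)
    (hρR : ρ * R ≤ τ * p / 4) (hS : ∑ i, ‖(S i).1‖ ^ 2 ≤ N * R ^ 2)
    (h : ∀ u : Feature d, ‖u‖ = 1 → ∃ v, ‖u - v‖ ≤ ρ ∧ p / 2 ≤ empFreq (liveMargin τ v) S) :
    ‖symMAP σβ S‖ ≤ 4 * Real.log 2 / (τ * p) := by
  have hN' : (0 : ℝ) < N := by exact_mod_cast hN
  set m := symMAP σβ S with hm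
  by_cases hm0 : m = 0
  · rw [hm0, norm_zero]; have := Real.log_pos one_lt_two; positivity
  have hmpos : 0 < ‖m‖ := norm_pos_iff.2 hm0
  obtain ⟨v, huv, hfreq⟩ := h (‖m‖⁻¹ • m) (by rw [norm_smul, norm_inv, norm_norm]; field_simp)
  have hnll : logisticNLL linearScore S m ≤ N * Real.log 2 := by
    have h := symMAP_le hσ S 0
    have h1 : logisticNLL linearScore S (0 : Feature d) = N * Real.log 2 := by
      simp [logisticNLL, linearScore]
      norm_num
    simp only [symObjective, h1, norm_zero, ← hm] at h
    have h2 : (0 : ℝ) ^ 2 / (2 * σβ ^ 2) = 0 := by simp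
    have h3 : 0 ≤ ‖m‖ ^ 2 / (2 * σβ ^ 2) := by positivity
    linarith
  -- A live point with score s has loss ln(1 + eˢ) ≥ s; other losses are only known to be
  -- nonnegative. The term ρ‖z‖ pays for replacing the direction of m by the net point v.
  have hterm : ∀ i, ‖m‖ * (τ * (liveMargin τ v).indicator (fun _ => (1 : ℝ)) (S i) -
      ρ * ‖(S i).1‖) ≤ Real.log (1 + Real.exp (-(signedLabel (S i).2 * linearScore m (S i).1))) := by
    intro i
    have hlog0 : 0 ≤ Real.log (1 + Real.exp (-(signedLabel (S i).2 * linearScore m (S i).1))) :=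
      Real.log_nonneg (by linarith [Real.exp_pos (-(signedLabel (S i).2 * linearScore m (S i).1))])
    by_cases hi : S i ∈ liveMargin τ v
    · rw [Set.indicator_of_mem hi]
      have h1 : linearScore m (S i).1 ≤
          Real.log (1 + Real.exp (-(signedLabel (S i).2 * linearScore m (S i).1))) := by
        rw [hi.1]
        rw [Real.le_log_iff_exp_le (by positivity)]
        simp [signedLabel]
      refine le_trans ?_ h1
      have h2 : linearScore m (S i).1 = ‖m‖ * ⟪‖m‖⁻¹ • m, (S i).1⟫ := by
        rw [linearScore, real_inner_smul_left]; field_simp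
      rw [h2]
      have h3 : ⟪‖m‖⁻¹ • m, (S i).1⟫ = ⟪v, (S i).1⟫ + ⟪‖m‖⁻¹ • m - v, (S i).1⟫ := by
        rw [← inner_add_left]; congr 1; abel
      have h4 : -(ρ * ‖(S i).1‖) ≤ ⟪‖m‖⁻¹ • m - v, (S i).1⟫ := by
        have h5 := (abs_le.1 (abs_real_inner_le_norm (‖m‖⁻¹ • m - v) (S i).1)).1
        have h6 : ‖‖m‖⁻¹ • m - v‖ * ‖(S i).1‖ ≤ ρ * ‖(S i).1‖ := by gcongr
        linarith
      have h7 : τ < ⟪v, (S i).1⟫ := hi.2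
      gcongr
      linarith
    · rw [Set.indicator_of_notMem hi]
      refine le_trans ?_ hlog0
      have : 0 ≤ ‖m‖ * (ρ * ‖(S i).1‖) := by positivity
      linarith
  have hsum := (Finset.sum_le_sum fun i (_ : i ∈ Finset.univ) => hterm i).trans hnll
  rw [← Finset.mul_sum, Finset.sum_sub_distrib, ← Finset.mul_sum, ← Finset.mul_sum] at hsum
  have hf : ∑ i, (liveMargin τ v).indicator (fun _ => (1 : ℝ)) (S i) =
      N * empFreq (liveMargin τ v) S := by
    unfold empFreq; field_simp
  -- Cauchy–Schwarz.
  have hnorm : ∑ i, ‖(S i).1‖ ≤ N * R := by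
    have h1 := sq_sum_le_card_mul_sum_sq (s := Finset.univ) (f := fun i => ‖(S i).1‖)
    simp only [Finset.card_univ, Fintype.card_fin] at h1
    have h2 : (∑ i, ‖(S i).1‖) ^ 2 ≤ (N * R) ^ 2 := by nlinarith
    exact (pow_le_pow_iff_left₀ (Finset.sum_nonneg fun i _ => norm_nonneg _) (by positivity)
      two_ne_zero).1 h2
  rw [hf] at hsum
  have h1 : N * (τ * p / 4) ≤ τ * (N * empFreq (liveMargin τ v) S) - ρ * ∑ i, ‖(S i).1‖ := by
    have h2 : τ * (N * (p / 2)) ≤ τ * (N * empFreq (liveMargin τ v) S) := by gcongr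
    have h3 : ρ * ∑ i, ‖(S i).1‖ ≤ ρ * (N * R) := by gcongr
    nlinarith
  have h2 : ‖m‖ * (N * (τ * p / 4)) ≤ N * Real.log 2 :=
    (mul_le_mul_of_nonneg_left h1 hmpos.le).trans hsum
  rw [le_div_iff₀ (by positivity)]
  have h3 : N * (‖m‖ * (τ * p)) ≤ N * (4 * Real.log 2) := by linarith
  exact le_of_mul_le_mul_left h3 hN'

/-! ### High probability bound for the tilt bound of the linear model -/

theorem half_le_log_two_mul_div {N : ℕ} (hN : 1 ≤ N) {δ : ℝ} (hδ : 0 < δ) (hδ1 : δ < 1) :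
    1 / 2 ≤ Real.log (2 * N / δ) := by
  have hN' : (1 : ℝ) ≤ N := by exact_mod_cast hN
  have h1 : (2 : ℝ) ≤ 2 * N / δ := by rw [le_div_iff₀ hδ]; nlinarith
  have h2 := Real.log_le_log two_pos h1
  linarith [Real.log_two_gt_d9]

theorem measure_sum_norm_sq_ge_le {d N : ℕ} (hN : 0 < N) (D : Measure (Example d))
    [IsProbabilityMeasure D] {c δ : ℝ} (hc : 0 < c) (hδ : 0 < δ)
    (h : ∫⁻ x, ENNReal.ofReal (‖x.1‖ ^ 2) ∂D ≤ ENNReal.ofReal c) :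
    sampleLaw D N {S | N * (c / δ) ≤ ∑ i, ‖(S i).1‖ ^ 2} ≤ ENNReal.ofReal δ := by
  have hN' : (0 : ℝ) < N := by exact_mod_cast hN
  have hmeas : Measurable fun x : Example d => ENNReal.ofReal (‖x.1‖ ^ 2) := by fun_prop
  have hint : ∫⁻ S, ∑ i, ENNReal.ofReal (‖(S i).1‖ ^ 2) ∂(sampleLaw D N) ≤
      ENNReal.ofReal (N * (c / δ)) * ENNReal.ofReal δ := by
    have hmi : ∀ i, Measurable fun S : Fin N → Example d => ENNReal.ofReal (‖(S i).1‖ ^ 2) :=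
      fun i => hmeas.comp (measurable_pi_apply i)
    rw [lintegral_finsetSum _ fun i _ => hmi i]
    have h1 : ∀ i : Fin N, ∫⁻ S, ENNReal.ofReal (‖(S i).1‖ ^ 2) ∂(sampleLaw D N) ≤
        ENNReal.ofReal c := fun i => by
      unfold sampleLaw
      rw [(measurePreserving_eval (fun _ : Fin N => D) i).lintegral_comp hmeas]
      exact h
    refine (Finset.sum_le_sum fun i _ => h1 i).trans (le_of_eq ?_)
    rw [Finset.sum_const, Finset.card_univ, Fintype.card_fin, nsmul_eq_mul,
      ← ENNReal.ofReal_natCast, ← ENNReal.ofReal_mul (Nat.cast_nonneg N),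
      ← ENNReal.ofReal_mul (by positivity)]
    congr 1; field_simp
  have hm := mul_meas_ge_le_lintegral₀ (μ := sampleLaw D N)
    (f := fun S => ∑ i, ENNReal.ofReal (‖(S i).1‖ ^ 2))
    (Finset.measurable_sum _ fun i _ => hmeas.comp (measurable_pi_apply i)).aemeasurable
    (ENNReal.ofReal (N * (c / δ)))
  have hpos : 0 < N * (c / δ) := by positivity
  refine (measure_mono fun S hS => ?_).trans
    ((ENNReal.mul_le_mul_iff_right (ENNReal.ofReal_pos.2 hpos).ne'
      ENNReal.ofReal_ne_top).1 (hm.trans hint))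
  have hS' : N * (c / δ) ≤ ∑ i, ‖(S i).1‖ ^ 2 := hS
  simp only [Set.mem_ofPred_eq]
  rw [← ENNReal.ofReal_sum_of_nonneg fun i _ => sq_nonneg _]
  exact ENNReal.ofReal_le_ofReal hS'

theorem measure_exists_liveMargin_lt_le {d N : ℕ} (hN : 0 < N) (D : Measure (Example d))
    [IsProbabilityMeasure D] (T : Finset (Feature d)) {τ p : ℝ} (hp : 0 < p)
    (h : ∀ v ∈ T, p ≤ D.real (liveMargin τ v)) :
    sampleLaw D N {S | ∃ v ∈ T, empFreq (liveMargin τ v) S < p / 2} ≤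
      ENNReal.ofReal (T.card * (2 * Real.sqrt N * Real.exp (-(N * p ^ 2 / 2)))) := by
  have hsub : {S : Fin N → Example d | ∃ v ∈ T, empFreq (liveMargin τ v) S < p / 2} ⊆
      ⋃ v ∈ T, {S | empFreq (liveMargin τ v) S + p / 2 < D.real (liveMargin τ v)} := by
    rintro S ⟨v, hv, hS⟩
    simp only [Set.mem_iUnion]
    exact ⟨v, hv, by have := h v hv; simp only [Set.mem_ofPred_eq]; linarith⟩
  refine (measure_mono hsub).trans ((measure_biUnion_finset_le _ _).trans ?_)
  refine (Finset.sum_le_sum fun v _ => measure_empFreq_deviation_le D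
    (measurableSet_liveMargin τ v) hN (by positivity : 0 ≤ p / 2)).trans (le_of_eq ?_)
  rw [Finset.sum_const, nsmul_eq_mul, ← ENNReal.ofReal_natCast,
    ← ENNReal.ofReal_mul (Nat.cast_nonneg _)]
  congr 5; ring

/-- The failure probability of a union bound over the net is small once `N` is large compared with
`d ln(2N/δ)`. -/
theorem net_union_bound_le {d N k : ℕ} {δ p C : ℝ} (hd : 1 ≤ d) (hN : 1 ≤ N) (hδ : 0 < δ)
    (hδ1 : δ < 1) (hp : 0 < p) (hC : 0 < C) (hk : (2 * k + 1 : ℝ) ≤ C * (d / δ))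
    (hlarge : (2 * (2 * C + 3) / p ^ 2 + 2) * d * Real.log (2 * N / δ) < N) :
    ((2 * k + 1) ^ d : ℕ) * (2 * Real.sqrt N * Real.exp (-(N * p ^ 2 / 2))) ≤ δ / 2 := by
  have hN' : (1 : ℝ) ≤ N := by exact_mod_cast hN
  have hd' : (1 : ℝ) ≤ d := by exact_mod_cast hd
  have hΛ := half_le_log_two_mul_div hN hδ hδ1
  set Λ := Real.log (2 * N / δ) with hΛdef
  have hexp : Real.exp Λ = 2 * N / δ := Real.exp_log (by positivity)
  have hdΛ : 0 ≤ d * Λ := by positivity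
  have hsplit : 2 * (2 * C + 3) / p ^ 2 * (d * Λ) + 2 * (d * Λ) < N := by
    calc _ = (2 * (2 * C + 3) / p ^ 2 + 2) * d * Λ := by ring
      _ < N := hlarge
  have hpos : 0 ≤ 2 * (2 * C + 3) / p ^ 2 * (d * Λ) := by positivity
  -- This is the purpose of the summand + 2 in `hlarge`; it gives d/δ ≤ 2N/δ = exp Λ below.
  have hdN : (d : ℝ) ≤ N := by nlinarith
  have hbase : (2 * k + 1 : ℝ) ≤ Real.exp ((2 * C + 1) * Λ) := by
    have h1 : C ≤ Real.exp (2 * C * Λ) := by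
      have h2 := Real.add_one_le_exp C
      have h3 : Real.exp C ≤ Real.exp (2 * C * Λ) := Real.exp_le_exp.2 (by nlinarith)
      linarith
    have h2 : d / δ ≤ Real.exp Λ := by
      rw [hexp]; gcongr; linarith
    calc (2 * k + 1 : ℝ) ≤ C * (d / δ) := hk
      _ ≤ Real.exp (2 * C * Λ) * Real.exp Λ := by gcongr
      _ = _ := by rw [← Real.exp_add]; congr 1; ring
  have hpow : (((2 * k + 1) ^ d : ℕ) : ℝ) ≤ Real.exp (d * ((2 * C + 1) * Λ)) := by
    rw [Real.exp_nat_mul]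
    push_cast
    exact pow_le_pow_left₀ (by positivity) hbase d
  have hsqrt : 2 * Real.sqrt N ≤ δ / 2 * Real.exp (2 * Λ) := by
    have h1 : Real.sqrt N ≤ N := by
      rw [Real.sqrt_le_left (by positivity)]; nlinarith
    have h2 : Real.exp (2 * Λ) = (2 * N / δ) ^ 2 := by
      rw [← hexp, ← Real.exp_nat_mul, Nat.cast_ofNat]
    have h3 : δ / 2 * (2 * N / δ) ^ 2 = 2 * (N * N / δ) := by field_simp
    rw [h2, h3]
    have h4 : (N : ℝ) ≤ N * N / δ := by rw [le_div_iff₀ hδ]; nlinarith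
    linarith
  -- Since d ≥ 1 the left side is at most (2C + 3)dΛ, whence the coefficient 2(2C + 3)/p² in
  -- `hlarge`.
  have hfin : d * ((2 * C + 1) * Λ) + 2 * Λ ≤ N * p ^ 2 / 2 := by
    have h1 : 2 * (2 * C + 3) / p ^ 2 * (d * Λ) ≤ N := by linarith
    rw [div_mul_eq_mul_div, div_le_iff₀ (by positivity)] at h1
    nlinarith
  calc (((2 * k + 1) ^ d : ℕ) : ℝ) * (2 * Real.sqrt N * Real.exp (-(N * p ^ 2 / 2)))
      ≤ Real.exp (d * ((2 * C + 1) * Λ)) *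
        (δ / 2 * Real.exp (2 * Λ) * Real.exp (-(N * p ^ 2 / 2))) := by gcongr
    _ = δ / 2 * Real.exp (d * ((2 * C + 1) * Λ) + 2 * Λ - N * p ^ 2 / 2) := by
        rw [sub_eq_add_neg, Real.exp_add, Real.exp_add]; ring
    _ ≤ δ / 2 * 1 := by
        gcongr
        rw [Real.exp_le_one_iff]; linarith
    _ = δ / 2 := mul_one _

/-- A sufficiently fine grid. -/
theorem exists_grid_size {d : ℕ} (hd : 1 ≤ d) {δ c a : ℝ} (hδ : 0 < δ) (hδ1 : δ < 1)
    (hc : 0 < c) (ha : 0 < a) :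
    ∃ k : ℕ, 0 < k ∧ Real.sqrt d / k ≤ 1 / 2 ∧
      Real.sqrt d / k * Real.sqrt (c * (d / δ)) ≤ a ∧
      (2 * k + 1 : ℝ) ≤ 3 * (3 + Real.sqrt c / a) * (d / δ) := by
  have hd' : (1 : ℝ) ≤ d := by exact_mod_cast hd
  set R := Real.sqrt (c * (d / δ)) with hR
  have hR0 : 0 ≤ R := Real.sqrt_nonneg _
  set s := Real.sqrt d with hs
  have hs1 : 1 ≤ s := Real.one_le_sqrt.2 hd'
  have hsd : s * s = d := Real.mul_self_sqrt (by positivity)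
  have hx : 0 < s * (2 + R / a) := by positivity
  -- The summand 2 makes the mesh at most 1/2, and R/a makes the mesh times R at most a.
  refine ⟨⌈s * (2 + R / a)⌉₊, Nat.ceil_pos.2 hx, ?_, ?_, ?_⟩
  all_goals
    have hle := Nat.le_ceil (s * (2 + R / a))
    have hlt := Nat.ceil_lt_add_one hx.le
    set k : ℝ := (⌈s * (2 + R / a)⌉₊ : ℝ) with hk
    have hkpos : 0 < k := lt_of_lt_of_le hx hle
    have hRa : 0 ≤ s * (R / a) := by positivity
  · rw [div_le_iff₀ hkpos]; linarith
  · rw [div_mul_eq_mul_div, div_le_iff₀ hkpos]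
    have h1 : s * R = a * (s * (R / a)) := by field_simp
    rw [h1]
    gcongr
    linarith
  · have hdδ : 1 ≤ d / δ := by rw [le_div_iff₀ hδ]; linarith
    have hddδ : (d : ℝ) ≤ d / δ := by rw [le_div_iff₀ hδ]; nlinarith
    have hsdδ : s ≤ d / δ := by nlinarith
    have hsR : s * R ≤ Real.sqrt c * (d / δ) := by
      rw [hR, Real.sqrt_mul hc.le]
      have h1 : s ≤ Real.sqrt (d / δ) := Real.sqrt_le_sqrt hddδ
      have h2 : Real.sqrt (d / δ) * Real.sqrt (d / δ) = d / δ :=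
        Real.mul_self_sqrt (by positivity)
      calc s * (Real.sqrt c * Real.sqrt (d / δ)) = Real.sqrt c * (s * Real.sqrt (d / δ)) := by ring
        _ ≤ Real.sqrt c * (Real.sqrt (d / δ) * Real.sqrt (d / δ)) := by gcongr
        _ = _ := by rw [h2]
    have hsRa : s * (R / a) ≤ Real.sqrt c / a * (d / δ) := by
      calc s * (R / a) = s * R / a := by ring
        _ ≤ Real.sqrt c * (d / δ) / a := by gcongr
        _ = _ := by ring
    have h2s : s * (2 + R / a) = 2 * s + s * (R / a) := by ring
    nlinarith

theorem sum_norm_signedFeature_sq {d N : ℕ} (S : Fin N → Example d) :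
    ∑ i, ‖signedFeature S i‖ ^ 2 = ∑ i, ‖(S i).1‖ ^ 2 :=
  Finset.sum_congr rfl fun i _ => by
    rw [signedFeature, norm_smul, mul_pow, Real.norm_eq_abs, sq_abs, signedLabel_sq, one_mul]

/-- The MAP estimate and the embeddings are bounded with high probability. -/
theorem exists_symMAP_bound {p₀ σ₀ ε σβ M : ℝ} (hp0 : 0 < p₀) (hp1 : p₀ < 1) (hσ₀ : 0 < σ₀)
    (hε : 0 < ε) (hσβ : 0 < σβ) :
    ∃ A : ℝ, 0 < A ∧ ∀ (d K N : ℕ) (w : Fin K → ℝ) (μ : Fin K → Feature d) (δ : ℝ),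
      1 ≤ d → 1 ≤ N → (∀ k, 0 ≤ w k) → ∑ k, w k = 1 → (∀ k, ‖μ k‖ ≤ M * Real.sqrt d) →
      0 < δ → δ < 1 →
      HighProb (sampleLaw (dataLaw p₀ σ₀ ε w μ) N) δ (fun S =>
        ‖symMAP σβ S‖ ^ 2 ≤ A * (d * Real.log (2 * N / δ)) ∧
        ∑ i, ‖(S i).1‖ ^ 2 ≤ N * (4 * (σ₀ ^ 2 + ε + M ^ 2) * (d / δ))) := by
  set p := p₀ * (gaussianReal 0 1).real (Set.Ioi 1) with hpdef
  have hp : 0 < p := mul_pos hp0 gaussianReal_Ioi_pos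
  set τ := σ₀ / 2 with hτdef
  have hτ : 0 < τ := by positivity
  set c := 4 * (σ₀ ^ 2 + ε + M ^ 2) with hcdef
  have hc : 0 < c := by positivity
  set C := 3 * (3 + Real.sqrt c / (τ * p / 4)) with hCdef
  have hC : 0 < C := by positivity
  set c₀ := 2 * (2 * C + 3) / p ^ 2 + 2 with hc₀def
  have hc₀ : 0 < c₀ := by positivity
  refine ⟨2 * σβ ^ 2 * c₀ + 2 * (4 / (τ * p)) ^ 2, by positivity, ?_⟩
  intro d K N w μ δ hd hN hw hw1 hμ hδ hδ1
  have hprob := isProbabilityMeasure_dataLaw σ₀ ε μ hp0 hp1 hw hw1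
  have hN' : (1 : ℝ) ≤ N := by exact_mod_cast hN
  have hd' : (1 : ℝ) ≤ d := by exact_mod_cast hd
  have hΛ := half_le_log_two_mul_div hN hδ hδ1
  set Λ := Real.log (2 * N / δ) with hΛdef
  have hdΛ : 1 / 2 ≤ d * Λ := by nlinarith
  set D := dataLaw p₀ σ₀ ε w μ with hD
  have hmom := lintegral_norm_sq_dataLaw_le (M := M) hp0 hp1 hσ₀ hε hw hw1 hμ
  have hsq := measure_sum_norm_sq_ge_le (N := N) hN D (c := c / 2 * d) (δ := δ / 2) (by positivity)
    (by positivity) (by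
      refine hmom.trans (le_of_eq ?_)
      congr 1; rw [hcdef]; ring)
  have hsqe : (c / 2 * d) / (δ / 2) = c * (d / δ) := by field_simp
  rw [hsqe] at hsq
  unfold HighProb
  have hlog2 : Real.log 2 ≤ 1 := by linarith [Real.log_two_lt_d9]
  -- With few samples the crude bound 2σβ² N ln 2 is already of order dΛ; with many, the union bound
  -- over the net succeeds and ‖m‖ is bounded by a constant.
  rcases le_or_gt (N : ℝ) (c₀ * d * Λ) with hcase | hcase
  · refine (measure_mono fun S hS => ?_).trans
      (hsq.trans (ENNReal.ofReal_le_ofReal (by linarith)))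
    by_contra hcon
    simp only [Set.mem_ofPred_eq, not_le] at hcon
    refine hS ⟨?_, hcon.le⟩
    have h1 := symMAP_norm_sq_le hσβ S
    have h2 : (N : ℝ) * Real.log 2 ≤ c₀ * d * Λ := by
      have : (N : ℝ) * Real.log 2 ≤ N * 1 := by gcongr
      linarith
    calc ‖symMAP σβ S‖ ^ 2 ≤ 2 * σβ ^ 2 * (N * Real.log 2) := h1
      _ ≤ 2 * σβ ^ 2 * (c₀ * d * Λ) := by gcongr
      _ = 2 * σβ ^ 2 * c₀ * (d * Λ) := by ring
      _ ≤ _ := by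
        gcongr
        have : 0 ≤ 2 * (4 / (τ * p)) ^ 2 := by positivity
        linarith
  · obtain ⟨k, hk, hk1, hk2, hk3⟩ := exists_grid_size hd hδ hδ1 hc
      (show 0 < τ * p / 4 by positivity)
    obtain ⟨T, hTcard, hT⟩ := exists_net d hk
    -- Only grid points of norm at least 1/2 have a guaranteed margin; a grid point within 1/2 of a
    -- unit vector is one of them.
    set T' := T.filter fun v => 1 / 2 ≤ ‖v‖ with hT'
    have hnet := measure_exists_liveMargin_lt_le (N := N) hN D T' (τ := τ) hp fun v hv =>
      le_dataLaw_liveMargin ε μ hp0 hp1 hσ₀ hw hw1 (Finset.mem_filter.1 hv).2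
    have hcard : (T'.card : ℝ) ≤ ((2 * k + 1) ^ d : ℕ) := by
      exact_mod_cast (Finset.card_filter_le _ _).trans hTcard
    have hsmall := net_union_bound_le hd hN hδ hδ1 hp hC hk3 hcase
    have hnet' := hnet.trans (ENNReal.ofReal_le_ofReal
      ((mul_le_mul_of_nonneg_right hcard (by positivity)).trans hsmall))
    refine le_trans (measure_mono fun S hS => ?_) ((measure_union_le _ _).trans
      ((add_le_add hsq hnet').trans (le_of_eq ?_)))
    · by_contra hcon
      simp only [Set.mem_union, Set.mem_ofPred_eq, not_or, not_le, not_exists, not_and, not_lt]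
        at hcon
      refine hS ⟨?_, hcon.1.le⟩
      have hbd := symMAP_norm_le_of_margin (N := N) hN hσβ S (R := Real.sqrt (c * (d / δ))) hτ hp
        (by positivity) (Real.sqrt_nonneg _) hk2
        (by rw [Real.sq_sqrt (by positivity)]; exact hcon.1.le) (fun u hu => by
          obtain ⟨v, hv, huv⟩ := hT u hu.le
          refine ⟨v, huv, hcon.2 v (Finset.mem_filter.2 ⟨hv, ?_⟩)⟩
          have h1 := norm_sub_norm_le u v
          rw [hu] at h1
          linarith)
      have hbd' : ‖symMAP σβ S‖ ≤ 4 / (τ * p) := by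
        refine hbd.trans ?_
        gcongr
        linarith
      calc ‖symMAP σβ S‖ ^ 2 ≤ (4 / (τ * p)) ^ 2 := by gcongr
        _ ≤ 2 * (4 / (τ * p)) ^ 2 * (d * Λ) := by nlinarith [sq_nonneg (4 / (τ * p))]
        _ ≤ _ := by
          gcongr
          have : 0 ≤ 2 * σβ ^ 2 * c₀ := by positivity
          linarith
    · rw [← ENNReal.ofReal_add (by positivity) (by positivity)]; congr 1; ring

/-- The tilt bound of the linear model is of order `d ln(2N/δ)` with high probability. -/
theorem exists_tiltBound_sym {p₀ σ₀ ε σβ M : ℝ} (hp0 : 0 < p₀) (hp1 : p₀ < 1) (hσ₀ : 0 < σ₀)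
    (hε : 0 < ε) (hσβ : 0 < σβ) :
    ∃ C : ℝ, 0 < C ∧ ∀ (d K N : ℕ) (w : Fin K → ℝ) (μ : Fin K → Feature d) (δ : ℝ),
      1 ≤ d → 1 ≤ N → (∀ k, 0 ≤ w k) → ∑ k, w k = 1 → (∀ k, ‖μ k‖ ≤ M * Real.sqrt d) →
      0 < δ → δ < 1 →
      HighProb (sampleLaw (dataLaw p₀ σ₀ ε w μ) N) δ (fun S =>
        tiltBound 0 (symMAP σβ S) σβ (signedFeature S) ≤ C * d * Real.log (2 * N / δ)) := by
  obtain ⟨A, hA, h⟩ := exists_symMAP_bound (M := M) hp0 hp1 hσ₀ hε hσβ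
  set c := 4 * (σ₀ ^ 2 + ε + M ^ 2) with hcdef
  have hc : 0 < c := by positivity
  refine ⟨3 / 2 * A / σβ ^ 2 + 2 + (2 * (σβ ^ 2 * c) + 1) / 2, by positivity, ?_⟩
  intro d K N w μ δ hd hN hw hw1 hμ hδ hδ1
  refine (measure_mono fun S hS => ?_).trans (h d K N w μ δ hd hN hw hw1 hμ hδ hδ1)
  intro hS'
  refine hS ?_
  obtain ⟨h1, h2⟩ := hS'
  have hN' : (1 : ℝ) ≤ N := by exact_mod_cast hN
  have hd' : (1 : ℝ) ≤ d := by exact_mod_cast hd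
  have hΛ := half_le_log_two_mul_div hN hδ hδ1
  set Λ := Real.log (2 * N / δ) with hΛdef
  unfold tiltBound
  rw [sum_norm_signedFeature_sq, finrank_euclideanSpace_fin, sub_zero]
  have hx : 0 < σβ ^ 2 * c := by positivity
  -- Markov's inequality controls the sum only with a factor 1/δ, but inside the logarithm this
  -- costs no more than Λ.
  have hlog : Real.log (1 + σβ ^ 2 * (∑ i, ‖(S i).1‖ ^ 2) / (4 * d)) ≤
      (2 * (σβ ^ 2 * c) + 1) * Λ := by
    have hNδ : (1 : ℝ) ≤ N / δ := by rw [le_div_iff₀ hδ]; linarith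
    have h3 : 1 + σβ ^ 2 * (∑ i, ‖(S i).1‖ ^ 2) / (4 * d) ≤
        (1 + σβ ^ 2 * c) * (2 * N / δ) := by
      have h4 : σβ ^ 2 * (∑ i, ‖(S i).1‖ ^ 2) / (4 * d) ≤ σβ ^ 2 * c * (N / δ) := by
        rw [div_le_iff₀ (by positivity)]
        have h5 : σβ ^ 2 * ∑ i, ‖(S i).1‖ ^ 2 ≤ σβ ^ 2 * (N * (c * (d / δ))) := by gcongr
        have h6 : σβ ^ 2 * (N * (c * (d / δ))) = σβ ^ 2 * c * (N / δ) * d := by ring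
        have h7 : 0 ≤ σβ ^ 2 * c * (N / δ) * d := by positivity
        linarith
      have h8 : 2 * (N : ℝ) / δ = 2 * (N / δ) := by ring
      rw [h8]
      nlinarith
    have hsum0 : 0 ≤ ∑ i, ‖(S i).1‖ ^ 2 := Finset.sum_nonneg fun i _ => sq_nonneg _
    have h9 := Real.log_le_log (by positivity) h3
    rw [Real.log_mul (by positivity) (by positivity)] at h9
    have h10 := Real.log_le_sub_one_of_pos (show 0 < 1 + σβ ^ 2 * c by positivity)
    nlinarith
  have e1 : 3 / 2 * ‖symMAP σβ S‖ ^ 2 / σβ ^ 2 ≤ 3 / 2 * A / σβ ^ 2 * (d * Λ) := by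
    calc 3 / 2 * ‖symMAP σβ S‖ ^ 2 / σβ ^ 2 ≤ 3 / 2 * (A * (d * Λ)) / σβ ^ 2 := by gcongr
      _ = _ := by ring
  have e2 : (d : ℝ) ≤ 2 * (d * Λ) := by nlinarith
  have e3 : (d : ℝ) / 2 * Real.log (1 + σβ ^ 2 * (∑ i, ‖(S i).1‖ ^ 2) / (4 * d)) ≤
      (2 * (σβ ^ 2 * c) + 1) / 2 * (d * Λ) := by
    calc _ ≤ (d : ℝ) / 2 * ((2 * (σβ ^ 2 * c) + 1) * Λ) := by gcongr
      _ = _ := by ring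
  calc _ ≤ 3 / 2 * A / σβ ^ 2 * (d * Λ) + 2 * (d * Λ) +
        (2 * (σβ ^ 2 * c) + 1) / 2 * (d * Λ) := by linarith
    _ = _ := by ring

/-! ### Uniform convergence over monotone families of sets -/

/-- The members of measure at least `c` of a monotone family contain a common set of measure at
least `c`. -/
theorem exists_measurableSet_subset_of_le {X : Type*} [MeasurableSpace X] (D : Measure X)
    [IsFiniteMeasure D] {A : ℝ → Set X} (hA : Monotone A) (hm : ∀ R, MeasurableSet (A R)) (c : ℝ)
    (hc : ∃ R, c ≤ D.real (A R)) :
    ∃ B, MeasurableSet B ∧ c ≤ D.real B ∧ ∀ R, c ≤ D.real (A R) → B ⊆ A R := by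
  set I : Set ℝ := {R | c ≤ D.real (A R)} with hI
  have hup : IsUpperSet I := fun a b hab ha =>
    le_trans (show c ≤ D.real (A a) from ha) (measureReal_mono (hA hab))
  have : I.OrdConnected := hup.ordConnected
  have : Nonempty I := ⟨⟨_, hc.choose_spec⟩⟩
  -- The admissible parameters form an up-set; intersecting along a sequence descending to its lower
  -- end keeps measure at least c by continuity from above, even if the end is not attained.
  obtain ⟨u, hu, hut⟩ := exists_seq_antitone_tendsto_atTop_atBot I
  have hanti : Antitone fun n => A (u n) := fun m n hmn => hA (hu hmn)
  have hmm : ∀ n, MeasurableSet (A (u n)) := fun n => hm _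
  refine ⟨⋂ n, A (u n), MeasurableSet.iInter hmm, ?_, fun R hR => ?_⟩
  · have ht := tendsto_measure_iInter_atTop (μ := D) (fun n => (hmm n).nullMeasurableSet) hanti
      ⟨0, measure_ne_top _ _⟩
    have ht' := (ENNReal.tendsto_toReal (measure_ne_top D _)).comp ht
    exact ge_of_tendsto' ht' fun n => (u n).2
  · obtain ⟨n, hn⟩ := (hut.eventually (eventually_le_atBot (⟨R, hR⟩ : I))).exists
    exact (Set.iInter_subset _ n).trans (hA hn)

/-- One bracket for each level k/N; a member is assigned the level obtained by rounding its measure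
down. Inner brackets suffice because only the true risk has to be bounded from above, and no
continuity of the family is needed. -/
theorem exists_lower_brackets {X : Type*} [MeasurableSpace X] (D : Measure X)
    [IsProbabilityMeasure D] {A : ℝ → Set X} (hA : Monotone A) (hm : ∀ R, MeasurableSet (A R))
    {N : ℕ} (hN : 0 < N) :
    ∃ B : Fin (N + 1) → Set X, (∀ k, MeasurableSet (B k)) ∧
      ∀ R, ∃ k, B k ⊆ A R ∧ D.real (A R) ≤ D.real (B k) + 1 / N := by
  have hN' : (0 : ℝ) < N := by exact_mod_cast hN
  have key : ∀ k : Fin (N + 1), ∃ B, MeasurableSet B ∧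
      ∀ R, (k : ℝ) / N ≤ D.real (A R) → B ⊆ A R ∧ (k : ℝ) / N ≤ D.real B := fun k => by
    by_cases hk : ∃ R, (k : ℝ) / N ≤ D.real (A R)
    · obtain ⟨B, hB, hB1, hB2⟩ := exists_measurableSet_subset_of_le D hA hm _ hk
      exact ⟨B, hB, fun R hR => ⟨hB2 R hR, hB1⟩⟩
    · exact ⟨∅, MeasurableSet.empty, fun R hR => (hk ⟨R, hR⟩).elim⟩
  choose B hB hB' using key
  refine ⟨B, hB, fun R => ?_⟩
  have h0 : 0 ≤ N * D.real (A R) := mul_nonneg hN'.le measureReal_nonneg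
  have hlt : ⌊N * D.real (A R)⌋₊ < N + 1 := by
    refine Nat.lt_succ_of_le (Nat.floor_le_of_le ?_)
    exact mul_le_of_le_one_right hN'.le measureReal_le_one
  refine ⟨⟨_, hlt⟩, ?_⟩
  obtain ⟨h1, h2⟩ := hB' ⟨_, hlt⟩ R (by
    rw [div_le_iff₀ hN', mul_comm (D.real _)]; exact Nat.floor_le h0)
  refine ⟨h1, ?_⟩
  have h3 := Nat.lt_floor_add_one (N * D.real (A R))
  have h4 : D.real (A R) ≤ (⌊N * D.real (A R)⌋₊ : ℝ) / N + 1 / N := by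
    rw [← add_div, le_div_iff₀ hN']; linarith
  simp only at h2
  linarith

theorem measure_exists_empFreq_deviation_le {d N : ℕ} (D : Measure (Example d))
    [IsProbabilityMeasure D] {A : ℝ → Set (Example d)} (hA : Monotone A)
    (hm : ∀ R, MeasurableSet (A R)) (hN : 0 < N) {t : ℝ} (ht : 0 ≤ t) :
    sampleLaw D N {S | ∃ R, empFreq (A R) S + (t + 1 / N) < D.real (A R)} ≤
      ENNReal.ofReal ((N + 1) * (2 * Real.sqrt N * Real.exp (-(2 * N * t ^ 2)))) := by
  obtain ⟨B, hB, h⟩ := exists_lower_brackets D hA hm hN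
  have hsub : {S : Fin N → Example d | ∃ R, empFreq (A R) S + (t + 1 / N) < D.real (A R)} ⊆
      ⋃ k, {S | empFreq (B k) S + t < D.real (B k)} := by
    rintro S ⟨R, hR⟩
    obtain ⟨k, hk, hk'⟩ := h R
    refine Set.mem_iUnion.2 ⟨k, show empFreq (B k) S + t < D.real (B k) from ?_⟩
    have := empFreq_mono hk S
    linarith
  refine (measure_mono hsub).trans ((measure_iUnion_fintype_le _ _).trans ?_)
  refine (Finset.sum_le_sum fun k _ => measure_empFreq_deviation_le D (hB k) hN ht).trans
    (le_of_eq ?_)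
  rw [Finset.sum_const, Finset.card_univ, Fintype.card_fin, nsmul_eq_mul,
    ← ENNReal.ofReal_natCast, ← ENNReal.ofReal_mul (Nat.cast_nonneg _)]
  push_cast
  rfl

/-! ### The radial classifier -/

/-- The spoof examples that a radial classifier misses. -/
def missedSpoof (d q : ℕ) (R : ℝ) : Set (Example d) := {x | x.2 = true ∧ ‖x.1‖ ^ q ≤ R}

/-- The live examples that the radial classifier with parameter `-T` rejects. -/
def rejectedLive (d q : ℕ) (T : ℝ) : Set (Example d) := {x | x.2 = false ∧ -T < ‖x.1‖ ^ q}

theorem measurableSet_missedSpoof (d q : ℕ) (R : ℝ) : MeasurableSet (missedSpoof d q R) :=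
  (measurable_snd (measurableSet_singleton true)).inter
    (measurableSet_le (measurable_fst.norm.pow_const q) measurable_const)

theorem measurableSet_rejectedLive (d q : ℕ) (T : ℝ) : MeasurableSet (rejectedLive d q T) :=
  (measurable_snd (measurableSet_singleton false)).inter
    (measurableSet_lt measurable_const (measurable_fst.norm.pow_const q))

theorem monotone_missedSpoof (d q : ℕ) : Monotone (missedSpoof d q) :=
  fun _ _ h _ hx => ⟨hx.1, hx.2.trans h⟩

/-- The sign of the parameter is reversed so that this family is increasing too and one bracketing
lemma serves both kinds of error. -/
theorem monotone_rejectedLive (d q : ℕ) : Monotone (rejectedLive d q) :=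
  fun _ _ h _ hx => ⟨hx.1, (neg_le_neg h).trans_lt hx.2⟩

theorem errorSet_radialScore (d q : ℕ) (R : ℝ) :
    errorSet (radialScore (d := d) q) R = missedSpoof d q R ∪ rejectedLive d q (-R) := by
  ext ⟨z, y⟩
  cases y <;> simp [errorSet, radialScore, missedSpoof, rejectedLive]

theorem disjoint_missedSpoof_rejectedLive (d q : ℕ) (R T : ℝ) :
    Disjoint (missedSpoof d q R) (rejectedLive d q T) := by
  rw [Set.disjoint_left]
  rintro x ⟨hx, -⟩ ⟨hx', -⟩
  rw [hx] at hx'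
  exact Bool.noConfusion hx'

theorem measurable_uncurry_radialScore (d q : ℕ) :
    Measurable (Function.uncurry (radialScore (d := d) q)) := by
  unfold radialScore Function.uncurry
  fun_prop

theorem measurable_uncurry_linearScore (d : ℕ) :
    Measurable (Function.uncurry (linearScore (d := d))) := by
  unfold linearScore Function.uncurry
  fun_prop

/-- Missed spoofs and rejected lives are disjoint and each ranges over a monotone family in R, so
two bracketing bounds at level δ/2 add up. Neither the dimension nor the shape of D enters. -/
theorem highProb_forall_radial_risk_le {d N : ℕ} (q : ℕ) (D : Measure (Example d))
    [IsProbabilityMeasure D] (hN : 1 ≤ N) {δ : ℝ} (hδ : 0 < δ) (hδ1 : δ < 1) :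
    HighProb (sampleLaw D N) δ fun S => ∀ R,
      risk D (radialScore q) R ≤ empRisk S (radialScore q) R + asymRate 32 N δ := by
  have hN' : (1 : ℝ) ≤ N := by exact_mod_cast hN
  have hΛ := half_le_log_two_mul_div hN hδ hδ1
  set Λ := Real.log (2 * N / δ) with hΛdef
  -- Then exp(−2Nt²) = (δ/(2N))⁴, which outweighs the N + 1 brackets and the factor 2√N. As 1/N ≤ t,
  -- the two families lose at most 2(t + 1/N) ≤ 4t, whose square is 32Λ/N.
  set t := Real.sqrt (2 * Λ / N) with ht
  have ht0 : 0 ≤ t := Real.sqrt_nonneg _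
  have ht2 : t ^ 2 = 2 * Λ / N := Real.sq_sqrt (by positivity)
  have hrate : asymRate 32 N δ = 4 * t := by
    rw [asymRate, ← hΛdef, ht, show 32 * Λ / N = 4 ^ 2 * (2 * Λ / N) by ring,
      Real.sqrt_mul (by positivity), Real.sqrt_sq (by norm_num)]
  have hNt : 1 / N ≤ t := by
    refine Real.le_sqrt_of_sq_le ?_
    rw [div_pow, one_pow, div_le_div_iff₀ (by positivity) (by positivity)]
    nlinarith [mul_le_mul hN' hΛ (by norm_num) (by positivity), sq_nonneg (N : ℝ)]
  have hexp : Real.exp (-(2 * N * t ^ 2)) = (δ / (2 * N)) ^ 4 := by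
    rw [ht2, show -(2 * (N : ℝ) * (2 * Λ / N)) = -((4 : ℕ) * Λ) by field_simp; norm_num,
      Real.exp_neg, Real.exp_nat_mul, hΛdef, Real.exp_log (by positivity), ← inv_pow, inv_div]
  have hprob : (N + 1) * (2 * Real.sqrt N * Real.exp (-(2 * N * t ^ 2))) ≤ δ / 2 := by
    have h1 : Real.sqrt N ≤ N := by
      rw [Real.sqrt_le_left (by positivity)]; nlinarith
    have h2 : δ ^ 4 ≤ δ := pow_le_of_le_one hδ.le hδ1.le (by norm_num)
    have h3 : ((N : ℝ) + 1) * (2 * Real.sqrt N) ≤ 4 * N ^ 2 := by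
      calc ((N : ℝ) + 1) * (2 * Real.sqrt N) ≤ (N + N) * (2 * N) := by gcongr
        _ = _ := by ring
    rw [hexp, ← mul_assoc]
    calc ((N : ℝ) + 1) * (2 * Real.sqrt N) * (δ / (2 * N)) ^ 4
        ≤ 4 * N ^ 2 * (δ / (2 * N)) ^ 4 := by gcongr
      _ = δ ^ 4 / (4 * N ^ 2) := by field_simp; norm_num
      _ ≤ δ / 2 := by
        rw [div_le_div_iff₀ (by positivity) (by positivity)]
        have h4 : (1 : ℝ) ≤ N ^ 2 := one_le_pow₀ hN'
        nlinarith
  have hs := (measure_exists_empFreq_deviation_le D (monotone_missedSpoof d q)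
    (measurableSet_missedSpoof d q) hN ht0).trans (ENNReal.ofReal_le_ofReal hprob)
  have hl := (measure_exists_empFreq_deviation_le D (monotone_rejectedLive d q)
    (measurableSet_rejectedLive d q) hN ht0).trans (ENNReal.ofReal_le_ofReal hprob)
  refine le_trans (measure_mono fun S hS => ?_) ((measure_union_le _ _).trans
      ((add_le_add hs hl).trans (le_of_eq ?_)))
  · by_contra hcon
    refine hS fun R => ?_
    simp only [Set.mem_union, Set.mem_ofPred_eq, not_or, not_exists, not_lt] at hcon
    have h1 := hcon.1 R
    have h2 := hcon.2 (-R)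
    rw [risk, empRisk_eq_empFreq, errorSet_radialScore,
      empFreq_union (disjoint_missedSpoof_rejectedLive d q R (-R))]
    have h3 := measureReal_union_le (μ := D) (missedSpoof d q R) (rejectedLive d q (-R))
    linarith
  · rw [← ENNReal.ofReal_add (by positivity) (by positivity)]; congr 1; ring

/-! ### Assembling the bounds -/

theorem HighProb.mono {Ω : Type} [MeasurableSpace Ω] {P : Measure Ω} {δ : ℝ} {A B : Ω → Prop}
    (h : HighProb P δ A) (hAB : ∀ S, A S → B S) : HighProb P δ B :=
  (measure_mono fun S (hS : ¬ B S) (hA : A S) => hS (hAB S hA)).trans h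

theorem klDiv_ne_top_of_tiltEstimate {E : Type*} [MeasurableSpace E] {prior post : Measure E}
    {κ : ℝ} (h : TiltEstimate prior post κ) : klDiv post prior ≠ ⊤ :=
  (h.klDiv_le.trans_lt ENNReal.ofReal_lt_top).ne

theorem highProb_pacBayesBound {d N : ℕ} {Θ : Type} [MeasurableSpace Θ] (D : Measure (Example d))
    [IsProbabilityMeasure D] {f : Θ → Feature d → ℝ} (hf : Measurable (Function.uncurry f))
    (prior : Measure Θ) [IsProbabilityMeasure prior] {post : (Fin N → Example d) → Measure Θ}
    {κ : (Fin N → Example d) → ℝ} (hpost : ∀ S, TiltEstimate prior (post S) (κ S)) (hN : 1 ≤ N)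
    {δ : ℝ} (hδ : 0 < δ) (hδ1 : δ < 1) :
    HighProb (sampleLaw D N) δ fun S => PACBayesBound D S f (post S) prior δ := by
  refine (measure_mono fun S hS => ?_).trans (measure_gapMoment_ge_le D hf prior hN hδ)
  by_contra hcon
  have := (hpost S).prob
  exact hS (pacBayesBound_of_gapMoment_lt D hf hN hδ hδ1
    (klDiv_ne_top_of_tiltEstimate (hpost S)) S (not_le.1 hcon))

/-- If the posterior expectation of `exp (N gap²)` is controlled, so is the gap: on average and
for a single draw. -/
theorem riskBound_of_gapMoment_lt {d N : ℕ} {Θ : Type} [MeasurableSpace Θ]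
    (D : Measure (Example d)) [IsProbabilityMeasure D] {f : Θ → Feature d → ℝ}
    (hf : Measurable (Function.uncurry f)) {post prior : Measure Θ} {κ : ℝ}
    (hpost : TiltEstimate prior post κ) (hN : 1 ≤ N) {δ G r : ℝ} (hδ1 : δ < 1)
    (hG : 0 < G) (hr : 0 < r) (S : Fin N → Example d)
    (h : gapMoment D f prior S < ENNReal.ofReal G)
    (hκ : Real.exp κ * (1 + G) ≤ δ * Real.exp (N * r ^ 2)) :
    RiskBound D S f post δ r := by
  have hN' : (1 : ℝ) ≤ N := by exact_mod_cast hN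
  have := hpost.prob
  have hgm : Measurable fun θ => (risk D f θ - empRisk S f θ) ^ 2 :=
    ((measurable_risk D hf).sub (measurable_empRisk S hf)).pow_const 2
  have hgb : ∀ θ, (risk D f θ - empRisk S f θ) ^ 2 ≤ 1 := fun θ =>
    (sq_le_one_iff_abs_le_one _).2 (abs_risk_sub_empRisk_le_one D f S θ)
  have hL : ∫⁻ θ, ENNReal.ofReal (Real.exp (N * (risk D f θ - empRisk S f θ) ^ 2)) ∂post ≤
      ENNReal.ofReal (δ * Real.exp (N * r ^ 2)) := by
    have h1 := hpost.lintegral_exp_le (fun θ => 2 * N * (risk D f θ - empRisk S f θ) ^ 2)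
      (hgm.const_mul _)
    have h2 : ∀ θ, 2 * N * (risk D f θ - empRisk S f θ) ^ 2 / 2 =
        N * (risk D f θ - empRisk S f θ) ^ 2 := fun θ => by ring
    simp only [h2] at h1
    refine h1.trans ?_
    calc ENNReal.ofReal (Real.exp κ) * (1 + gapMoment D f prior S)
        ≤ ENNReal.ofReal (Real.exp κ) * (1 + ENNReal.ofReal G) := by gcongr
      _ = ENNReal.ofReal (Real.exp κ * (1 + G)) := by
        rw [ENNReal.ofReal_mul (Real.exp_pos _).le, ENNReal.ofReal_add zero_le_one hG.le,
          ENNReal.ofReal_one]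
      _ ≤ _ := ENNReal.ofReal_le_ofReal hκ
  have hem : Measurable fun θ => Real.exp (N * (risk D f θ - empRisk S f θ) ^ 2) :=
    (hgm.const_mul _).exp
  constructor
  · refine integral_risk_le_of_sq D hf S post hr ?_
    have hei : Integrable (fun θ => Real.exp (N * (risk D f θ - empRisk S f θ) ^ 2)) post :=
      Integrable.of_bound hem.aestronglyMeasurable (Real.exp N) (ae_of_all _ fun θ => by
        rw [Real.norm_of_nonneg (Real.exp_pos _).le, Real.exp_le_exp]
        exact mul_le_of_le_one_right (by positivity) (hgb θ))
    have hgi : Integrable (fun θ => (risk D f θ - empRisk S f θ) ^ 2) post :=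
      Integrable.of_bound hgm.aestronglyMeasurable 1 (ae_of_all _ fun θ => by
        rw [Real.norm_of_nonneg (sq_nonneg _)]; exact hgb θ)
    have hI : ∫ θ, Real.exp (N * (risk D f θ - empRisk S f θ) ^ 2) ∂post ≤
        Real.exp (N * r ^ 2) := by
      have hpos := Real.exp_pos (N * r ^ 2)
      rw [integral_eq_lintegral_of_nonneg_ae (ae_of_all _ fun θ => (Real.exp_pos _).le)
        hem.aestronglyMeasurable]
      refine ENNReal.toReal_le_of_le_ofReal hpos.le
        (hL.trans (ENNReal.ofReal_le_ofReal ?_))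
      nlinarith
    -- Integrating 1 + y ≤ exp(y) at y = N gap² − N r² bounds the mean of gap² by r².
    have hmono : ∫ θ, (N * (risk D f θ - empRisk S f θ) ^ 2 + (1 - N * r ^ 2)) ∂post ≤
        ∫ θ, Real.exp (N * (risk D f θ - empRisk S f θ) ^ 2) / Real.exp (N * r ^ 2) ∂post := by
      refine integral_mono ((hgi.const_mul _).add (integrable_const _)) (hei.div_const _)
        fun θ => ?_
      have := Real.add_one_le_exp (N * (risk D f θ - empRisk S f θ) ^ 2 - N * r ^ 2)
      rw [Real.exp_sub] at this
      simp only
      linarith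
    rw [integral_add (hgi.const_mul _) (integrable_const _), integral_const_mul, integral_div,
      integral_const, probReal_univ, one_smul] at hmono
    have hdiv := (div_le_one (Real.exp_pos (N * r ^ 2))).2 hI
    nlinarith
  -- For a single draw, Markov's inequality for exp(N gap²); the factor δ in `hκ` is what it
  -- consumes.
  · have hm := mul_meas_ge_le_lintegral₀ (μ := post) hem.ennreal_ofReal.aemeasurable
      (ENNReal.ofReal (Real.exp (N * r ^ 2)))
    have hm' := hm.trans hL
    rw [mul_comm δ, ENNReal.ofReal_mul (Real.exp_pos _).le] at hm'
    refine (measure_mono fun θ hθ => ?_).trans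
      ((ENNReal.mul_le_mul_iff_right (ENNReal.ofReal_pos.2 (Real.exp_pos _)).ne'
        ENNReal.ofReal_ne_top).1 hm')
    refine ENNReal.ofReal_le_ofReal (Real.exp_le_exp.2 ?_)
    have hθ' : empRisk S f θ + r < risk D f θ := not_le.1 hθ
    have : r ^ 2 ≤ (risk D f θ - empRisk S f θ) ^ 2 :=
      pow_le_pow_left₀ hr.le (by linarith) 2
    gcongr

/-- With Λ = ln(2N/δ), halving δ at most doubles the logarithm, which gives exp(2CdΛ), and 1 + 4√N/δ
≤ δ exp(3Λ). Together they account for the constant 2C + 3. -/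
theorem exp_mul_one_add_le {d K N : ℕ} {δ C κ : ℝ} (hd : 1 ≤ d) (hN : 1 ≤ N) (hδ : 0 < δ)
    (hδ1 : δ < 1) (hC : 0 < C) (hκ : κ ≤ C * d * Real.log (2 * N / (δ / 2))) :
    Real.exp κ * (1 + 2 * Real.sqrt N / (δ / 2)) ≤
      δ * Real.exp (N * symRate (2 * C + 3) d K N δ ^ 2) := by
  have hN' : (1 : ℝ) ≤ N := by exact_mod_cast hN
  have hd' : (1 : ℝ) ≤ d := by exact_mod_cast hd
  have hΛ := half_le_log_two_mul_div hN hδ hδ1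
  have hlog : Real.log (2 * N / (δ / 2)) ≤ 2 * Real.log (2 * N / δ) := by
    have h2 : (2 : ℝ) ≤ 2 * N / δ := by rw [le_div_iff₀ hδ]; nlinarith
    have h3 := Real.log_le_log two_pos h2
    rw [show 2 * (N : ℝ) / (δ / 2) = 2 * (2 * N / δ) by ring,
      Real.log_mul two_ne_zero (by positivity)]
    linarith
  rw [symRate, Real.sq_sqrt (by positivity)]
  set Λ := Real.log (2 * N / δ) with hΛdef
  have hexp : Real.exp Λ = 2 * N / δ := Real.exp_log (by positivity)
  have hG : 1 + 2 * Real.sqrt N / (δ / 2) ≤ δ * Real.exp (3 * Λ) := by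
    have h1 : Real.sqrt N ≤ N := by
      rw [Real.sqrt_le_left (by positivity)]; nlinarith
    have hx : 1 ≤ N / δ := by rw [le_div_iff₀ hδ]; linarith
    have h2 : 2 * Real.sqrt N / (δ / 2) ≤ 4 * (N / δ) := by
      rw [div_le_iff₀ (by positivity)]
      have : 4 * (N / δ) * (δ / 2) = 2 * N := by field_simp; norm_num
      linarith
    have h3 : δ * Real.exp (3 * Λ) = 8 * (N * (N / δ) ^ 2) := by
      have : Real.exp (3 * Λ) = Real.exp Λ ^ 3 := by rw [← Real.exp_nat_mul, Nat.cast_ofNat]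
      rw [this, hexp]; field_simp; norm_num
    have h4 : (N / δ : ℝ) ≤ N * (N / δ) ^ 2 := by nlinarith [mul_le_mul hN' hx]
    linarith
  have hK : (0 : ℝ) ≤ K := Nat.cast_nonneg K
  calc Real.exp κ * (1 + 2 * Real.sqrt N / (δ / 2))
      ≤ Real.exp (C * d * (2 * Λ)) * (δ * Real.exp (3 * Λ)) := by
        gcongr
        exact hκ.trans (by gcongr)
    _ = δ * Real.exp (C * d * (2 * Λ) + 3 * Λ) := by rw [Real.exp_add]; ring
    _ ≤ _ := by
        gcongr
        rw [mul_div_cancel₀ _ (by positivity)]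
        have h1 : 0 ≤ (2 * C + 3) * K * Λ := by positivity
        have h2 : 0 ≤ (d - 1) * Λ := mul_nonneg (by linarith) (by linarith)
        linarith

theorem highProb_riskBound_sym {d K N : ℕ} {D : Measure (Example d)} [IsProbabilityMeasure D]
    {σβ C δ : ℝ} (hd : 1 ≤ d) (hN : 1 ≤ N) (hσβ : 0 < σβ) (hC : 0 < C) (hδ : 0 < δ) (hδ1 : δ < 1)
    {post : (Fin N → Example d) → Measure (Feature d)} {κ : (Fin N → Example d) → ℝ}
    (hpost : ∀ S, TiltEstimate (symPrior d σβ) (post S) (κ S))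
    (hκ : HighProb (sampleLaw D N) (δ / 2) fun S => κ S ≤ C * d * Real.log (2 * N / (δ / 2))) :
    HighProb (sampleLaw D N) δ fun S =>
      RiskBound D S linearScore (post S) δ (symRate (2 * C + 3) d K N δ) := by
  have hN' : (1 : ℝ) ≤ N := by exact_mod_cast hN
  have hd' : (1 : ℝ) ≤ d := by exact_mod_cast hd
  have hΛ := half_le_log_two_mul_div hN hδ hδ1
  have := (isIsotropicGaussian_symPrior d hσβ).prob
  have hgap := measure_gapMoment_ge_le D (measurable_uncurry_linearScore d) (symPrior d σβ) hN
    (half_pos hδ)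
  refine le_trans (measure_mono fun S hS => ?_) ((measure_union_le _ _).trans
      ((add_le_add hκ hgap).trans (le_of_eq ?_)))
  · by_contra hcon
    simp only [Set.mem_union, Set.mem_ofPred_eq, not_or, not_lt, not_le] at hcon
    exact hS (riskBound_of_gapMoment_lt D (measurable_uncurry_linearScore d) (hpost S) hN hδ1
      (by positivity) (Real.sqrt_pos.2 (by positivity)) S hcon.2
      (exp_mul_one_add_le hd hN hδ hδ1 hC hcon.1))
  · rw [← ENNReal.ofReal_add (by positivity) (by positivity)]; congr 1; ring

theorem riskBound_of_forall_le {d N : ℕ} {Θ : Type} [MeasurableSpace Θ]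
    (D : Measure (Example d)) [IsProbabilityMeasure D] {f : Θ → Feature d → ℝ}
    (hf : Measurable (Function.uncurry f)) (post : Measure Θ) [IsProbabilityMeasure post]
    (S : Fin N → Example d) {δ r : ℝ} (h : ∀ θ, risk D f θ ≤ empRisk S f θ + r) :
    RiskBound D S f post δ r := by
  constructor
  · have h2 := integrable_empRisk S hf post
    have := integral_mono (integrable_risk D hf post) (h2.add (integrable_const r)) h
    simpa [integral_add h2 (integrable_const r)] using this
  · simp [h]

/-- In R the score has slope −1, so the gradients are ±1 and their squares sum to N for every
sample. Hence neither the embeddings nor their dimension appear. -/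
theorem tiltBound_asym_le {d N : ℕ} (hN : 1 ≤ N) {σR : ℝ} (hσ : 0 < σR) (μR m : ℝ)
    (S : Fin N → Example d) :
    tiltBound μR m σR (fun i => -signedLabel (S i).2) ≤
      (3 / 2 / σR ^ 2 + 3 + σR ^ 2) * (Real.log (2 * N) + (m - μR) ^ 2) := by
  have hN' : (1 : ℝ) ≤ N := by exact_mod_cast hN
  have hL : 1 / 2 ≤ Real.log (2 * N) := by
    have := Real.log_le_log two_pos (show (2 : ℝ) ≤ 2 * N by linarith)
    linarith [Real.log_two_gt_d9]
  have hsum : ∑ i, ‖-signedLabel (S i).2‖ ^ 2 = N := by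
    simp [signedLabel_sq]
  have hlog : Real.log (1 + σR ^ 2 * N / 4) ≤ Real.log (2 * N) + σR ^ 2 := by
    have h1 : 1 + σR ^ 2 * N / 4 ≤ 2 * N * (1 + σR ^ 2) := by nlinarith [sq_nonneg σR]
    have h2 := Real.log_le_log (by positivity) h1
    rw [Real.log_mul (by positivity) (by positivity)] at h2
    have h3 := Real.log_le_sub_one_of_pos (show 0 < 1 + σR ^ 2 by positivity)
    linarith
  unfold tiltBound
  rw [hsum, Module.finrank_self, Nat.cast_one, mul_one, Real.norm_eq_abs, sq_abs]
  have hs : 0 < σR ^ 2 := by positivity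
  have h4 : 3 / 2 * (m - μR) ^ 2 / σR ^ 2 = 3 / 2 / σR ^ 2 * (m - μR) ^ 2 := by ring
  rw [h4]
  have h5 : 0 ≤ 3 / 2 / σR ^ 2 * Real.log (2 * N) := by positivity
  have h6 : 0 ≤ (3 + σR ^ 2) * (m - μR) ^ 2 := by positivity
  nlinarith

theorem asymRate_mono {C C' : ℝ} (h : C ≤ C') {N : ℕ} (hN : 1 ≤ N) {δ : ℝ} (hδ : 0 < δ)
    (hδ1 : δ < 1) : asymRate C N δ ≤ asymRate C' N δ := by
  have := half_le_log_two_mul_div hN hδ hδ1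
  unfold asymRate
  gcongr

theorem exists_asymRate_lt_symRate {C C' η : ℝ} (hC : 0 < C) (hη : 0 < η) :
    ∃ n₀ : ℕ, ∀ (d K N : ℕ) (δ : ℝ), n₀ ≤ d + K → 1 ≤ N → 0 < δ → δ < 1 →
      asymRate C' N δ < η * symRate C d K N δ := by
  -- Squaring the inequality reduces it to C' < η²C(d + K); the 0 in the maximum ensures d + K > 0.
  obtain ⟨n₀, hn⟩ := exists_nat_gt (max (C' / (η ^ 2 * C)) 0)
  refine ⟨n₀, fun d K N δ hdK hN hδ hδ1 => ?_⟩
  have hΛ := half_le_log_two_mul_div hN hδ hδ1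
  have hN' : (1 : ℝ) ≤ N := by exact_mod_cast hN
  have hdK' : (n₀ : ℝ) ≤ d + K := by exact_mod_cast hdK
  have h1 := (le_max_right _ _).trans_lt hn
  have h2 := (le_max_left _ _).trans_lt hn
  rw [div_lt_iff₀ (by positivity)] at h2
  have h3 : C' < η ^ 2 * (C * ((d : ℝ) + K)) := by
    have : 0 < η ^ 2 * C := by positivity
    nlinarith
  have hdK0 : (0 : ℝ) < d + K := by linarith
  have h4 : η * symRate C d K N δ =
      Real.sqrt (η ^ 2 * (C * ((d : ℝ) + K)) * Real.log (2 * N / δ) / N) := by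
    rw [symRate, mul_assoc (η ^ 2), mul_div_assoc (η ^ 2), Real.sqrt_mul (by positivity),
      Real.sqrt_sq hη.le]
  rw [h4, asymRate, Real.sqrt_lt_sqrt_iff_of_pos (by positivity)]
  gcongr

end AsyIRM

theorem mainTheorem1 :
    -- symmetric IRM: hyperplane classifier
    (∀ p₀ σ₀ ε σβ M : ℝ, 0 < p₀ → p₀ < 1 → 0 < σ₀ → 0 < ε → 0 < σβ → 0 < M →
      ∃ C : ℝ, 0 < C ∧
        ∀ (d K N : ℕ) (w : Fin K → ℝ) (μ : Fin K → Feature d) (δ : ℝ),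
          1 ≤ d → 1 ≤ N → (∀ k, 0 ≤ w k) → ∑ k, w k = 1 → (∀ k, ‖μ k‖ ≤ M * Real.sqrt d) →
          0 < δ → δ < 1 →
          ∀ post ∈ ({bayesPosterior (symPrior d σβ) linearScore, symLaplace σβ} :
              Set ((Fin N → Example d) → Measure (Feature d))),
            HighProb (sampleLaw (dataLaw p₀ σ₀ ε w μ) N) δ (fun S =>
              klDiv (post S) (symPrior d σβ) ≤
                ENNReal.ofReal (C * ((d : ℝ) + K) * Real.log (2 * N / δ))) ∧
            HighProb (sampleLaw (dataLaw p₀ σ₀ ε w μ) N) δ (fun S =>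
              PACBayesBound (dataLaw p₀ σ₀ ε w μ) S linearScore (post S) (symPrior d σβ) δ) ∧
            HighProb (sampleLaw (dataLaw p₀ σ₀ ε w μ) N) δ (fun S =>
              RiskBound (dataLaw p₀ σ₀ ε w μ) S linearScore (post S) δ (symRate C d K N δ))) ∧
    -- AsyIRM: radial classifier
    (∀ σR : ℝ, 0 < σR →
      ∃ C : ℝ, 0 < C ∧
        ∀ (d K N : ℕ) (p₀ σ₀ ε μR : ℝ) (w : Fin K → ℝ) (μ : Fin K → Feature d) (δ : ℝ) (q : ℕ),
          1 ≤ d → 1 ≤ N → 0 < p₀ → p₀ < 1 → 0 < σ₀ → 0 < ε → (∀ k, 0 ≤ w k) → ∑ k, w k = 1 →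
          0 < δ → δ < 1 → (q = 1 ∨ q = 2) →
          ∀ post ∈ ({bayesPosterior (asymPrior μR σR) (radialScore q), asymLaplace q μR σR} :
              Set ((Fin N → Example d) → Measure ℝ)),
            (∀ S : Fin N → Example d, klDiv (post S) (asymPrior μR σR) ≤
              ENNReal.ofReal (C * (Real.log (2 * N) + (asymMAP q μR σR S - μR) ^ 2))) ∧
            HighProb (sampleLaw (dataLaw p₀ σ₀ ε w μ) N) δ (fun S =>
              PACBayesBound (dataLaw p₀ σ₀ ε w μ) S (radialScore q) (post S)
                (asymPrior μR σR) δ) ∧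
            HighProb (sampleLaw (dataLaw p₀ σ₀ ε w μ) N) δ (fun S =>
              RiskBound (dataLaw p₀ σ₀ ε w μ) S (radialScore q) (post S) δ (asymRate C N δ))) ∧
    -- strictly better scaling of the second bound, whatever the constants
    (∀ C C' η : ℝ, 0 < C → 0 < C' → 0 < η → ∃ n₀ : ℕ, ∀ (d K N : ℕ) (δ : ℝ),
      n₀ ≤ d + K → 1 ≤ N → 0 < δ → δ < 1 → asymRate C' N δ < η * symRate C d K N δ) := by
  refine ⟨fun p₀ σ₀ ε σβ M hp0 hp1 hσ₀ hε hσβ _ => ?_, fun σR hσR => ?_,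
    fun C C' η hC _ hη => exists_asymRate_lt_symRate hC hη⟩
  · obtain ⟨C, hC, hκ⟩ := exists_tiltBound_sym (M := M) hp0 hp1 hσ₀ hε hσβ
    refine ⟨2 * C + 3, by positivity,
      fun d K N w μ δ hd hN hw hw1 hμ hδ hδ1 post hpost => ?_⟩
    have := isProbabilityMeasure_dataLaw σ₀ ε μ hp0 hp1 hw hw1
    have := (isIsotropicGaussian_symPrior d hσβ).prob
    have hest := tiltEstimate_sym hd hσβ hpost
    refine ⟨?_, highProb_pacBayesBound _ (measurable_uncurry_linearScore d) _ hest hN hδ hδ1,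
      highProb_riskBound_sym hd hN hσβ hC hδ hδ1 hest
        -- Half of δ goes to the divergence bound; the other half goes to the gap moment.
        (hκ d K N w μ (δ / 2) hd hN hw hw1 hμ (half_pos hδ) (by linarith))⟩
    refine (hκ d K N w μ δ hd hN hw hw1 hμ hδ hδ1).mono fun S hS => ?_
    have hΛ := half_le_log_two_mul_div hN hδ hδ1
    refine (hest S).klDiv_le.trans (ENNReal.ofReal_le_ofReal (hS.trans ?_))
    gcongr
    · linarith
    · exact le_add_of_nonneg_right (Nat.cast_nonneg K)
  -- The first three terms serve the divergence bound, the 32 the uniform deviation bound.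
  · refine ⟨3 / 2 / σR ^ 2 + 3 + σR ^ 2 + 32, by positivity,
      fun d K N p₀ σ₀ ε μR w μ δ q hd hN hp0 hp1 _ _ hw hw1 hδ hδ1 _ post hpost => ?_⟩
    have := isProbabilityMeasure_dataLaw σ₀ ε μ hp0 hp1 hw hw1
    have := (isIsotropicGaussian_asymPrior μR hσR).prob
    have hest := tiltEstimate_asym q μR hσR hpost
    refine ⟨fun S => (hest S).klDiv_le.trans (ENNReal.ofReal_le_ofReal
        ((tiltBound_asym_le hN hσR μR _ S).trans ?_)),
      highProb_pacBayesBound _ (measurable_uncurry_radialScore d q) _ hest hN hδ hδ1, ?_⟩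
    · have hL : 0 ≤ Real.log (2 * N) := Real.log_nonneg (by
        have : (1 : ℝ) ≤ N := by exact_mod_cast hN
        linarith)
      exact mul_le_mul_of_nonneg_right (by linarith) (by positivity)
    -- The bound holds for every R simultaneously, so the posterior is irrelevant and (m − μ)² does
    -- not occur in the rate.
    · refine (highProb_forall_radial_risk_le q _ hN hδ hδ1).mono fun S hS => ?_
      have := (hest S).prob
      have hrate := asymRate_mono (show (32 : ℝ) ≤ 3 / 2 / σR ^ 2 + 3 + σR ^ 2 + 32 by
        have : 0 ≤ 3 / 2 / σR ^ 2 + 3 + σR ^ 2 := by positivity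
        linarith) hN hδ hδ1
      exact riskBound_of_forall_le _ (measurable_uncurry_radialScore d q) _ S fun R =>
        (hS R).trans (by linarith)
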